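/- **Theorem.** Fix an integer $\mathcal S\ge 1$. For $N\ge1$, $\beta\ge 0$, $h\ge 0$, $\mathcal D\in\mathbb R$ consider on $\{0,\pm1,\dots,\pm\mathcal S\}^N$ the Ghatak–Sherrington Hamiltonian $$H_N(\sigma)=\frac{\beta}{\sqrt N}\sum_{1\le i<j\le N} g_{i,j}\sigma_i\sigma_j+\mathcal D\sum_{i=1}^N\sigma_i^2+h\sum_{i=1}^N\sigma_i,\qquad g_{i,j}\ \text{i.i.d. } N(0,1),$$ let $\langle\cdot\rangle$ be the average over independent replicas $\sigma^1,\sigma^2,\dots$ drawn from the Gibbs measure with weights proportional to $e^{H_N(\sigma)}$, and let $\nu(\cdot)=\mathbb E\langle\cdot\rangle$, where $\mathbb E$ is the expectation over the $g_{i,j}$. Put $R_{k,l}=\frac1N\sum_i\sigma^k_i\sigma^l_i$, $b_i=\langle\sigma_i\rangle$, $\tilde b_i=\langle\sigma_i^2\rangle$ and $$T_1=\frac1N\sum_{i=1}^N(\sigma^1_i-b_i)b_i,\qquad S_1=\frac1N\sum_{i=1}^N\big((\sigma^1_i)^2-\tilde b_i\big).$$ For real $p,q$ (the square root below being read as $0$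 if $q<0$) and a function $f$ of finitely many spins $\epsilon_1,\epsilon_2,\dots\in\{0,\pm1,\dots,\pm\mathcal S\}$, let $\nu_0(f)=\mathbb E_\eta\langle f\rangle_0$, where $\eta\sim N(0,1)$ and, given $\eta$, the $\epsilon_k$ are independent under $\langle\cdot\rangle_0$, each taking the value $x$ with probability proportional to $$\exp\Big(\beta\eta\sqrt q\,x+\tfrac{\beta^2}{2}(p-q)x^2+\mathcal D x^2+hx\Big).$$ (This is the law of the last spins of the replicas at time $0$ of the cavity interpolation.) Set $$D=\nu_0((\epsilon_1^2-\epsilon_2^2)\epsilon_1^2),\quad E=\nu_0((\epsilon_1^2-\epsilon_2^2)\epsilon_1\epsilon_3),\quad F=\nu_0((\epsilon_1\epsilon_3-\epsilon_2\epsilon_3)\epsilon_1\epsilon_3),\quad G=\nu_0((\epsilon_1\epsilon_3-\epsilon_2\epsilon_3)\epsilon_1\epsilon_4),$$ $$M_1=1-\beta^2(F-3G),\quad M_2=1-\tfrac{\beta^2}{2}D,\quad M_3=1-\beta^2(F-G),\quad M=M_1M_2+\beta^4E^2 .$$ There is $\beta'>0$, depending only on $\mathcal S$, such that for all $0\le\beta<\beta'$,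 $h\ge0$ and $\mathcal D\in\mathbb R$ the system $p=\nu_0(\epsilon_1^2)$, $q=\nu_0(\epsilon_1\epsilon_2)$ has a unique solution $(p,q)\in\mathbb R^2$, and for this solution the following hold. The overlaps concentrate, $\nu((R_{1,2}-q)^2)=O_N(2)$ and $\nu((R_{1,1}-p)^2)=O_N(2)$; the numbers $M_1,M_2,M_3,M$ are positive; and $$\nu(T_1^2)=A_1^2+O_N(3),\qquad \nu(S_1^2)=B_1^2+O_N(3),\qquad \nu(S_1T_1)=C_1^2+O_N(3),$$ where $$A_1^2=\frac{GM_2+\frac{\beta^2}{2}E^2}{M}\cdot\frac1{NM_3},\qquad B_1^2=\frac{DM_1-2\beta^2E^2}{NM},\qquad C_1^2=\frac{E}{NM},$$ and, if $\beta>0$, $$A_1^2=\frac1{2\beta^2N}\Big(\frac1{M_3}-\frac{M_2}{M}\Big),\qquad B_1^2=\frac{2}{N\beta^2}\Big(\frac{M_1}{M}-1\Big).$$ Here $a_N=O_N(H)$ means that $|a_N|\le K N^{-H/2}$ for all $N\ge1$ with a constant $K$ that does not depend on $N$ (it may depend on $\mathcal S,\beta,h,\mathcal D$). -/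

import Mathlib

open MeasureTheory ProbabilityTheory

noncomputable section

namespace GhatakSherrington

/-- The single-spin space `{0, ±1, …, ±S}`. -/
abbrev Spin (S : ℕ) : Type := ↥(Finset.Icc (-(S : ℤ)) (S : ℤ))

/-- The real value of a spin. -/
def sv {S : ℕ} (x : Spin S) : ℝ := ((x : ℤ) : ℝ)

/-- Configurations of `N` spins. -/
abbrev Config (N S : ℕ) : Type := Fin N → Spin S

/-- The pairs of sites `i < j`. -/
abbrev Edge (N : ℕ) : Type := {e : Fin N × Fin N // e.1 < e.2}

/-- A realization of the couplings `g i j`, `i < j`. -/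
abbrev Disorder (N : ℕ) : Type := Edge N → ℝ

/-- The law of the disorder: i.i.d. standard Gaussians. -/
def disorderLaw (N : ℕ) : Measure (Disorder N) :=
  Measure.pi fun _ : Edge N => gaussianReal 0 1

/-- The Hamiltonian, with inverse temperature `β`, external field `h`, crystal field `cr`. -/
def hamiltonian (N S : ℕ) (β h cr : ℝ) (g : Disorder N) (σ : Config N S) : ℝ :=
  β / √(N : ℝ) * ∑ e : Edge N, g e * sv (σ e.1.1) * sv (σ e.1.2)
    + cr * ∑ i, sv (σ i) ^ 2 + h * ∑ i, sv (σ i)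

/-- The partition function. -/
def partitionFn (N S : ℕ) (β h cr : ℝ) (g : Disorder N) : ℝ :=
  ∑ σ : Config N S, Real.exp (hamiltonian N S β h cr g σ)

/-- The Gibbs probability of a configuration. -/
def gibbs (N S : ℕ) (β h cr : ℝ) (g : Disorder N) (σ : Config N S) : ℝ :=
  Real.exp (hamiltonian N S β h cr g σ) / partitionFn N S β h cr g

/-- The Gibbs average `⟨f⟩` of a function of `n` independent replicas (for fixed disorder). -/
def gibbsAvg (N S : ℕ) (β h cr : ℝ) {n : ℕ} (g : Disorder N)
    (f : (Fin n → Config N S) → ℝ) : ℝ :=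
  ∑ σ : Fin n → Config N S, f σ * ∏ k, gibbs N S β h cr g (σ k)

/-- `ν(f) = E⟨f⟩`; the function of the replicas may itself depend on the disorder. -/
def nu (N S : ℕ) (β h cr : ℝ) {n : ℕ}
    (f : Disorder N → (Fin n → Config N S) → ℝ) : ℝ :=
  ∫ g, gibbsAvg N S β h cr g (f g) ∂(disorderLaw N)

/-- The overlap `R k l`; for `k = l` the self-overlap. -/
def overlap {N S n : ℕ} (σ : Fin n → Config N S) (k l : Fin n) : ℝ :=
  1 / (N : ℝ) * ∑ i, sv (σ k i) * sv (σ l i)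

/-- `b i = ⟨σ i⟩`, the quenched mean of the spin at site `i`. -/
def quenchedMean (N S : ℕ) (β h cr : ℝ) (g : Disorder N) (i : Fin N) : ℝ :=
  gibbsAvg N S β h cr (n := 1) g fun σ => sv (σ 0 i)

/-- `b̃ i = ⟨(σ i)²⟩`, the quenched second moment of the spin at site `i`. -/
def quenchedSq (N S : ℕ) (β h cr : ℝ) (g : Disorder N) (i : Fin N) : ℝ :=
  gibbsAvg N S β h cr (n := 1) g fun σ => sv (σ 0 i) ^ 2

/-- `T k = N⁻¹ ∑ i, (σᵏ i - b i) * b i`. -/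
def compT (N S : ℕ) (β h cr : ℝ) {n : ℕ} (k : Fin n) (g : Disorder N)
    (σ : Fin n → Config N S) : ℝ :=
  1 / (N : ℝ) * ∑ i, (sv (σ k i) - quenchedMean N S β h cr g i) * quenchedMean N S β h cr g i

/-- `S k = N⁻¹ ∑ i, ((σᵏ i)² - b̃ i)`. -/
def compS (N S : ℕ) (β h cr : ℝ) {n : ℕ} (k : Fin n) (g : Disorder N)
    (σ : Fin n → Config N S) : ℝ :=
  1 / (N : ℝ) * ∑ i, (sv (σ k i) ^ 2 - quenchedSq N S β h cr g i)

/-- The Hamiltonian of the decoupled last spin (interpolation time `0`), given the Gaussian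
variable `η` that replaces its interaction with the other spins. -/
def lastHamiltonian (S : ℕ) (β h cr p q : ℝ) (η : ℝ) (x : Spin S) : ℝ :=
  sv x * (β * η * √q) + β ^ 2 / 2 * (p - q) * sv x ^ 2 + cr * sv x ^ 2 + h * sv x

/-- The Gibbs probability of a value of the decoupled last spin. -/
def lastGibbs (S : ℕ) (β h cr p q : ℝ) (η : ℝ) (x : Spin S) : ℝ :=
  Real.exp (lastHamiltonian S β h cr p q η x) /
    ∑ y : Spin S, Real.exp (lastHamiltonian S β h cr p q η y)

/-- `ν₀(f)` for a function `f` of the last spins of `n` replicas. At time `0` the last spin is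
decoupled from the other spins, so only its own Gibbs measure and the average over `η` enter. -/
def nu0 (S : ℕ) (β h cr p q : ℝ) {n : ℕ} (f : (Fin n → ℝ) → ℝ) : ℝ :=
  ∫ η, ∑ ε : Fin n → Spin S,
    f (fun k => sv (ε k)) * ∏ k, lastGibbs S β h cr p q η (ε k) ∂(gaussianReal 0 1)

/-- The replica-symmetric equations `p = ν₀(ε₁²)`, `q = ν₀(ε₁ ε₂)`. -/
def IsReplicaSymmetric (S : ℕ) (β h cr p q : ℝ) : Prop :=
  p = nu0 S β h cr p q (n := 1) (fun ε => ε 0 ^ 2) ∧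
  q = nu0 S β h cr p q (n := 2) (fun ε => ε 0 * ε 1)

/-- `D = ν₀((ε₁² - ε₂²) ε₁²)`. -/
def cD (S : ℕ) (β h cr p q : ℝ) : ℝ :=
  nu0 S β h cr p q (n := 2) fun ε => (ε 0 ^ 2 - ε 1 ^ 2) * ε 0 ^ 2

/-- `E = ν₀((ε₁² - ε₂²) ε₁ ε₃)`. -/
def cE (S : ℕ) (β h cr p q : ℝ) : ℝ :=
  nu0 S β h cr p q (n := 3) fun ε => (ε 0 ^ 2 - ε 1 ^ 2) * (ε 0 * ε 2)

/-- `F = ν₀((ε₁ ε₃ - ε₂ ε₃) ε₁ ε₃)`. -/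
def cF (S : ℕ) (β h cr p q : ℝ) : ℝ :=
  nu0 S β h cr p q (n := 3) fun ε => (ε 0 * ε 2 - ε 1 * ε 2) * (ε 0 * ε 2)

/-- `G = ν₀((ε₁ ε₃ - ε₂ ε₃) ε₁ ε₄)`. -/
def cG (S : ℕ) (β h cr p q : ℝ) : ℝ :=
  nu0 S β h cr p q (n := 4) fun ε => (ε 0 * ε 2 - ε 1 * ε 2) * (ε 0 * ε 3)

def M1 (S : ℕ) (β h cr p q : ℝ) : ℝ :=
  1 - β ^ 2 * (cF S β h cr p q - 3 * cG S β h cr p q)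

def M2 (S : ℕ) (β h cr p q : ℝ) : ℝ :=
  1 - β ^ 2 / 2 * cD S β h cr p q

def M3 (S : ℕ) (β h cr p q : ℝ) : ℝ :=
  1 - β ^ 2 * (cF S β h cr p q - cG S β h cr p q)

def M0 (S : ℕ) (β h cr p q : ℝ) : ℝ :=
  M1 S β h cr p q * M2 S β h cr p q + β ^ 4 * cE S β h cr p q ^ 2

/-- The constant `A₁²` (it depends on `N` through the factor `1 / N`). -/
def A1sq (N S : ℕ) (β h cr p q : ℝ) : ℝ :=
  (cG S β h cr p q * M2 S β h cr p q + β ^ 2 / 2 * cE S β h cr p q ^ 2) / M0 S β h cr p q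
    * (1 / ((N : ℝ) * M3 S β h cr p q))

/-- The constant `B₁²`. -/
def B1sq (N S : ℕ) (β h cr p q : ℝ) : ℝ :=
  (cD S β h cr p q * M1 S β h cr p q - 2 * β ^ 2 * cE S β h cr p q ^ 2)
    / ((N : ℝ) * M0 S β h cr p q)

/-- The constant `C₁²`. -/
def C1sq (N S : ℕ) (β h cr p q : ℝ) : ℝ :=
  cE S β h cr p q / ((N : ℝ) * M0 S β h cr p q)

/-- `a = O_N(H)`: `|a N| ≤ K * N ^ (-H / 2)` with `K` independent of `N`. -/
def IsON (H : ℕ) (a : ℕ → ℝ) : Prop :=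
  ∃ K : ℝ, ∀ N : ℕ, 1 ≤ N → |a N| ≤ K * (N : ℝ) ^ (-(H : ℝ) / 2)

end GhatakSherrington

end

/-!
The proof is the cavity method with a Gaussian interpolation, for small `β`.

*Interpolation.* For a Gaussian Hamiltonian on a finite space which depends smoothly on a
parameter, the derivative of the average of a function of `n` replicas is an average over `n + 2`
replicas (`hasDerivAt_gaussAvg`): the derivative of the Gibbs measure brings in one replica, and
Gaussian integration by parts (`integral_mul_stdGaussian`) another one. All paths are parametrized
by an angle `θ ∈ [0, π / 2]` with interpolation time `sin² θ`, which keeps them differentiable at both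
ends. Applied to the single-spin measure, the formula shows that the map behind the
replica-symmetric equations is a contraction (`contracting_rsMap`), so that `(p, q)` exists and is
unique.

*Cavity path.* For each site `i` the couplings at `i` are replaced by an independent Gaussian field,
so that at time `0` the spin at `i` is independent of the other ones and has the law of `ν₀`
(`cavityAvg_zero_mul`). The derivative along the path carries a factor
`β² εₖ εₗ (R⁻ₖₗ - r)`, where `R⁻` is the overlap without the site `i` and `r` is `p` or `q`
(`hasDerivAt_cavityAvg`); every step of the expansion therefore gains one power of the deviation of
the overlaps. No symmetry between the sites is used, the expansion is made at each site and then
averaged.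

*Concentration.* One factor of `(R - r) ^ (s + 2)` is a mean over the sites of `εₖ εₗ - r`. Its
average at time `0` vanishes by the replica-symmetric equations, and the remainder is a small
multiple of the moment itself plus a lower moment divided by `N` (`fullAvg_pow_le`). Hence the
moments of order `m ≤ 4` of the deviations are `O(N ^ (-m / 2))` (`exists_overlapMoment_le`).

*Linear system.* The second moments of `T₁` and `S₁` and their mixed moment are differences of
overlap covariances (`nu_compT_sq`, `nu_compS_sq`, `nu_compS_mul_compT`). A first-order cavity
expansion of `ν(a(ε) (R - r))`, for a function `a` of the last spins with `ν₀(a) = 0`, expresses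
such a difference through all overlap covariances up to `O(N ^ (-3 / 2))`
(`exists_cavity_expansion_sum`). With `a = ε₁² - ε₂²` and `a = (ε₁ - ε₂) ε₃` the coefficients are
`D`, `E`, `F`, `G` and most terms cancel: four linear equations remain for the three moments and one
auxiliary difference. Their determinants are `M₃`, `M` and `M₂`, which are positive for small `β`,
and the solution (`solve_system`) is `A₁²`, `B₁²`, `C₁²`.
-/

noncomputable section

namespace GhatakSherrington

/-! ### Gibbs averages over replicas -/

section Replicas

variable {Ω : Type*} [Fintype Ω] {m n : ℕ}

/-- The Gibbs probability of `σ` for the Hamiltonian `H` on a finite space. -/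
def gibbsWeight (H : Ω → ℝ) (σ : Ω) : ℝ := Real.exp (H σ) / ∑ τ, Real.exp (H τ)

/-- The average of a function of `n` independent replicas drawn from the Gibbs measure of `H`. -/
def replicaAvg (H : Ω → ℝ) (f : (Fin n → Ω) → ℝ) : ℝ :=
  ∑ σ : Fin n → Ω, f σ * ∏ k, gibbsWeight H (σ k)

lemma gibbsWeight_nonneg (H : Ω → ℝ) (σ : Ω) : 0 ≤ gibbsWeight H σ := by
  unfold gibbsWeight; positivity

lemma sum_exp_pos [Nonempty Ω] (H : Ω → ℝ) : 0 < ∑ τ, Real.exp (H τ) :=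
  Finset.sum_pos (fun _ _ => Real.exp_pos _) Finset.univ_nonempty

lemma sum_gibbsWeight [Nonempty Ω] (H : Ω → ℝ) : ∑ σ, gibbsWeight H σ = 1 := by
  unfold gibbsWeight
  rw [← Finset.sum_div, div_self (sum_exp_pos H).ne']

/-- The average of a product of functions of the single replicas factorizes. -/
lemma replicaAvg_prod (H : Ω → ℝ) (φ : Fin n → Ω → ℝ) :
    replicaAvg H (fun σ => ∏ k, φ k (σ k)) = ∏ k, ∑ x, φ k x * gibbsWeight H x := by
  unfold replicaAvg
  simp_rw [← Finset.prod_mul_distrib]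
  rw [Fintype.prod_sum]

lemma replicaAvg_add (H : Ω → ℝ) (f g : (Fin n → Ω) → ℝ) :
    replicaAvg H (fun σ => f σ + g σ) = replicaAvg H f + replicaAvg H g := by
  simp only [replicaAvg, add_mul, Finset.sum_add_distrib]

lemma replicaAvg_sub (H : Ω → ℝ) (f g : (Fin n → Ω) → ℝ) :
    replicaAvg H (fun σ => f σ - g σ) = replicaAvg H f - replicaAvg H g := by
  simp only [replicaAvg, sub_mul, Finset.sum_sub_distrib]

lemma replicaAvg_const_mul (H : Ω → ℝ) (c : ℝ) (f : (Fin n → Ω) → ℝ) :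
    replicaAvg H (fun σ => c * f σ) = c * replicaAvg H f := by
  simp only [replicaAvg, mul_assoc, Finset.mul_sum]

lemma replicaAvg_sum {ι : Type*} (s : Finset ι) (H : Ω → ℝ) (f : ι → (Fin n → Ω) → ℝ) :
    replicaAvg H (fun σ => ∑ j ∈ s, f j σ) = ∑ j ∈ s, replicaAvg H (f j) := by
  simp only [replicaAvg, Finset.sum_mul]
  rw [Finset.sum_comm]

lemma sum_prod_gibbsWeight [Nonempty Ω] {κ : Type*} [Fintype κ] [DecidableEq κ] (H : Ω → ℝ) :
    ∑ σ : κ → Ω, ∏ k, gibbsWeight H (σ k) = 1 := by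
  rw [← Fintype.prod_sum (f := fun (_ : κ) (x : Ω) => gibbsWeight H x)]
  simp [sum_gibbsWeight]

lemma replicaAvg_const [Nonempty Ω] (H : Ω → ℝ) (c : ℝ) :
    replicaAvg H (fun _ : Fin n → Ω => c) = c := by
  rw [replicaAvg, ← Finset.mul_sum, sum_prod_gibbsWeight, mul_one]

lemma replicaAvg_mono (H : Ω → ℝ) {f g : (Fin n → Ω) → ℝ} (h : ∀ σ, f σ ≤ g σ) :
    replicaAvg H f ≤ replicaAvg H g :=
  Finset.sum_le_sum fun σ _ => mul_le_mul_of_nonneg_right (h σ)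
    (Finset.prod_nonneg fun _ _ => gibbsWeight_nonneg _ _)

lemma replicaAvg_nonneg (H : Ω → ℝ) {f : (Fin n → Ω) → ℝ} (h : ∀ σ, 0 ≤ f σ) :
    0 ≤ replicaAvg H f :=
  Finset.sum_nonneg fun σ _ => mul_nonneg (h σ)
    (Finset.prod_nonneg fun _ _ => gibbsWeight_nonneg _ _)

lemma abs_replicaAvg_le (H : Ω → ℝ) (f : (Fin n → Ω) → ℝ) :
    |replicaAvg H f| ≤ replicaAvg H (fun σ => |f σ|) := by
  refine (Finset.abs_sum_le_sum_abs _ _).trans (le_of_eq (Finset.sum_congr rfl fun σ _ => ?_))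
  rw [abs_mul, abs_of_nonneg (Finset.prod_nonneg fun _ _ => gibbsWeight_nonneg _ _)]

lemma abs_replicaAvg_le_of_bound [Nonempty Ω] (H : Ω → ℝ) {f : (Fin n → Ω) → ℝ} {B : ℝ}
    (h : ∀ σ, |f σ| ≤ B) : |replicaAvg H f| ≤ B :=
  (abs_replicaAvg_le H f).trans ((replicaAvg_mono H h).trans_eq (replicaAvg_const H B))

/-- Replicas on which a function does not depend may be added or removed, and the others
relabelled, without changing its average. -/
lemma replicaAvg_comp [Nonempty Ω] (H : Ω → ℝ) {φ : Fin n → Fin m} (hφ : Function.Injective φ)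
    (f : (Fin n → Ω) → ℝ) :
    replicaAvg H (fun σ : Fin m → Ω => f (σ ∘ φ)) = replicaAvg H f := by
  classical
  let e : Fin n ⊕ ↥(Set.range φ)ᶜ ≃ Fin m :=
    ((Equiv.ofInjective φ hφ).sumCongr (Equiv.refl _)).trans (Equiv.Set.sumCompl (Set.range φ))
  have he : ∀ k, e (Sum.inl k) = φ k := fun k => rfl
  let E : (Fin m → Ω) ≃ (Fin n → Ω) × (↥(Set.range φ)ᶜ → Ω) :=
    (Equiv.arrowCongr e.symm (Equiv.refl Ω)).trans (Equiv.sumArrowEquivProdArrow _ _ _)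
  have hE1 : ∀ σ : Fin m → Ω, (E σ).1 = σ ∘ φ := fun σ => rfl
  have hE2 : ∀ (σ : Fin m → Ω) c, (E σ).2 c = σ (e (Sum.inr c)) := fun σ c => rfl
  let G : (Fin n → Ω) × (↥(Set.range φ)ᶜ → Ω) → ℝ := fun x =>
    (f x.1 * ∏ k, gibbsWeight H (x.1 k)) * ∏ c, gibbsWeight H (x.2 c)
  have key : ∀ σ : Fin m → Ω, f (σ ∘ φ) * ∏ k, gibbsWeight H (σ k) = G (E σ) := by
    intro σ
    change _ = (f (E σ).1 * ∏ k, gibbsWeight H ((E σ).1 k)) * ∏ c, gibbsWeight H ((E σ).2 c)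
    rw [← Equiv.prod_comp e, Fintype.prod_sum_type]
    simp only [hE1, hE2, he, Function.comp, mul_assoc]
  unfold replicaAvg
  refine (Fintype.sum_equiv E _ G key).trans ?_
  rw [Fintype.sum_prod_type]
  refine Finset.sum_congr rfl fun x _ => ?_
  change ∑ y : ↥(Set.range φ)ᶜ → Ω, (f x * ∏ k, gibbsWeight H (x k)) *
    ∏ c, gibbsWeight H (y c) = _
  rw [← Finset.mul_sum, sum_prod_gibbsWeight, mul_one]

lemma replicaAvg_mul [Nonempty Ω] (H : Ω → ℝ) (f : (Fin n → Ω) → ℝ) (a : Ω → ℝ) :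
    replicaAvg H (fun τ : Fin (n + 1) → Ω => f (Fin.init τ) * a (τ (Fin.last n)))
      = replicaAvg H f * ∑ x, a x * gibbsWeight H x := by
  unfold replicaAvg
  rw [← Equiv.sum_comp (Fin.snocEquiv (fun _ => Ω)), Fintype.sum_prod_type, Finset.sum_comm,
    Finset.sum_mul]
  refine Finset.sum_congr rfl fun σ _ => ?_
  rw [Finset.mul_sum]
  refine Finset.sum_congr rfl fun x _ => ?_
  have h : Fin.init (Fin.snocEquiv (fun _ => Ω) (x, σ)) = σ := Fin.init_snoc _ _
  beta_reduce
  rw [h]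
  simp only [Fin.snocEquiv_apply, Fin.snoc_last, Fin.prod_univ_castSucc, Fin.snoc_castSucc]
  ring

/-- Two non-interacting systems: averages factorize. -/
lemma replicaAvg_prodMk {X Y : Type*} [Fintype X] [Fintype Y] (HX : X → ℝ) (HY : Y → ℝ)
    (f : (Fin n → X) → ℝ) (g : (Fin n → Y) → ℝ) :
    replicaAvg (fun z : X × Y => HX z.1 + HY z.2)
        (fun σ => f (fun k => (σ k).1) * g (fun k => (σ k).2))
      = replicaAvg HX f * replicaAvg HY g := by
  have hw : ∀ z : X × Y, gibbsWeight (fun z : X × Y => HX z.1 + HY z.2) z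
      = gibbsWeight HX z.1 * gibbsWeight HY z.2 := by
    intro z
    unfold gibbsWeight
    rw [Fintype.sum_prod_type, div_mul_div_comm, ← Real.exp_add, Finset.sum_mul_sum]
    simp_rw [Real.exp_add]
  unfold replicaAvg
  rw [← Equiv.sum_comp (Equiv.arrowProdEquivProdArrow (Fin n) (fun _ => X) (fun _ => Y)).symm,
    Fintype.sum_prod_type, Finset.sum_mul_sum]
  refine Finset.sum_congr rfl fun x _ => Finset.sum_congr rfl fun y _ => ?_
  simp only [hw, Finset.prod_mul_distrib, Equiv.arrowProdEquivProdArrow_symm_apply]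
  ring

/-- Transport of an average along a bijection of the single-replica spaces. -/
lemma replicaAvg_equiv {Ω' : Type*} [Fintype Ω'] (e : Ω ≃ Ω') (H : Ω' → ℝ)
    (f : (Fin n → Ω') → ℝ) :
    replicaAvg (fun σ => H (e σ)) (fun σ => f (fun k => e (σ k))) = replicaAvg H f := by
  unfold replicaAvg
  rw [← Equiv.sum_comp (Equiv.arrowCongr (Equiv.refl (Fin n)) e)]
  refine Finset.sum_congr rfl fun σ _ => ?_
  have : ∀ x, gibbsWeight (fun σ => H (e σ)) x = gibbsWeight H (e x) := by
    intro x; unfold gibbsWeight; rw [← Equiv.sum_comp e]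
  simp only [this]
  rfl

/-! ### Differentiation of Gibbs averages -/

/-- The weight of replica `k` in the derivative of an average over `n` replicas: the `n` given
replicas have weight `1`, the additional one has weight `-n`. -/
def replicaCoeff (n : ℕ) (k : Fin (n + 1)) : ℝ := if (k : ℕ) < n then 1 else -n

/-- The derivative, in the direction `a` of the Hamiltonian, of the average of `f` is the average
of `replicaDeriv a f`, a function of one more replica. -/
def replicaDeriv (a : Ω → ℝ) (f : (Fin n → Ω) → ℝ) (τ : Fin (n + 1) → Ω) : ℝ :=
  f (Fin.init τ) * ∑ k, replicaCoeff n k * a (τ k)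

@[simp] lemma replicaCoeff_castSucc (k : Fin n) : replicaCoeff n k.castSucc = 1 := by
  simp [replicaCoeff]

@[simp] lemma replicaCoeff_last : replicaCoeff n (Fin.last n) = -n := by
  simp [replicaCoeff]

lemma replicaAvg_replicaDeriv [Nonempty Ω] (H a : Ω → ℝ) (f : (Fin n → Ω) → ℝ) :
    replicaAvg H (replicaDeriv a f)
      = replicaAvg H (fun σ => f σ * ∑ k, a (σ k))
        - n * (replicaAvg H f * ∑ x, a x * gibbsWeight H x) := by
  have h1 : replicaDeriv a f = fun τ : Fin (n + 1) → Ω =>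
      (fun σ => f σ * ∑ k, a (σ k)) (τ ∘ Fin.castSucc)
        - n * (f (Fin.init τ) * a (τ (Fin.last n))) := by
    funext τ
    rw [replicaDeriv, Fin.sum_univ_castSucc]
    simp only [replicaCoeff_castSucc, replicaCoeff_last, Function.comp]
    change f (fun k => τ k.castSucc) * _ = f (fun k => τ k.castSucc) * _ -
      n * (f (fun k => τ k.castSucc) * _)
    simp only [one_mul]
    ring
  rw [h1, replicaAvg_sub, replicaAvg_const_mul, replicaAvg_mul,
    replicaAvg_comp H (Fin.castSucc_injective n) (fun σ => f σ * ∑ k, a (σ k))]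

lemma hasDerivAt_gibbsWeight [Nonempty Ω] {H : ℝ → Ω → ℝ} {H' : Ω → ℝ} {t : ℝ}
    (hH : ∀ σ, HasDerivAt (fun s => H s σ) (H' σ) t) (σ : Ω) :
    HasDerivAt (fun s => gibbsWeight (H s) σ)
      (gibbsWeight (H t) σ * (H' σ - ∑ x, H' x * gibbsWeight (H t) x)) t := by
  have hZ := (sum_exp_pos (H t)).ne'
  have hsum : HasDerivAt (fun s => ∑ τ, Real.exp (H s τ)) (∑ τ, Real.exp (H t τ) * H' τ) t :=
    HasDerivAt.fun_sum fun τ _ => (hH τ).exp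
  refine ((hH σ).exp.div hsum hZ).congr_deriv ?_
  unfold gibbsWeight
  simp_rw [mul_div_assoc']
  rw [← Finset.sum_div]
  have : ∑ x, H' x * Real.exp (H t x) = ∑ x, Real.exp (H t x) * H' x :=
    Finset.sum_congr rfl fun _ _ => mul_comm _ _
  rw [this]
  field_simp

lemma hasDerivAt_replicaAvg [Nonempty Ω] {H : ℝ → Ω → ℝ} {H' : Ω → ℝ} {t : ℝ}
    (hH : ∀ σ, HasDerivAt (fun s => H s σ) (H' σ) t) (f : (Fin n → Ω) → ℝ) :
    HasDerivAt (fun s => replicaAvg (H s) f) (replicaAvg (H t) (replicaDeriv H' f)) t := by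
  have h1 : ∀ σ : Fin n → Ω, HasDerivAt (fun s => f σ * ∏ k, gibbsWeight (H s) (σ k))
      (f σ * ((∏ k, gibbsWeight (H t) (σ k)) *
        ∑ k, (H' (σ k) - ∑ x, H' x * gibbsWeight (H t) x))) t := by
    intro σ
    refine HasDerivAt.const_mul _ ?_
    have := HasDerivAt.fun_finsetProd (u := Finset.univ)
      (f := fun (k : Fin n) s => gibbsWeight (H s) (σ k)) (x := t)
      fun k _ => hasDerivAt_gibbsWeight hH (σ k)
    refine this.congr_deriv ?_
    rw [Finset.mul_sum]
    refine Finset.sum_congr rfl fun k _ => ?_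
    rw [smul_eq_mul, ← mul_assoc, Finset.prod_erase_mul _ _ (Finset.mem_univ k)]
  refine (HasDerivAt.fun_sum fun σ _ => h1 σ).congr_deriv ?_
  rw [replicaAvg_replicaDeriv]
  simp only [replicaAvg, Finset.sum_sub_distrib, Finset.sum_const, Finset.card_univ,
    Fintype.card_fin, nsmul_eq_mul]
  generalize ∑ x, H' x * gibbsWeight (H t) x = b
  rw [Finset.sum_mul, Finset.mul_sum, ← Finset.sum_sub_distrib]
  refine Finset.sum_congr rfl fun σ _ => ?_
  ring

end Replicas

lemma abs_replicaDeriv_le {Ω : Type*} {n : ℕ} {a : Ω → ℝ} {f : (Fin n → Ω) → ℝ} {A B : ℝ}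
    (ha : ∀ x, |a x| ≤ A) (hf : ∀ σ, |f σ| ≤ B) (hB : 0 ≤ B) (τ : Fin (n + 1) → Ω) :
    |replicaDeriv a f τ| ≤ B * (2 * n * A) := by
  rw [replicaDeriv, abs_mul]
  refine mul_le_mul (hf _) ?_ (abs_nonneg _) hB
  rw [Fin.sum_univ_castSucc]
  simp only [replicaCoeff_castSucc, replicaCoeff_last, one_mul]
  have h1 : |∑ k : Fin n, a (τ k.castSucc)| ≤ n * A := by
    refine (Finset.abs_sum_le_sum_abs _ _).trans ((Finset.sum_le_sum fun k _ => ha _).trans ?_)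
    simp
  have h2 : |-(n : ℝ) * a (τ (Fin.last n))| ≤ n * A := by
    rw [abs_mul, abs_neg, Nat.abs_cast]
    exact mul_le_mul_of_nonneg_left (ha _) (Nat.cast_nonneg _)
  exact (abs_add_le _ _).trans (by linarith)

/-! ### Gaussian integration by parts -/

lemma hasDerivAt_gaussianPDFReal (x : ℝ) :
    HasDerivAt (gaussianPDFReal 0 1) (-x * gaussianPDFReal 0 1 x) x := by
  have h : gaussianPDFReal 0 1 = fun x : ℝ => (√(2 * Real.pi * (1 : NNReal)))⁻¹ *
      Real.exp (-(x - 0) ^ 2 / (2 * (1 : NNReal))) := rfl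
  have h2 : HasDerivAt (fun x : ℝ => -(x - 0) ^ 2 / (2 * ((1 : NNReal) : ℝ))) (-x) x := by
    have := (((hasDerivAt_id x).sub_const 0).pow 2).neg.div_const (2 * ((1 : NNReal) : ℝ))
    refine this.congr_deriv ?_
    simp
    ring
  rw [h]
  refine (h2.exp.const_mul _).congr_deriv ?_
  ring

lemma integrable_id_gaussianReal : Integrable (fun x : ℝ => x) (gaussianReal 0 1) :=
  (memLp_id_gaussianReal 1).integrable le_rfl

/-- Integration by parts for the standard Gaussian law on the line. -/
lemma integral_mul_gaussianReal {F F' : ℝ → ℝ} (hF : ∀ x, HasDerivAt F (F' x) x)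
    (hF' : Continuous F') {B : ℝ} (hB : ∀ x, |F x| ≤ B) (hB' : ∀ x, |F' x| ≤ B) :
    ∫ x, x * F x ∂gaussianReal 0 1 = ∫ x, F' x ∂gaussianReal 0 1 := by
  have hFc : Continuous F := continuous_iff_continuousAt.2 fun x => (hF x).continuousAt
  have key : ∀ G : ℝ → ℝ, Integrable G (gaussianReal 0 1) →
      Integrable (fun x => gaussianPDFReal 0 1 x * G x) := by
    intro G hG
    rw [gaussianReal_of_var_ne_zero 0 one_ne_zero] at hG
    have h3 := (integrable_withDensity_iff_integrable_smul' (measurable_gaussianPDF 0 1)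
      (by simp [gaussianPDF])).1 hG
    simpa [toReal_gaussianPDF] using h3
  have iF : Integrable F (gaussianReal 0 1) :=
    Integrable.of_bound hFc.aestronglyMeasurable B (Filter.Eventually.of_forall hB)
  have iF' : Integrable F' (gaussianReal 0 1) :=
    Integrable.of_bound hF'.aestronglyMeasurable B (Filter.Eventually.of_forall hB')
  have ixF : Integrable (fun x => x * F x) (gaussianReal 0 1) := by
    refine (integrable_id_gaussianReal.bdd_mul (c := B) hFc.aestronglyMeasurable
      (Filter.Eventually.of_forall hB)).congr (Filter.Eventually.of_forall fun x => ?_)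
    simp only [mul_comm]
  rw [integral_gaussianReal_eq_integral_smul one_ne_zero,
    integral_gaussianReal_eq_integral_smul one_ne_zero]
  have h := integral_mul_deriv_eq_deriv_mul_of_integrable (u := F) (u' := F')
    (v := gaussianPDFReal 0 1) (v' := fun x => -x * gaussianPDFReal 0 1 x)
    (fun x _ => hF x) (fun x _ => hasDerivAt_gaussianPDFReal x)
    ((key _ ixF).neg.congr (Filter.Eventually.of_forall fun x => by
      simp only [Pi.neg_apply, Pi.mul_apply]; ring))
    ((key _ iF').congr (Filter.Eventually.of_forall fun x => by
      simp only [Pi.mul_apply]; ring))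
    ((key _ iF).congr (Filter.Eventually.of_forall fun x => by
      simp only [Pi.mul_apply]; ring))
  simp only [smul_eq_mul]
  have e1 : ∫ x, gaussianPDFReal 0 1 x * (x * F x) = - ∫ x, F x * (-x * gaussianPDFReal 0 1 x) := by
    rw [← integral_neg]; congr 1; funext x; ring
  rw [e1, h, neg_neg]
  congr 1; funext x; ring

section Pi

variable {ι : Type*} [Fintype ι]

/-- The law of a family of independent standard Gaussian variables. -/
def stdGaussian (ι : Type*) [Fintype ι] : Measure (ι → ℝ) :=
  Measure.pi fun _ : ι => gaussianReal 0 1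

instance : IsProbabilityMeasure (stdGaussian ι) := by
  unfold stdGaussian; infer_instance

/-- Resampling one coordinate preserves the law of independent Gaussian variables. -/
lemma measurePreserving_update [DecidableEq ι] (k : ι) :
    MeasurePreserving (fun z : (ι → ℝ) × ℝ => Function.update z.1 k z.2)
      ((stdGaussian ι).prod (gaussianReal 0 1)) (stdGaussian ι) := by
  have hm : Measurable fun z : (ι → ℝ) × ℝ => Function.update z.1 k z.2 := by
    refine measurable_pi_iff.2 fun j => ?_
    by_cases hj : j = k
    · subst hj; simpa using measurable_snd
    · simp only [Function.update_of_ne hj]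
      exact (measurable_pi_apply j).comp measurable_fst
  refine ⟨hm, ?_⟩
  symm
  refine Measure.pi_eq fun s hs => ?_
  rw [Measure.map_apply hm (MeasurableSet.univ_pi hs)]
  have hpre : (fun z : (ι → ℝ) × ℝ => Function.update z.1 k z.2) ⁻¹' Set.univ.pi s
      = Set.univ.pi (Function.update s k Set.univ) ×ˢ s k := by
    ext z
    simp only [Set.mem_preimage, Set.mem_univ_pi, Set.mem_prod]
    constructor
    · intro h
      refine ⟨fun j => ?_, by simpa using h k⟩
      by_cases hj : j = k
      · subst hj; simp
      · simpa [Function.update_of_ne hj] using h j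
    · rintro ⟨h1, h2⟩ j
      by_cases hj : j = k
      · subst hj; simpa using h2
      · simpa [Function.update_of_ne hj] using h1 j
  rw [hpre, Measure.prod_prod, stdGaussian, Measure.pi_pi,
    ← Finset.prod_erase_mul _ _ (Finset.mem_univ k), Function.update_self, measure_univ, mul_one,
    ← Finset.prod_erase_mul Finset.univ (fun i => gaussianReal 0 1 (s i)) (Finset.mem_univ k)]
  congr 1
  refine Finset.prod_congr rfl fun j hj => ?_
  rw [Function.update_of_ne (Finset.ne_of_mem_erase hj)]

lemma integrable_eval_stdGaussian (k : ι) : Integrable (fun g => g k) (stdGaussian ι) :=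
  (measurePreserving_eval (fun _ : ι => gaussianReal 0 1) k).integrable_comp_of_integrable
    integrable_id_gaussianReal

/-- Integration by parts in one coordinate of a standard Gaussian vector. -/
lemma integral_mul_stdGaussian [DecidableEq ι] (k : ι) {F F' : (ι → ℝ) → ℝ}
    (hF : ∀ g x, HasDerivAt (fun s => F (Function.update g k s)) (F' (Function.update g k x)) x)
    (hFc : Continuous F) (hF' : Continuous F') {B : ℝ} (hB : ∀ g, |F g| ≤ B)
    (hB' : ∀ g, |F' g| ≤ B) :
    ∫ g, g k * F g ∂stdGaussian ι = ∫ g, F' g ∂stdGaussian ι := by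
  have hp := measurePreserving_update (ι := ι) k
  have iF' : Integrable F' (stdGaussian ι) :=
    Integrable.of_bound hF'.aestronglyMeasurable B (Filter.Eventually.of_forall hB')
  have ixF : Integrable (fun g => g k * F g) (stdGaussian ι) := by
    refine ((integrable_eval_stdGaussian k).bdd_mul (c := B) hFc.aestronglyMeasurable
      (Filter.Eventually.of_forall hB)).congr (Filter.Eventually.of_forall fun x => ?_)
    simp only [mul_comm]
  have tr : ∀ G : (ι → ℝ) → ℝ, Integrable G (stdGaussian ι) → ∫ g, G g ∂stdGaussian ι
      = ∫ g, ∫ x, G (Function.update g k x) ∂gaussianReal 0 1 ∂stdGaussian ι := by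
    intro G hG
    have h2 := integral_prod _ (hp.integrable_comp_of_integrable hG)
    simp only [Function.comp] at h2
    rw [← h2]
    conv_lhs => rw [← hp.map_eq]
    exact integral_map hp.aemeasurable (by rw [hp.map_eq]; exact hG.1)
  rw [tr _ ixF, tr _ iF']
  refine integral_congr_ae (Filter.Eventually.of_forall fun g => ?_)
  simp only [Function.update_self]
  have hu : Continuous fun x : ℝ => Function.update g k x :=
    continuous_const.update k continuous_id
  exact integral_mul_gaussianReal (hF g) (hF'.comp hu) (fun x => hB _) (fun x => hB' _)

end Pi

/-! ### Gaussian Hamiltonians and the interpolation formula -/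

section Interpolation

variable {ι Ω : Type*} [Fintype ι] [Fintype Ω] {m n : ℕ}

/-- The Hamiltonian with couplings `g j` in front of the functions `a j`, and a deterministic
part `c`. -/
def gaussHam (a : ι → Ω → ℝ) (c : Ω → ℝ) (g : ι → ℝ) (σ : Ω) : ℝ := ∑ j, g j * a j σ + c σ

/-- The average over replicas and over the standard Gaussian couplings. -/
def gaussAvg (a : ι → Ω → ℝ) (c : Ω → ℝ) (f : (Fin n → Ω) → ℝ) : ℝ :=
  ∫ g, replicaAvg (gaussHam a c g) f ∂stdGaussian ι

variable (a : ι → Ω → ℝ) (c : Ω → ℝ)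

lemma continuous_replicaAvg [Nonempty Ω] {α : Type*} [TopologicalSpace α] {H : α → Ω → ℝ}
    (hH : ∀ σ, Continuous fun x => H x σ) (f : (Fin n → Ω) → ℝ) :
    Continuous fun x => replicaAvg (H x) f := by
  unfold replicaAvg gibbsWeight
  refine continuous_finsetSum _ fun σ _ => continuous_const.mul <|
    continuous_finsetProd _ fun k _ => (hH _).rexp.div ?_ fun x => (sum_exp_pos (H x)).ne'
  exact continuous_finsetSum _ fun τ _ => (hH τ).rexp

omit [Fintype Ω] in
lemma continuous_gaussHam (σ : Ω) : Continuous fun g => gaussHam a c g σ := by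
  unfold gaussHam; fun_prop

lemma exists_abs_bound (f : (Fin n → Ω) → ℝ) : ∃ B, 0 ≤ B ∧ ∀ σ, |f σ| ≤ B :=
  ⟨∑ σ, |f σ|, Finset.sum_nonneg fun _ _ => abs_nonneg _, fun σ =>
    Finset.single_le_sum (f := fun σ => |f σ|) (fun _ _ => abs_nonneg _) (Finset.mem_univ σ)⟩

variable [Nonempty Ω]

lemma integrable_replicaAvg (f : (Fin n → Ω) → ℝ) :
    Integrable (fun g => replicaAvg (gaussHam a c g) f) (stdGaussian ι) := by
  obtain ⟨B, -, hB⟩ := exists_abs_bound f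
  exact Integrable.of_bound
    (continuous_replicaAvg (continuous_gaussHam a c) f).aestronglyMeasurable B
    (Filter.Eventually.of_forall fun g => abs_replicaAvg_le_of_bound _ hB)

lemma gaussAvg_add (f g : (Fin n → Ω) → ℝ) :
    gaussAvg a c (fun σ => f σ + g σ) = gaussAvg a c f + gaussAvg a c g := by
  simp only [gaussAvg, replicaAvg_add]
  exact integral_add (integrable_replicaAvg a c f) (integrable_replicaAvg a c g)

lemma gaussAvg_sub (f g : (Fin n → Ω) → ℝ) :
    gaussAvg a c (fun σ => f σ - g σ) = gaussAvg a c f - gaussAvg a c g := by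
  simp only [gaussAvg, replicaAvg_sub]
  exact integral_sub (integrable_replicaAvg a c f) (integrable_replicaAvg a c g)

lemma gaussAvg_sum {κ : Type*} (s : Finset κ) (f : κ → (Fin n → Ω) → ℝ) :
    gaussAvg a c (fun σ => ∑ j ∈ s, f j σ) = ∑ j ∈ s, gaussAvg a c (f j) := by
  simp only [gaussAvg, replicaAvg_sum]
  exact integral_finsetSum _ fun j _ => integrable_replicaAvg a c (f j)

omit [Nonempty Ω] in
lemma gaussAvg_const_mul (r : ℝ) (f : (Fin n → Ω) → ℝ) :
    gaussAvg a c (fun σ => r * f σ) = r * gaussAvg a c f := by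
  simp only [gaussAvg, replicaAvg_const_mul]
  exact integral_const_mul _ _

lemma gaussAvg_const (r : ℝ) : gaussAvg a c (fun _ : Fin n → Ω => r) = r := by
  simp [gaussAvg, replicaAvg_const]

lemma gaussAvg_mono {f g : (Fin n → Ω) → ℝ} (h : ∀ σ, f σ ≤ g σ) :
    gaussAvg a c f ≤ gaussAvg a c g :=
  integral_mono (integrable_replicaAvg a c f) (integrable_replicaAvg a c g)
    fun _ => replicaAvg_mono _ h

omit [Nonempty Ω] in
lemma gaussAvg_nonneg {f : (Fin n → Ω) → ℝ} (h : ∀ σ, 0 ≤ f σ) : 0 ≤ gaussAvg a c f :=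
  integral_nonneg fun _ => replicaAvg_nonneg _ h

lemma abs_gaussAvg_le (f : (Fin n → Ω) → ℝ) :
    |gaussAvg a c f| ≤ gaussAvg a c (fun σ => |f σ|) :=
  abs_integral_le_integral_abs.trans <| integral_mono (integrable_replicaAvg a c f).abs
    (integrable_replicaAvg a c _) fun _ => abs_replicaAvg_le _ _

lemma gaussAvg_comp {φ : Fin n → Fin m} (hφ : Function.Injective φ) (f : (Fin n → Ω) → ℝ) :
    gaussAvg a c (fun σ : Fin m → Ω => f (σ ∘ φ)) = gaussAvg a c f := by
  simp only [gaussAvg, replicaAvg_comp _ hφ]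

/-- The two-replica weight of the second derivative formula, for the couplings `a`, with
derivatives `a'` and `c'` of the Hamiltonian. -/
def interpolationKernel (a a' : ι → Ω → ℝ) (c' : Ω → ℝ) (τ : Fin (n + 2) → Ω) : ℝ :=
  ∑ k : Fin (n + 1), ∑ l : Fin (n + 2), replicaCoeff n k * replicaCoeff (n + 1) l *
    (∑ j, a' j (τ k.castSucc) * a j (τ l) + if k.castSucc = l then c' (τ l) else 0)

/-- Integration by parts for an average over replicas. -/
lemma integral_mul_replicaAvg (j : ι) (f : (Fin n → Ω) → ℝ) :
    ∫ g, g j * replicaAvg (gaussHam a c g) f ∂stdGaussian ι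
      = gaussAvg a c (replicaDeriv (a j) f) := by
  classical
  obtain ⟨B, -, hB⟩ := exists_abs_bound f
  obtain ⟨B', -, hB'⟩ := exists_abs_bound (replicaDeriv (a j) f)
  refine integral_mul_stdGaussian j (fun g x => ?_)
    (continuous_replicaAvg (continuous_gaussHam a c) f)
    (continuous_replicaAvg (continuous_gaussHam a c) _) (B := max B B')
    (fun g => abs_replicaAvg_le_of_bound _ fun σ => (hB σ).trans (le_max_left _ _))
    (fun g => abs_replicaAvg_le_of_bound _ fun σ => (hB' σ).trans (le_max_right _ _))
  refine hasDerivAt_replicaAvg (H := fun s => gaussHam a c (Function.update g j s))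
    (fun σ => ?_) f
  have h : (fun s => gaussHam a c (Function.update g j s) σ)
      = fun s => s * a j σ + (∑ k ∈ Finset.univ.erase j, g k * a k σ + c σ) := by
    funext s
    rw [gaussHam, ← Finset.add_sum_erase _ _ (Finset.mem_univ j), Function.update_self, add_assoc]
    congr 2
    exact Finset.sum_congr rfl fun k hk => by
      rw [Function.update_of_ne (Finset.ne_of_mem_erase hk)]
  rw [h]
  simpa using ((hasDerivAt_id x).mul_const (a j σ)).add_const
    (∑ k ∈ Finset.univ.erase j, g k * a k σ + c σ)

omit [Fintype Ω] [Nonempty Ω] in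
lemma replicaDeriv_gaussHam (g : ι → ℝ) (f : (Fin n → Ω) → ℝ) :
    replicaDeriv (gaussHam a c g) f
      = fun τ => ∑ j, g j * replicaDeriv (a j) f τ + replicaDeriv c f τ := by
  funext τ
  simp only [replicaDeriv, gaussHam, mul_add, Finset.sum_add_distrib, Finset.mul_sum]
  rw [Finset.sum_comm]
  congr 1
  exact Finset.sum_congr rfl fun j _ => Finset.sum_congr rfl fun k _ => by ring

omit [Nonempty Ω] in
lemma replicaAvg_replicaDeriv_gaussHam (H : Ω → ℝ) (g : ι → ℝ) (f : (Fin n → Ω) → ℝ) :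
    replicaAvg H (replicaDeriv (gaussHam a c g) f)
      = ∑ j, g j * replicaAvg H (replicaDeriv (a j) f) + replicaAvg H (replicaDeriv c f) := by
  simp only [replicaDeriv_gaussHam, replicaAvg_add, replicaAvg_sum, replicaAvg_const_mul]

omit [Fintype Ω] [Nonempty Ω] in
lemma sum_replicaDeriv_replicaDeriv (a' : ι → Ω → ℝ) (c' : Ω → ℝ) (f : (Fin n → Ω) → ℝ)
    (τ : Fin (n + 2) → Ω) :
    ∑ j, replicaDeriv (a j) (replicaDeriv (a' j) f) τ + replicaDeriv c' f (τ ∘ Fin.castSucc)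
      = f (fun k => τ k.castSucc.castSucc) * interpolationKernel a a' c' τ := by
  have h0 : ∀ k : Fin (n + 1), (∑ l : Fin (n + 2), replicaCoeff n k * replicaCoeff (n + 1) l *
      if k.castSucc = l then c' (τ l) else 0) = replicaCoeff n k * c' (τ k.castSucc) := by
    intro k
    simp only [mul_ite, mul_zero, Finset.sum_ite_eq, Finset.mem_univ, if_true,
      replicaCoeff_castSucc, mul_one]
  simp only [interpolationKernel, mul_add, Finset.sum_add_distrib, h0]
  congr 1
  · simp only [replicaDeriv, Finset.mul_sum, Finset.sum_mul]
    rw [Finset.sum_comm]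
    simp_rw [Finset.sum_comm (s := (Finset.univ : Finset ι))]
    rw [Finset.sum_comm]
    refine Finset.sum_congr rfl fun k _ => Finset.sum_congr rfl fun l _ =>
      Finset.sum_congr rfl fun j _ => ?_
    change f (fun k => τ k.castSucc.castSucc) * (_ * a' j (τ k.castSucc)) * _ = _
    ring

/-- Gaussian interpolation: along a differentiable path of Hamiltonians the derivative of an
average over `n` replicas is an average over `n + 2` replicas. One of the additional replicas comes
from the derivative of the Gibbs measure, the other one from integration by parts. -/
theorem hasDerivAt_gaussAvg {a a' : ℝ → ι → Ω → ℝ} {c c' : ℝ → Ω → ℝ} {A : ℝ}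
    (ha : ∀ t j σ, HasDerivAt (fun s => a s j σ) (a' t j σ) t)
    (hc : ∀ t σ, HasDerivAt (fun s => c s σ) (c' t σ) t)
    (hA : ∀ t j σ, |a' t j σ| ≤ A) (hC : ∀ t σ, |c' t σ| ≤ A) (f : (Fin n → Ω) → ℝ) (t : ℝ) :
    HasDerivAt (fun s => gaussAvg (a s) (c s) f)
      (gaussAvg (a t) (c t) fun τ : Fin (n + 2) → Ω =>
        f (fun k => τ k.castSucc.castSucc) * interpolationKernel (a t) (a' t) (c' t) τ) t := by
  obtain ⟨B, hB0, hB⟩ := exists_abs_bound f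
  have hH : ∀ t g σ,
      HasDerivAt (fun s => gaussHam (a s) (c s) g σ) (gaussHam (a' t) (c' t) g σ) t :=
    fun t g σ => (HasDerivAt.fun_sum fun j _ => (ha t j σ).const_mul (g j)).add (hc t σ)
  have hcont : ∀ {m : ℕ} (φ : (Fin m → Ω) → ℝ),
      Continuous fun g => replicaAvg (gaussHam (a t) (c t) g) φ := fun φ =>
    continuous_replicaAvg (continuous_gaussHam _ _) φ
  have hint : ∀ j, Integrable (fun g : ι → ℝ => g j *
      replicaAvg (gaussHam (a t) (c t) g) (replicaDeriv (a' t j) f)) (stdGaussian ι) := by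
    intro j
    obtain ⟨B', -, hB'⟩ := exists_abs_bound (replicaDeriv (a' t j) f)
    refine ((integrable_eval_stdGaussian j).bdd_mul (c := B') (hcont _).aestronglyMeasurable
      (Filter.Eventually.of_forall fun g => abs_replicaAvg_le_of_bound _ hB')).congr
      (Filter.Eventually.of_forall fun x => ?_)
    simp only [mul_comm]
  have hbi : Integrable (fun g : ι → ℝ => ∑ j, |g j| * (B * (2 * n * A)) + B * (2 * n * A))
      (stdGaussian ι) :=
    (integrable_finsetSum _ fun j _ => (integrable_eval_stdGaussian j).abs.mul_const _).add
      (integrable_const _)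
  have hd := (hasDerivAt_integral_of_dominated_loc_of_deriv_le (μ := stdGaussian ι) (x₀ := t)
    (s := Set.univ) (F := fun s g => replicaAvg (gaussHam (a s) (c s) g) f)
    (F' := fun s g => replicaAvg (gaussHam (a s) (c s) g)
      (replicaDeriv (gaussHam (a' s) (c' s) g) f)) Filter.univ_mem
    (Filter.Eventually.of_forall fun s => (integrable_replicaAvg _ _ f).1)
    (integrable_replicaAvg _ _ f)
    (by
      simp only [replicaAvg_replicaDeriv_gaussHam]
      refine Continuous.aestronglyMeasurable ?_
      exact (continuous_finsetSum _ fun j _ => (continuous_apply j).mul (hcont _)).add (hcont _))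
    (Filter.Eventually.of_forall fun g s _ => by
      rw [replicaAvg_replicaDeriv_gaussHam, Real.norm_eq_abs]
      refine (abs_add_le _ _).trans (add_le_add ((Finset.abs_sum_le_sum_abs _ _).trans
        (Finset.sum_le_sum fun j _ => ?_)) ?_)
      · rw [abs_mul]
        exact mul_le_mul_of_nonneg_left (abs_replicaAvg_le_of_bound _
          (abs_replicaDeriv_le (hA s j) hB hB0)) (abs_nonneg _)
      · exact abs_replicaAvg_le_of_bound _ (abs_replicaDeriv_le (hC s) hB hB0))
    hbi
    (Filter.Eventually.of_forall fun g s _ => hasDerivAt_replicaAvg (hH s g) f)).2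
  refine hd.congr_deriv ?_
  simp only [replicaAvg_replicaDeriv_gaussHam]
  rw [integral_add (integrable_finsetSum _ fun j _ => hint j) (integrable_replicaAvg _ _ _),
    integral_finsetSum _ fun j _ => hint j]
  simp only [integral_mul_replicaAvg]
  change _ + gaussAvg (a t) (c t) (replicaDeriv (c' t) f) = _
  rw [← gaussAvg_comp (a t) (c t) (Fin.castSucc_injective (n + 1)) (replicaDeriv (c' t) f),
    ← gaussAvg_sum, ← gaussAvg_add]
  simp only [sum_replicaDeriv_replicaDeriv]

end Interpolation

/-! ### Estimates along the path -/

section Path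

lemma abs_sin_mul_cos_le_one (θ : ℝ) : |Real.sin θ * Real.cos θ| ≤ 1 := by
  rw [abs_mul]
  exact mul_le_one₀ (Real.abs_sin_le_one θ) (abs_nonneg _) (Real.abs_cos_le_one θ)

variable {φ ψ : ℝ → ℝ} {C : ℝ}

/-- The path is parametrized by an angle, so that `t = sin² θ` is the interpolation time and
`2 sin θ cos θ dθ = dt`; no square root of the time appears. -/
lemma abs_sub_le_of_hasDerivAt_sin_mul_cos
    (h : ∀ θ, HasDerivAt φ (Real.sin θ * Real.cos θ * ψ θ) θ)
    (hC : ∀ θ ∈ Set.Icc 0 (Real.pi / 2), |ψ θ| ≤ C) {θ : ℝ}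
    (hθ : θ ∈ Set.Icc 0 (Real.pi / 2)) : |φ θ - φ 0| ≤ 2 * C := by
  have hC0 : 0 ≤ C := (abs_nonneg _).trans (hC θ hθ)
  have := norm_image_sub_le_of_norm_deriv_le_segment' (f := φ) (a := 0) (b := Real.pi / 2)
    (C := C) (fun x _ => (h x).hasDerivWithinAt) (fun x hx => by
      rw [Real.norm_eq_abs, abs_mul]
      refine (mul_le_mul (a := |Real.sin x * Real.cos x|) (b := 1) ?_
        (hC x (Set.Ico_subset_Icc_self hx)) (abs_nonneg _) zero_le_one).trans_eq (one_mul C)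
      exact abs_sin_mul_cos_le_one x) θ hθ
  refine this.trans ?_
  have h1 := hθ.2
  have h2 := Real.pi_le_four
  nlinarith

lemma abs_sub_sub_half_le_of_hasDerivAt_sin_mul_cos
    (h : ∀ θ, HasDerivAt φ (Real.sin θ * Real.cos θ * ψ θ) θ)
    (hC : ∀ θ ∈ Set.Icc 0 (Real.pi / 2), |ψ θ - ψ 0| ≤ C) :
    |φ (Real.pi / 2) - φ 0 - 1 / 2 * ψ 0| ≤ 2 * C := by
  have h2 : ∀ θ, HasDerivAt (fun θ => φ θ - 1 / 2 * Real.sin θ ^ 2 * ψ 0)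
      (Real.sin θ * Real.cos θ * (ψ θ - ψ 0)) θ := by
    intro θ
    refine ((h θ).sub ((((Real.hasDerivAt_sin θ).pow 2).const_mul (1 / 2)).mul_const
      (ψ 0))).congr_deriv ?_
    push_cast
    ring
  have := abs_sub_le_of_hasDerivAt_sin_mul_cos h2 hC
    (Set.right_mem_Icc.2 (by positivity : (0 : ℝ) ≤ Real.pi / 2))
  simp only [Real.sin_pi_div_two, Real.sin_zero] at this
  convert this using 2
  ring

/-- A differential inequality integrated backwards from the end point of the path. -/
lemma le_exp_mul_of_hasDerivAt_sin_mul_cos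
    (h : ∀ θ, HasDerivAt φ (Real.sin θ * Real.cos θ * ψ θ) θ)
    (hC0 : 0 ≤ C) (hφ : ∀ θ, 0 ≤ φ θ)
    (hC : ∀ θ, |ψ θ| ≤ C * φ θ) {θ : ℝ}
    (hθ : θ ∈ Set.Icc 0 (Real.pi / 2)) : φ θ ≤ Real.exp (2 * C) * φ (Real.pi / 2) := by
  have hd : ∀ x, HasDerivAt (fun x => φ x * Real.exp (C * x))
      ((Real.sin x * Real.cos x * ψ x + C * φ x) * Real.exp (C * x)) x := by
    intro x
    refine ((h x).mul ((hasDerivAt_id x).const_mul C).exp).congr_deriv ?_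
    simp only [id]
    ring
  have hmono : Monotone (fun x => φ x * Real.exp (C * x)) := by
    refine monotone_of_deriv_nonneg (fun x => (hd x).differentiableAt) fun x => ?_
    rw [(hd x).deriv]
    refine mul_nonneg ?_ (Real.exp_pos _).le
    have h1 : |Real.sin x * Real.cos x * ψ x| ≤ C * φ x := by
      rw [abs_mul]
      refine (mul_le_mul (a := |Real.sin x * Real.cos x|) (b := 1) ?_ (hC x) (abs_nonneg _)
        zero_le_one).trans_eq (one_mul _)
      exact abs_sin_mul_cos_le_one x
    linarith [neg_abs_le (Real.sin x * Real.cos x * ψ x)]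
  have h1 : φ θ * Real.exp (C * θ) ≤ φ (Real.pi / 2) * Real.exp (C * (Real.pi / 2)) := hmono hθ.2
  have h2 : φ θ ≤ φ θ * Real.exp (C * θ) :=
    le_mul_of_one_le_right (hφ θ) (Real.one_le_exp (mul_nonneg hC0 hθ.1))
  refine h2.trans (h1.trans ?_)
  rw [mul_comm]
  refine mul_le_mul_of_nonneg_right (Real.exp_le_exp.2 ?_) (hφ _)
  nlinarith [Real.pi_le_four]

end Path

lemma sum_abs_replicaCoeff (n : ℕ) : ∑ k, |replicaCoeff n k| = 2 * n := by
  rw [Fin.sum_univ_castSucc]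
  simp
  ring

lemma abs_sum_replicaCoeff_le {n : ℕ} {Y : Fin (n + 1) → Fin (n + 2) → ℝ} {B : ℝ}
    (hY : ∀ k l, |Y k l| ≤ B) :
    |∑ k, ∑ l, replicaCoeff n k * replicaCoeff (n + 1) l * Y k l| ≤ 4 * n * (n + 1) * B := by
  have h1 : ∀ k l, |replicaCoeff n k * replicaCoeff (n + 1) l * Y k l|
      ≤ |replicaCoeff n k| * |replicaCoeff (n + 1) l| * B := by
    intro k l
    rw [abs_mul, abs_mul]
    exact mul_le_mul_of_nonneg_left (hY k l) (by positivity)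
  refine (Finset.abs_sum_le_sum_abs _ _).trans ((Finset.sum_le_sum fun k _ =>
    (Finset.abs_sum_le_sum_abs _ _).trans (Finset.sum_le_sum fun l _ => h1 k l)).trans_eq ?_)
  simp_rw [mul_assoc, ← Finset.mul_sum, ← Finset.sum_mul]
  rw [sum_abs_replicaCoeff, sum_abs_replicaCoeff]
  push_cast
  ring

/-! ### The replica-symmetric equations -/

section ReplicaSymmetric

variable {S : ℕ} {β h cr p q p' q' : ℝ} {n : ℕ}

instance : Nonempty (Spin S) := ⟨⟨0, by simp⟩⟩

lemma abs_sv_le (x : Spin S) : |sv x| ≤ S := by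
  have hx := Finset.mem_Icc.1 x.2
  unfold sv
  rw [abs_le]
  constructor
  · exact_mod_cast hx.1
  · exact_mod_cast hx.2

lemma abs_sv_mul_sv_le (x y : Spin S) : |sv x * sv y| ≤ (S : ℝ) ^ 2 := by
  rw [abs_mul, pow_two]
  exact mul_le_mul (abs_sv_le x) (abs_sv_le y) (abs_nonneg _) (Nat.cast_nonneg _)

lemma nu0_eq (f : (Fin n → ℝ) → ℝ) : nu0 S β h cr p q f
    = ∫ η, replicaAvg (lastHamiltonian S β h cr p q η) (fun ε => f fun k => sv (ε k))
      ∂gaussianReal 0 1 := rfl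

/-- The target overlaps: `p` for the self-overlap, `q` for the overlap of two replicas. -/
def target (p q : ℝ) {n : ℕ} (k l : Fin n) : ℝ := if k = l then p else q

lemma continuous_lastHamiltonian (x : Spin S) :
    Continuous fun η => lastHamiltonian S β h cr p q η x := by
  unfold lastHamiltonian; fun_prop

lemma integrable_lastHamiltonian (f : (Fin n → Spin S) → ℝ) :
    Integrable (fun η => replicaAvg (lastHamiltonian S β h cr p q η) f) (gaussianReal 0 1) := by
  obtain ⟨B, -, hB⟩ := exists_abs_bound f
  exact Integrable.of_bound
    (continuous_replicaAvg continuous_lastHamiltonian f).aestronglyMeasurable B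
    (Filter.Eventually.of_forall fun g => abs_replicaAvg_le_of_bound _ hB)

lemma nu0_comp {m : ℕ} {φ : Fin n → Fin m} (hφ : Function.Injective φ) (f : (Fin n → ℝ) → ℝ) :
    nu0 S β h cr p q (fun ε : Fin m → ℝ => f (ε ∘ φ)) = nu0 S β h cr p q f := by
  simp only [nu0_eq]
  congr 1
  funext η
  exact replicaAvg_comp _ hφ (fun ε => f fun k => sv (ε k))

lemma abs_nu0_le {f : (Fin n → ℝ) → ℝ} {B : ℝ} (hB : ∀ ε : Fin n → Spin S,
    |f (fun k => sv (ε k))| ≤ B) : |nu0 S β h cr p q f| ≤ B := by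
  rw [nu0_eq, ← Real.norm_eq_abs]
  refine (norm_integral_le_of_norm_le_const (C := B)
    (Filter.Eventually.of_forall fun η => ?_)).trans_eq (by simp)
  exact abs_replicaAvg_le_of_bound _ hB

lemma nu0_sub (f g : (Fin n → ℝ) → ℝ) : nu0 S β h cr p q (fun ε => f ε - g ε)
    = nu0 S β h cr p q f - nu0 S β h cr p q g := by
  simp only [nu0_eq, replicaAvg_sub]
  exact integral_sub (integrable_lastHamiltonian _) (integrable_lastHamiltonian _)

lemma nu0_const (r : ℝ) : nu0 S β h cr p q (fun _ : Fin n → ℝ => r) = r := by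
  simp [nu0_eq, replicaAvg_const]

/-- The couplings of the path between two single-spin measures: two independent Gaussian variables
carry the weights `sin θ` and `cos θ`. -/
def spinPathCoupling (S : ℕ) (β q q' θ : ℝ) (b : Bool) (x : Spin S) : ℝ :=
  bif b then Real.sin θ * (β * √q' * sv x) else Real.cos θ * (β * √q * sv x)

/-- The deterministic part of the path between the single-spin measures with parameters `p, q`
(at `θ = 0`) and `p', q'` (at `θ = π / 2`). -/
def spinPathField (S : ℕ) (β h cr p q p' q' θ : ℝ) (x : Spin S) : ℝ :=
  Real.sin θ ^ 2 * (β ^ 2 / 2 * (p' - q') * sv x ^ 2)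
    + Real.cos θ ^ 2 * (β ^ 2 / 2 * (p - q) * sv x ^ 2) + cr * sv x ^ 2 + h * sv x

/-- The derivative of `spinPathCoupling` in `θ`. -/
def spinPathCoupling' (S : ℕ) (β q q' θ : ℝ) (b : Bool) (x : Spin S) : ℝ :=
  bif b then Real.cos θ * (β * √q' * sv x) else -Real.sin θ * (β * √q * sv x)

/-- The derivative of `spinPathField` in `θ`. -/
def spinPathField' (S : ℕ) (β p q p' q' θ : ℝ) (x : Spin S) : ℝ :=
  Real.sin θ * Real.cos θ * (β ^ 2 * ((p' - q') - (p - q)) * sv x ^ 2)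

lemma hasDerivAt_spinPathCoupling (θ : ℝ) (b : Bool) (x : Spin S) :
    HasDerivAt (fun θ => spinPathCoupling S β q q' θ b x) (spinPathCoupling' S β q q' θ b x) θ := by
  cases b
  · exact (Real.hasDerivAt_cos θ).mul_const _
  · exact (Real.hasDerivAt_sin θ).mul_const _

lemma hasDerivAt_spinPathField (θ : ℝ) (x : Spin S) :
    HasDerivAt (fun θ => spinPathField S β h cr p q p' q' θ x)
      (spinPathField' S β p q p' q' θ x) θ := by
  refine (((((Real.hasDerivAt_sin θ).pow 2).mul_const _).add
    (((Real.hasDerivAt_cos θ).pow 2).mul_const _)).add_const _ |>.add_const _).congr_deriv ?_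
  unfold spinPathField'
  push_cast
  ring

lemma exists_spinPath_bound : ∃ A, (∀ θ b x, |spinPathCoupling' S β q q' θ b x| ≤ A) ∧
    ∀ θ x, |spinPathField' S β p q p' q' θ x| ≤ A := by
  refine ⟨|β * √q'| * S + |β * √q| * S + |β ^ 2 * ((p' - q') - (p - q))| * S ^ 2,
    fun θ b x => ?_, fun θ x => ?_⟩
  · have h1 : |spinPathCoupling' S β q q' θ b x| ≤ |β * √q'| * S + |β * √q| * S := by
      have hx := abs_sv_le x
      cases b
      · simp only [spinPathCoupling', cond_false, abs_mul (-Real.sin θ), abs_neg,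
          abs_mul (β * √q) (sv x)]
        calc _ ≤ 1 * (|β * √q| * S) := by
              gcongr
              exact Real.abs_sin_le_one θ
          _ ≤ _ := by rw [one_mul]; exact le_add_of_nonneg_left (by positivity)
      · simp only [spinPathCoupling', cond_true, abs_mul (Real.cos θ), abs_mul (β * √q') (sv x)]
        calc _ ≤ 1 * (|β * √q'| * S) := by
              gcongr
              exact Real.abs_cos_le_one θ
          _ ≤ _ := by rw [one_mul]; exact le_add_of_nonneg_right (by positivity)
    exact h1.trans (le_add_of_nonneg_right (by positivity))
  · have hx := abs_sv_le x
    rw [spinPathField', abs_mul, abs_mul (β ^ 2 * ((p' - q') - (p - q))), abs_pow]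
    calc _ ≤ 1 * (|β ^ 2 * ((p' - q') - (p - q))| * (S : ℝ) ^ 2) := by
          gcongr
          exact abs_sin_mul_cos_le_one θ
      _ ≤ _ := by rw [one_mul]; exact le_add_of_nonneg_left (by positivity)

lemma interpolationKernel_spinPath (hq : 0 ≤ q) (hq' : 0 ≤ q') (θ : ℝ) (τ : Fin (n + 2) → Spin S) :
    interpolationKernel (spinPathCoupling S β q q' θ) (spinPathCoupling' S β q q' θ)
        (spinPathField' S β p q p' q' θ) τ
      = Real.sin θ * Real.cos θ *
        ∑ k : Fin (n + 1), ∑ l : Fin (n + 2), replicaCoeff n k * replicaCoeff (n + 1) l *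
          (β ^ 2 * (sv (τ k.castSucc) * sv (τ l) *
            (target p' q' k.castSucc l - target p q k.castSucc l))) := by
  rw [interpolationKernel, Finset.mul_sum]
  refine Finset.sum_congr rfl fun k _ => ?_
  rw [Finset.mul_sum]
  refine Finset.sum_congr rfl fun l _ => ?_
  have e1 : √q * √q = q := Real.mul_self_sqrt hq
  have e2 : √q' * √q' = q' := Real.mul_self_sqrt hq'
  rw [Fintype.sum_bool]
  simp only [spinPathCoupling, spinPathCoupling', spinPathField', cond_true, cond_false, target]
  split_ifs with hkl
  · subst hkl
    linear_combination (replicaCoeff n k * replicaCoeff (n + 1) k.castSucc * Real.cos θ *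
      Real.sin θ * β ^ 2 * sv (τ k.castSucc) ^ 2) * (e2 - e1)
  · linear_combination (replicaCoeff n k * replicaCoeff (n + 1) l * Real.cos θ *
      Real.sin θ * β ^ 2 * sv (τ k.castSucc) * sv (τ l)) * (e2 - e1)

lemma hasDerivAt_nu0_path (hq : 0 ≤ q) (hq' : 0 ≤ q') (f : (Fin n → Spin S) → ℝ) (θ : ℝ) :
    HasDerivAt (fun θ => gaussAvg (spinPathCoupling S β q q' θ)
        (spinPathField S β h cr p q p' q' θ) f)
      (Real.sin θ * Real.cos θ * gaussAvg (spinPathCoupling S β q q' θ)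
        (spinPathField S β h cr p q p' q' θ)
        (fun τ : Fin (n + 2) → Spin S => f (fun k => τ k.castSucc.castSucc) *
          ∑ k : Fin (n + 1), ∑ l : Fin (n + 2), replicaCoeff n k * replicaCoeff (n + 1) l *
            (β ^ 2 * (sv (τ k.castSucc) * sv (τ l) *
              (target p' q' k.castSucc l - target p q k.castSucc l))))) θ := by
  obtain ⟨A, hA, hC⟩ := exists_spinPath_bound (S := S) (β := β) (p := p) (q := q) (p' := p')
    (q' := q')
  refine (hasDerivAt_gaussAvg hasDerivAt_spinPathCoupling hasDerivAt_spinPathField hA hC f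
    θ).congr_deriv ?_
  rw [← gaussAvg_const_mul]
  congr 1
  funext τ
  rw [interpolationKernel_spinPath hq hq', mul_left_comm]

lemma integral_eval_stdGaussian {ι : Type*} [Fintype ι] (k : ι) {F : ℝ → ℝ} (hF : Continuous F) :
    ∫ g : ι → ℝ, F (g k) ∂stdGaussian ι = ∫ η, F η ∂gaussianReal 0 1 := by
  have hp := measurePreserving_eval (fun _ : ι => gaussianReal 0 1) k
  rw [← hp.map_eq, integral_map hp.aemeasurable hF.aestronglyMeasurable]
  rfl

/-- Averages over the decoupled spin are Lipschitz in the parameters, with a small constant at high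
temperature. -/
lemma abs_nu0_sub_le (hq : 0 ≤ q) (hq' : 0 ≤ q') {f : (Fin n → ℝ) → ℝ} {B : ℝ}
    (hB : ∀ ε : Fin n → Spin S, |f (fun k => sv (ε k))| ≤ B) :
    |nu0 S β h cr p' q' f - nu0 S β h cr p q f|
      ≤ 2 * (B * (4 * n * (n + 1) * (β ^ 2 * (S ^ 2 * max |p' - p| |q' - q|)))) := by
  have hB0 : 0 ≤ B := (abs_nonneg _).trans (hB fun _ => Classical.arbitrary _)
  have hK : ∀ τ : Fin (n + 2) → Spin S, |f (fun k => sv (τ k.castSucc.castSucc)) *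
      ∑ k : Fin (n + 1), ∑ l : Fin (n + 2), replicaCoeff n k * replicaCoeff (n + 1) l *
            (β ^ 2 * (sv (τ k.castSucc) * sv (τ l) *
              (target p' q' k.castSucc l - target p q k.castSucc l)))|
      ≤ B * (4 * n * (n + 1) * (β ^ 2 * (S ^ 2 * max |p' - p| |q' - q|))) := by
    intro τ
    rw [abs_mul]
    refine mul_le_mul (hB _) (abs_sum_replicaCoeff_le fun k l => ?_) (abs_nonneg _) hB0
    rw [abs_mul, abs_mul, abs_of_nonneg (sq_nonneg β)]
    refine mul_le_mul_of_nonneg_left (mul_le_mul (abs_sv_mul_sv_le _ _) ?_ (abs_nonneg _)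
      (by positivity)) (sq_nonneg β)
    unfold target
    split_ifs
    · exact le_max_left _ _
    · exact le_max_right _ _
  have key := abs_sub_le_of_hasDerivAt_sin_mul_cos
    (hasDerivAt_nu0_path (S := S) (β := β) (h := h) (cr := cr) (p := p) (p' := p') hq hq'
      (fun ε : Fin n → Spin S => f fun k => sv (ε k)))
    (C := B * (4 * n * (n + 1) * (β ^ 2 * (S ^ 2 * max |p' - p| |q' - q|)))) (fun θ _ => by
      refine (abs_gaussAvg_le _ _ _).trans ((gaussAvg_mono _ _ hK).trans_eq (gaussAvg_const _ _ _)))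
    (Set.right_mem_Icc.2 (by positivity : (0 : ℝ) ≤ Real.pi / 2))
  have e : ∀ (b : Bool) (P Q : ℝ), ∫ g : Bool → ℝ, replicaAvg (lastHamiltonian S β h cr P Q (g b))
      (fun ε : Fin n → Spin S => f fun k => sv (ε k)) ∂stdGaussian Bool = nu0 S β h cr P Q f :=
    fun b P Q => integral_eval_stdGaussian b
      (continuous_replicaAvg continuous_lastHamiltonian _)
  rw [← e true p' q', ← e false p q]
  convert key using 4
  · unfold gaussAvg
    congr 1
    funext g
    congr 1
    funext x
    simp [gaussHam, lastHamiltonian, spinPathCoupling, spinPathField]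
    ring
  · unfold gaussAvg
    congr 1
    funext g
    congr 1
    funext x
    simp [gaussHam, lastHamiltonian, spinPathCoupling, spinPathField]
    ring

/-- The right-hand side of the replica-symmetric equations, extended to negative `q`. -/
def rsMap (S : ℕ) (β h cr : ℝ) (z : ℝ × ℝ) : ℝ × ℝ :=
  (nu0 S β h cr z.1 (max z.2 0) (n := 1) (fun ε => ε 0 ^ 2),
    nu0 S β h cr z.1 (max z.2 0) (n := 2) (fun ε => ε 0 * ε 1))

lemma nu0_mul_nonneg : 0 ≤ nu0 S β h cr p q (n := 2) (fun ε => ε 0 * ε 1) := by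
  rw [nu0_eq]
  refine integral_nonneg fun η => ?_
  have h1 := replicaAvg_prod (lastHamiltonian S β h cr p q η) (fun (_ : Fin 2) x => sv x)
  simp only [Fin.prod_univ_two] at h1
  simp only [Pi.zero_apply]
  rw [h1]
  exact mul_self_nonneg _

lemma nu0_sq_nonneg : 0 ≤ nu0 S β h cr p q (n := 1) (fun ε => ε 0 ^ 2) := by
  rw [nu0_eq]
  exact integral_nonneg fun η => replicaAvg_nonneg _ fun σ => sq_nonneg _

lemma isReplicaSymmetric_iff :
    IsReplicaSymmetric S β h cr p q ↔ Function.IsFixedPt (rsMap S β h cr) (p, q) := by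
  unfold IsReplicaSymmetric Function.IsFixedPt rsMap
  rw [Prod.mk.injEq]
  constructor
  · rintro ⟨h1, h2⟩
    have hq : max q 0 = q := max_eq_left (h2 ▸ nu0_mul_nonneg)
    simp only [hq]
    exact ⟨h1.symm, h2.symm⟩
  · rintro ⟨h1, h2⟩
    have hq : max q 0 = q := max_eq_left (by conv_rhs => rw [← h2]
                                             exact nu0_mul_nonneg)
    simp only [hq] at h1 h2
    exact ⟨h1.symm, h2.symm⟩

lemma contracting_rsMap (hβ : 96 * (β ^ 2 * S ^ 4) ≤ 1) :
    ContractingWith (1 / 2) (rsMap S β h cr) := by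
  refine ⟨by rw [← NNReal.coe_lt_coe]; norm_num, LipschitzWith.of_dist_le_mul fun z w => ?_⟩
  have hmax : max |z.1 - w.1| |max z.2 0 - max w.2 0| ≤ dist z w := by
    rw [Prod.dist_eq, Real.dist_eq, Real.dist_eq]
    refine max_le_max le_rfl ?_
    exact abs_max_sub_max_le_abs _ _ _
  have hd : (0 : ℝ) ≤ dist z w := dist_nonneg
  have hS2 : (0 : ℝ) ≤ β ^ 2 * S ^ 4 := by positivity
  have key : ∀ (n : ℕ) (f : (Fin n → ℝ) → ℝ), n ≤ 2 →
      (∀ ε : Fin n → Spin S, |f fun k => sv (ε k)| ≤ (S : ℝ) ^ 2) →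
      |nu0 S β h cr z.1 (max z.2 0) f - nu0 S β h cr w.1 (max w.2 0) f| ≤ 1 / 2 * dist z w := by
    intro n f hn hf
    refine (abs_nu0_sub_le (le_max_right w.2 0) (le_max_right z.2 0) hf).trans ?_
    have hn' : (n : ℝ) ≤ 2 := by exact_mod_cast hn
    calc _ ≤ 2 * ((S : ℝ) ^ 2 * (4 * 2 * (2 + 1) * (β ^ 2 * (S ^ 2 * dist z w)))) := by gcongr
      _ = 48 * (β ^ 2 * S ^ 4) * dist z w := by ring
      _ ≤ _ := mul_le_mul_of_nonneg_right (by linarith) hd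
  rw [Prod.dist_eq]
  refine max_le ?_ ?_
  · refine (key 1 (fun ε => ε 0 ^ 2) one_le_two fun ε => ?_).trans_eq (by norm_num)
    rw [pow_two]
    exact abs_sv_mul_sv_le _ _
  · exact (key 2 (fun ε => ε 0 * ε 1) le_rfl fun ε => abs_sv_mul_sv_le _ _).trans_eq (by norm_num)

/-- At high temperature the replica-symmetric map is a contraction, hence has exactly one fixed
point. -/
lemma exists_isReplicaSymmetric (hβ : 96 * (β ^ 2 * S ^ 4) ≤ 1) :
    ∃ p q, IsReplicaSymmetric S β h cr p q ∧
      ∀ p' q', IsReplicaSymmetric S β h cr p' q' → p' = p ∧ q' = q := by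
  have hc := contracting_rsMap (h := h) (cr := cr) hβ
  refine ⟨hc.fixedPoint.1, hc.fixedPoint.2, isReplicaSymmetric_iff.2 hc.fixedPoint_isFixedPt,
    fun p' q' h' => ?_⟩
  have := hc.fixedPoint_unique (isReplicaSymmetric_iff.1 h')
  rw [← this]
  exact ⟨rfl, rfl⟩

lemma IsReplicaSymmetric.bounds (hrs : IsReplicaSymmetric S β h cr p q) :
    0 ≤ p ∧ p ≤ S ^ 2 ∧ 0 ≤ q ∧ q ≤ S ^ 2 := by
  obtain ⟨h1, h2⟩ := hrs
  refine ⟨h1 ▸ nu0_sq_nonneg, ?_, h2 ▸ nu0_mul_nonneg, ?_⟩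
  · rw [h1]
    refine (le_abs_self _).trans (abs_nu0_le fun ε => ?_)
    rw [pow_two]; exact abs_sv_mul_sv_le _ _
  · rw [h2]
    exact (le_abs_self _).trans (abs_nu0_le fun ε => abs_sv_mul_sv_le _ _)

end ReplicaSymmetric

/-! ### The cavity path -/

section Cavity

variable {N S : ℕ} {n : ℕ}

/-- The couplings of the cavity path at site `i`. The couplings of the site `i` to the others carry
the weight `sin θ`; one additional Gaussian field acts on the spin at `i` with weight `cos θ`. -/
def cavityCoupling (β q : ℝ) (i : Fin N) (θ : ℝ) : Edge N ⊕ Unit → Config N S → ℝ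
  | Sum.inl e, σ => (if e.1.1 = i ∨ e.1.2 = i then Real.sin θ else 1) *
      (β / √(N : ℝ) * (sv (σ e.1.1) * sv (σ e.1.2)))
  | Sum.inr _, σ => Real.cos θ * (β * √q * sv (σ i))

/-- The derivative of `cavityCoupling` in `θ`. -/
def cavityCoupling' (β q : ℝ) (i : Fin N) (θ : ℝ) : Edge N ⊕ Unit → Config N S → ℝ
  | Sum.inl e, σ => (if e.1.1 = i ∨ e.1.2 = i then Real.cos θ else 0) *
      (β / √(N : ℝ) * (sv (σ e.1.1) * sv (σ e.1.2)))
  | Sum.inr _, σ => -Real.sin θ * (β * √q * sv (σ i))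

/-- The deterministic part of the cavity path at site `i`. -/
def cavityField (β h cr p q : ℝ) (i : Fin N) (θ : ℝ) (σ : Config N S) : ℝ :=
  Real.cos θ ^ 2 * (β ^ 2 / 2 * (p - q) * sv (σ i) ^ 2)
    + (cr * ∑ j, sv (σ j) ^ 2 + h * ∑ j, sv (σ j))

/-- The derivative of `cavityField` in `θ`. -/
def cavityField' (β p q : ℝ) (i : Fin N) (θ : ℝ) (σ : Config N S) : ℝ :=
  -(Real.sin θ * Real.cos θ) * (β ^ 2 * (p - q) * sv (σ i) ^ 2)

/-- The average of a function of `n` replicas along the cavity path at site `i`. At `θ = π / 2` it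
is `ν`; at `θ = 0` the spin at `i` is decoupled from the others. -/
def cavityAvg (β h cr p q : ℝ) (i : Fin N) (θ : ℝ) (f : (Fin n → Config N S) → ℝ) : ℝ :=
  gaussAvg (cavityCoupling β q i θ) (cavityField β h cr p q i θ) f

/-- The overlap of two configurations without the site `i`, still divided by `N`. -/
def cavityOverlap (i : Fin N) (σ τ : Config N S) : ℝ :=
  1 / (N : ℝ) * ∑ j ∈ Finset.univ.erase i, sv (σ j) * sv (τ j)

/-- The function of `n + 2` replicas which represents the derivative of `f` along the cavity
path. -/
def cavityDeriv (p q : ℝ) (i : Fin N) (f : (Fin n → Config N S) → ℝ)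
    (τ : Fin (n + 2) → Config N S) : ℝ :=
  f (fun k => τ k.castSucc.castSucc) *
    ∑ k : Fin (n + 1), ∑ l : Fin (n + 2), replicaCoeff n k * replicaCoeff (n + 1) l *
      (sv (τ k.castSucc i) * sv (τ l i) *
        (cavityOverlap i (τ k.castSucc) (τ l) - target p q k.castSucc l))

lemma hasDerivAt_cavityCoupling (β q : ℝ) (i : Fin N) (θ : ℝ) (j : Edge N ⊕ Unit)
    (σ : Config N S) :
    HasDerivAt (fun θ => cavityCoupling β q i θ j σ) (cavityCoupling' β q i θ j σ) θ := by
  cases j with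
  | inl e =>
    simp only [cavityCoupling, cavityCoupling']
    refine HasDerivAt.mul_const ?_ _
    split_ifs
    · exact Real.hasDerivAt_sin θ
    · exact hasDerivAt_const θ 1
  | inr u => exact (Real.hasDerivAt_cos θ).mul_const _

lemma hasDerivAt_cavityField (β h cr p q : ℝ) (i : Fin N) (θ : ℝ) (σ : Config N S) :
    HasDerivAt (fun θ => cavityField β h cr p q i θ σ) (cavityField' β p q i θ σ) θ := by
  refine ((((Real.hasDerivAt_cos θ).pow 2).mul_const _).add_const _).congr_deriv ?_
  unfold cavityField'
  push_cast
  ring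

lemma exists_cavity_bound (β p q : ℝ) (i : Fin N) :
    ∃ A, (∀ θ j (σ : Config N S), |cavityCoupling' β q i θ j σ| ≤ A) ∧
      ∀ θ (σ : Config N S), |cavityField' β p q i θ σ| ≤ A := by
  refine ⟨|β / √(N : ℝ)| * (S : ℝ) ^ 2 + |β * √q| * S + |β ^ 2 * (p - q)| * (S : ℝ) ^ 2,
    fun θ j σ => ?_, fun θ σ => ?_⟩
  · have h1 : |cavityCoupling' β q i θ j σ| ≤ |β / √(N : ℝ)| * (S : ℝ) ^ 2 + |β * √q| * S := by
      cases j with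
      | inl e =>
        have hx := abs_sv_mul_sv_le (σ e.1.1) (σ e.1.2)
        have hc : |(if e.1.1 = i ∨ e.1.2 = i then Real.cos θ else 0)| ≤ 1 := by
          split_ifs
          · exact Real.abs_cos_le_one θ
          · simp
        rw [cavityCoupling', abs_mul, abs_mul (β / √(N : ℝ))]
        calc _ ≤ 1 * (|β / √(N : ℝ)| * (S : ℝ) ^ 2) := by gcongr
          _ ≤ _ := by rw [one_mul]; exact le_add_of_nonneg_right (by positivity)
      | inr u =>
        have hx := abs_sv_le (σ i)
        rw [cavityCoupling', abs_mul, abs_neg, abs_mul (β * √q)]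
        calc _ ≤ 1 * (|β * √q| * S) := by
              gcongr
              exact Real.abs_sin_le_one θ
          _ ≤ _ := by rw [one_mul]; exact le_add_of_nonneg_left (by positivity)
    exact h1.trans (le_add_of_nonneg_right (by positivity))
  · have hx := abs_sv_le (σ i)
    rw [cavityField', abs_mul, abs_neg, abs_mul (β ^ 2 * (p - q)), abs_pow]
    calc _ ≤ 1 * (|β ^ 2 * (p - q)| * (S : ℝ) ^ 2) := by
          gcongr
          exact abs_sin_mul_cos_le_one θ
      _ ≤ _ := by rw [one_mul]; exact le_add_of_nonneg_left (by positivity)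

/-- The edges at the site `i` correspond to the other sites. -/
lemma sum_edge_incident (i : Fin N) (x : Fin N → ℝ) :
    ∑ e : Edge N, (if e.1.1 = i ∨ e.1.2 = i then x e.1.1 * x e.1.2 else 0)
      = x i * ∑ j ∈ Finset.univ.erase i, x j := by
  rw [← Finset.sum_subtype (Finset.univ.filter fun e : Fin N × Fin N => e.1 < e.2) (by simp)
    (fun e : Fin N × Fin N => if e.1 = i ∨ e.2 = i then x e.1 * x e.2 else 0),
    Finset.sum_filter, Fintype.sum_prod_type]
  have h1 : ∀ a b : Fin N, (if a < b then (if a = i ∨ b = i then x a * x b else 0) else 0)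
      = (if a = i then (if i < b then x i * x b else 0) else 0)
        + (if b = i then (if a < i then x i * x a else 0) else 0) := by
    intro a b
    by_cases ha : a = i <;> by_cases hb : b = i
    · subst ha; subst hb; simp
    · subst ha; simp [hb]
    · subst hb; simp [ha, mul_comm]
    · simp [ha, hb]
  simp_rw [h1, Finset.sum_add_distrib]
  rw [Finset.sum_comm (f := fun a b => if a = i then (if i < b then x i * x b else 0) else 0)]
  simp only [Finset.sum_ite_eq', Finset.mem_univ, if_true]
  rw [← Finset.sum_add_distrib, Finset.mul_sum, ← Finset.add_sum_erase _ _ (Finset.mem_univ i)]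
  simp only [lt_irrefl, if_false, add_zero, zero_add]
  refine Finset.sum_congr rfl fun j hj => ?_
  rcases lt_or_gt_of_ne (Finset.ne_of_mem_erase hj) with hlt | hlt
  · simp [hlt, hlt.not_gt]
  · simp [hlt, hlt.not_gt]

lemma sum_cavityCoupling' {β q : ℝ} (hq : 0 ≤ q) (i : Fin N) (θ : ℝ) (σ τ : Config N S) :
    ∑ j, cavityCoupling' β q i θ j σ * cavityCoupling β q i θ j τ
      = Real.sin θ * Real.cos θ *
        (β ^ 2 * (sv (σ i) * sv (τ i) * (cavityOverlap i σ τ - q))) := by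
  have hN : √(N : ℝ) * √(N : ℝ) = N := Real.mul_self_sqrt (Nat.cast_nonneg N)
  have e1 : √q * √q = q := Real.mul_self_sqrt hq
  have h1 : ∀ e : Edge N,
      cavityCoupling' β q i θ (Sum.inl e) σ * cavityCoupling β q i θ (Sum.inl e) τ
      = Real.sin θ * Real.cos θ * (β ^ 2 / N) *
        (if e.1.1 = i ∨ e.1.2 = i then (fun j => sv (σ j) * sv (τ j)) e.1.1 *
          (fun j => sv (σ j) * sv (τ j)) e.1.2 else 0) := by
    intro e
    have hb : β / √(N : ℝ) * (β / √(N : ℝ)) = β ^ 2 / N := by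
      rw [div_mul_div_comm, hN, pow_two]
    simp only [cavityCoupling, cavityCoupling']
    split_ifs
    · rw [← hb]; ring
    · ring
  rw [Fintype.sum_sum_type]
  simp_rw [h1]
  rw [← Finset.mul_sum, sum_edge_incident i (fun j => sv (σ j) * sv (τ j))]
  simp only [Finset.univ_unique, Finset.sum_singleton, cavityCoupling, cavityCoupling',
    cavityOverlap]
  linear_combination (-(Real.sin θ * Real.cos θ * β ^ 2 * sv (σ i) * sv (τ i))) * e1

theorem hasDerivAt_cavityAvg {β h cr p q : ℝ} (hq : 0 ≤ q) (i : Fin N)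
    (f : (Fin n → Config N S) → ℝ) (θ : ℝ) :
    HasDerivAt (fun θ => cavityAvg β h cr p q i θ f)
      (Real.sin θ * Real.cos θ *
        (β ^ 2 * cavityAvg β h cr p q i θ (cavityDeriv p q i f))) θ := by
  obtain ⟨A, hA, hC⟩ := exists_cavity_bound (S := S) β p q i
  refine (hasDerivAt_gaussAvg (hasDerivAt_cavityCoupling β q i)
    (hasDerivAt_cavityField β h cr p q i) hA hC f θ).congr_deriv ?_
  unfold cavityAvg
  rw [← gaussAvg_const_mul, ← gaussAvg_const_mul]
  congr 1
  funext τ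
  rw [cavityDeriv, mul_left_comm (β ^ 2), mul_left_comm (Real.sin θ * Real.cos θ),
    interpolationKernel]
  congr 1
  rw [Finset.mul_sum, Finset.mul_sum]
  refine Finset.sum_congr rfl fun k _ => ?_
  rw [Finset.mul_sum, Finset.mul_sum]
  refine Finset.sum_congr rfl fun l _ => ?_
  rw [sum_cavityCoupling' hq]
  unfold target cavityField'
  split_ifs with hkl
  · subst hkl; ring
  · ring

/-! ### The two ends of the cavity path -/

lemma integral_stdGaussian_sum {ι κ : Type*} [Fintype ι] [Fintype κ] (F : (ι → ℝ) → ℝ)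
    (G : (κ → ℝ) → ℝ) :
    ∫ g : ι ⊕ κ → ℝ, F (fun j => g (Sum.inl j)) * G (fun j => g (Sum.inr j)) ∂stdGaussian (ι ⊕ κ)
      = (∫ g, F g ∂stdGaussian ι) * ∫ g, G g ∂stdGaussian κ := by
  have hp := measurePreserving_sumPiEquivProdPi (X := fun _ : ι ⊕ κ => ℝ)
    (fun _ : ι ⊕ κ => gaussianReal 0 1)
  rw [← integral_prod_mul]
  exact hp.integral_comp' (fun z : (ι → ℝ) × (κ → ℝ) => F z.1 * G z.2)

lemma cavityAvg_pi_div_two (β h cr p q : ℝ) (i : Fin N) (f : (Fin n → Config N S) → ℝ) :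
    cavityAvg β h cr p q i (Real.pi / 2) f = nu N S β h cr fun _ => f := by
  have hH : ∀ g : Edge N ⊕ Unit → ℝ, gaussHam (cavityCoupling β q i (Real.pi / 2))
      (cavityField β h cr p q i (Real.pi / 2)) g
      = hamiltonian N S β h cr fun e => g (Sum.inl e) := by
    intro g
    funext σ
    simp only [gaussHam, Fintype.sum_sum_type, cavityCoupling, cavityField, Real.sin_pi_div_two,
      Real.cos_pi_div_two, hamiltonian, ite_self, Finset.mul_sum]
    simp only [one_mul, zero_mul, mul_zero, Finset.sum_const_zero, add_zero, ne_eq,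
      OfNat.ofNat_ne_zero, not_false_eq_true, zero_pow, zero_add]
    rw [add_assoc]
    congr 1
    exact Finset.sum_congr rfl fun e _ => by ring
  have := integral_stdGaussian_sum (κ := Unit) (fun g : Edge N → ℝ =>
    replicaAvg (hamiltonian N S β h cr g) f) (fun _ => 1)
  simp only [mul_one, integral_const, probReal_univ, smul_eq_mul] at this
  unfold cavityAvg gaussAvg
  simp_rw [hH]
  exact this

/-- At the start of the path the spin at `i` only feels its own Hamiltonian. -/
lemma gaussHam_cavity_zero (β h cr p q : ℝ) (i : Fin N) (g : Edge N ⊕ Unit → ℝ)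
    (σ : Config N S) :
    gaussHam (cavityCoupling β q i 0) (cavityField β h cr p q i 0) g σ
      = lastHamiltonian S β h cr p q (g (Sum.inr ())) (σ i)
        + gaussHam (cavityCoupling β q i 0) (cavityField β h cr p q i 0)
          (Sum.elim (fun e => g (Sum.inl e)) 0) (Function.update σ i ⟨0, by simp⟩) := by
  have h0 : sv (⟨0, by simp⟩ : Spin S) = 0 := by simp [sv]
  have hsum : ∀ F : Spin S → ℝ, F ⟨0, by simp⟩ = 0 →
      ∑ j, F (σ j) = F (σ i) + ∑ j, F (Function.update σ i ⟨0, by simp⟩ j) := by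
    intro F hF
    rw [← Finset.add_sum_erase _ _ (Finset.mem_univ i),
      ← Finset.add_sum_erase _ (fun j => F (Function.update σ i ⟨0, by simp⟩ j))
        (Finset.mem_univ i), Function.update_self, hF, zero_add]
    congr 1
    exact Finset.sum_congr rfl fun j hj => by
      rw [Function.update_of_ne (Finset.ne_of_mem_erase hj)]
  have hedge : ∀ e : Edge N, cavityCoupling β q i 0 (Sum.inl e) σ
      = cavityCoupling β q i 0 (Sum.inl e) (Function.update σ i ⟨0, by simp⟩) := by
    intro e
    simp only [cavityCoupling, Real.sin_zero]
    split_ifs with he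
    · ring
    · push Not at he
      rw [Function.update_of_ne he.1, Function.update_of_ne he.2]
  simp only [gaussHam, Fintype.sum_sum_type, Sum.elim_inl, Sum.elim_inr, ← hedge, cavityField,
    hsum (fun x => sv x ^ 2) (by simp [h0]), hsum sv h0]
  simp only [Finset.univ_unique, Finset.sum_singleton, cavityCoupling, Real.cos_zero,
    lastHamiltonian, PUnit.default_eq_unit, Pi.zero_apply, Function.update_self, h0]
  ring

/-- At the start of the path, functions of the spins at `i` are independent of functions of the
other spins. -/
theorem cavityAvg_zero_mul (β h cr p q : ℝ) (i : Fin N) (a : (Fin n → ℝ) → ℝ)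
    {b : (Fin n → Config N S) → ℝ}
    (hb : ∀ σ, b (fun k => Function.update (σ k) i ⟨0, by simp⟩) = b σ) :
    cavityAvg β h cr p q i 0 (fun σ => a (fun k => sv (σ k i)) * b σ)
      = nu0 S β h cr p q a * cavityAvg β h cr p q i 0 b := by
  let e : Config N S ≃ Spin S × ({j // j ≠ i} → Spin S) := Equiv.funSplitAt i (Spin S)
  let ext : ({j // j ≠ i} → Spin S) → Config N S := fun y => e.symm (⟨0, by simp⟩, y)
  have hext : ∀ σ : Config N S, ext (e σ).2 = Function.update σ i ⟨0, by simp⟩ := by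
    intro σ
    funext j
    by_cases hj : j = i
    · subst hj; simp [ext, e, Equiv.funSplitAt, Equiv.piSplitAt]
    · simp [ext, e, Equiv.funSplitAt, Equiv.piSplitAt, hj]
  let HY : (Edge N → ℝ) → ({j // j ≠ i} → Spin S) → ℝ := fun g y =>
    gaussHam (cavityCoupling β q i 0) (cavityField β h cr p q i 0) (Sum.elim g 0) (ext y)
  have hfac : ∀ (a : (Fin n → ℝ) → ℝ) (g : Edge N ⊕ Unit → ℝ),
      replicaAvg (gaussHam (cavityCoupling β q i 0) (cavityField β h cr p q i 0) g)
        (fun σ => a (fun k => sv (σ k i)) * b σ)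
      = replicaAvg (HY fun j => g (Sum.inl j)) (fun y => b fun k => ext (y k)) *
        replicaAvg (lastHamiltonian S β h cr p q (g (Sum.inr ())))
          (fun ε => a fun k => sv (ε k)) := by
    intro a g
    rw [mul_comm, ← replicaAvg_prodMk, ← replicaAvg_equiv e]
    congr 1
    · funext σ
      rw [gaussHam_cavity_zero, ← hext]
      rfl
    · funext σ
      simp only [hext, hb]
      rfl
  have hint : ∀ a : (Fin n → ℝ) → ℝ,
      cavityAvg β h cr p q i 0 (fun σ => a (fun k => sv (σ k i)) * b σ)
      = (∫ g, replicaAvg (HY g) (fun y => b fun k => ext (y k)) ∂stdGaussian (Edge N)) *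
        nu0 S β h cr p q a := by
    intro a
    unfold cavityAvg gaussAvg
    simp_rw [hfac a]
    have h1 := integral_stdGaussian_sum (fun g => replicaAvg (HY g) fun y => b fun k => ext (y k))
      (fun u : Unit → ℝ => replicaAvg (lastHamiltonian S β h cr p q (u ()))
          (fun ε => a fun k => sv (ε k)))
    rw [h1, nu0_eq, integral_eval_stdGaussian ()
      (F := fun η => replicaAvg (lastHamiltonian S β h cr p q η) (fun ε => a fun k => sv (ε k)))
      (continuous_replicaAvg continuous_lastHamiltonian _)]
  have h1 := hint fun _ => 1
  simp only [one_mul, nu0_const, mul_one] at h1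
  rw [hint a, h1, mul_comm]

end Cavity

/-! ### Error terms along the cavity path -/

section CavityError

variable {N S : ℕ} {n : ℕ}

/-- The couplings of the Ghatak–Sherrington Hamiltonian. -/
def fullCoupling (β : ℝ) (e : Edge N) (σ : Config N S) : ℝ :=
  β / √(N : ℝ) * (sv (σ e.1.1) * sv (σ e.1.2))

/-- The deterministic part of the Ghatak–Sherrington Hamiltonian. -/
def fullField (h cr : ℝ) (σ : Config N S) : ℝ := cr * ∑ j, sv (σ j) ^ 2 + h * ∑ j, sv (σ j)

/-- `ν(f)` for a function of the replicas which does not depend on the disorder. -/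
def fullAvg (β h cr : ℝ) (f : (Fin n → Config N S) → ℝ) : ℝ :=
  gaussAvg (fullCoupling β) (fullField h cr) f

lemma nu_eq_fullAvg (β h cr : ℝ) (f : (Fin n → Config N S) → ℝ) :
    nu N S β h cr (fun _ => f) = fullAvg β h cr f := by
  have hH : ∀ g : Disorder N, hamiltonian N S β h cr g
      = gaussHam (fullCoupling β) (fullField h cr) g := by
    intro g
    funext σ
    simp only [gaussHam, fullCoupling, fullField, hamiltonian, Finset.mul_sum]
    rw [add_assoc]
    congr 1
    exact Finset.sum_congr rfl fun e _ => by ring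
  unfold fullAvg gaussAvg
  simp_rw [← hH]
  rfl

lemma cavityAvg_end (β h cr p q : ℝ) (i : Fin N) (f : (Fin n → Config N S) → ℝ) :
    cavityAvg β h cr p q i (Real.pi / 2) f = fullAvg β h cr f := by
  rw [cavityAvg_pi_div_two, nu_eq_fullAvg]

/-- The total deviation of the overlaps without the site `i` from their targets. -/
def cavityError (p q : ℝ) (i : Fin N) (σ : Fin n → Config N S) : ℝ :=
  ∑ k, ∑ l, |cavityOverlap i (σ k) (σ l) - target p q k l|

lemma cavityError_nonneg (p q : ℝ) (i : Fin N) (σ : Fin n → Config N S) :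
    0 ≤ cavityError p q i σ :=
  Finset.sum_nonneg fun _ _ => Finset.sum_nonneg fun _ _ => abs_nonneg _

lemma le_cavityError (p q : ℝ) (i : Fin N) (σ : Fin n → Config N S) (k l : Fin n) :
    |cavityOverlap i (σ k) (σ l) - target p q k l| ≤ cavityError p q i σ :=
  (Finset.single_le_sum (f := fun l => |cavityOverlap i (σ k) (σ l) - target p q k l|)
    (fun _ _ => abs_nonneg _) (Finset.mem_univ l)).trans
  (Finset.single_le_sum (f := fun k => ∑ l, |cavityOverlap i (σ k) (σ l) - target p q k l|)
    (fun _ _ => Finset.sum_nonneg fun _ _ => abs_nonneg _) (Finset.mem_univ k))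

lemma target_castSucc (p q : ℝ) (k l : Fin n) :
    target p q k.castSucc l.castSucc = target p q k l := by
  simp [target]

lemma cavityError_castSucc_le (p q : ℝ) (i : Fin N) (τ : Fin (n + 1) → Config N S) :
    cavityError p q i (fun k => τ k.castSucc) ≤ cavityError p q i τ := by
  unfold cavityError
  rw [Fin.sum_univ_castSucc (n := n)]
  refine le_add_of_le_of_nonneg (Finset.sum_le_sum fun k _ => ?_)
    (Finset.sum_nonneg fun _ _ => abs_nonneg _)
  rw [Fin.sum_univ_castSucc (n := n)]
  simp only [target_castSucc]
  exact le_add_of_nonneg_right (abs_nonneg _)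

lemma abs_cavityOverlap_le (i : Fin N) (σ τ : Config N S) :
    |cavityOverlap i σ τ| ≤ (S : ℝ) ^ 2 := by
  have hN : (0 : ℝ) < N := by exact_mod_cast i.pos
  rw [cavityOverlap, abs_mul, abs_of_nonneg (by positivity), one_div, inv_mul_le_iff₀ hN]
  refine (Finset.abs_sum_le_sum_abs _ _).trans
    ((Finset.sum_le_sum fun j _ => abs_sv_mul_sv_le _ _).trans ?_)
  rw [Finset.sum_const, nsmul_eq_mul]
  refine mul_le_mul_of_nonneg_right ?_ (by positivity)
  exact_mod_cast (Finset.card_le_univ _).trans_eq (Fintype.card_fin N)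

lemma abs_replicaCoeff_le (k : Fin (n + 1)) : |replicaCoeff n k| ≤ n + 1 := by
  unfold replicaCoeff
  split_ifs
  · simp
  · simp

/-- Each interpolation step gains one factor of the deviations of the overlaps. -/
lemma abs_cavityDeriv_le_error (p q : ℝ) (i : Fin N) {f : (Fin n → Config N S) → ℝ} {B : ℝ} {m : ℕ}
    (hB : 0 ≤ B) (hf : ∀ σ, |f σ| ≤ B * cavityError p q i σ ^ m)
    (τ : Fin (n + 2) → Config N S) :
    |cavityDeriv p q i f τ|
      ≤ B * ((n + 1) * (n + 2) * S ^ 2) * cavityError p q i τ ^ (m + 1) := by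
  have h1 : |f fun k => τ k.castSucc.castSucc| ≤ B * cavityError p q i τ ^ m := by
    refine (hf _).trans (mul_le_mul_of_nonneg_left (pow_le_pow_left₀ (cavityError_nonneg _ _ _ _)
      ?_ m) hB)
    exact (cavityError_castSucc_le p q i fun k => τ k.castSucc).trans
      (cavityError_castSucc_le p q i τ)
  have h2 : |∑ k : Fin (n + 1), ∑ l : Fin (n + 2), replicaCoeff n k * replicaCoeff (n + 1) l *
      (sv (τ k.castSucc i) * sv (τ l i) *
        (cavityOverlap i (τ k.castSucc) (τ l) - target p q k.castSucc l))|
      ≤ (n + 1) * (n + 2) * S ^ 2 * cavityError p q i τ := by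
    have h3 : ∀ (k : Fin (n + 1)) (l : Fin (n + 2)),
        |replicaCoeff n k * replicaCoeff (n + 1) l * (sv (τ k.castSucc i) * sv (τ l i) *
          (cavityOverlap i (τ k.castSucc) (τ l) - target p q k.castSucc l))|
        ≤ (n + 1) * (n + 2) * S ^ 2 *
          |cavityOverlap i (τ k.castSucc) (τ l) - target p q k.castSucc l| := by
      intro k l
      rw [abs_mul, abs_mul, abs_mul (sv _ * sv _), ← mul_assoc]
      have e1 := abs_replicaCoeff_le k
      have e2 := abs_replicaCoeff_le l
      have e3 := abs_sv_mul_sv_le (τ k.castSucc i) (τ l i)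
      push_cast at e2
      have e2' : |replicaCoeff (n + 1) l| ≤ (n : ℝ) + 2 := by linarith
      gcongr
    refine (Finset.abs_sum_le_sum_abs _ _).trans ((Finset.sum_le_sum fun k _ =>
      (Finset.abs_sum_le_sum_abs _ _).trans (Finset.sum_le_sum fun l _ => h3 k l)).trans ?_)
    simp_rw [← Finset.mul_sum]
    refine mul_le_mul_of_nonneg_left ?_ (by positivity)
    unfold cavityError
    rw [Fin.sum_univ_castSucc (n := n + 1)]
    exact le_add_of_nonneg_right (Finset.sum_nonneg fun _ _ => abs_nonneg _)
  rw [cavityDeriv, abs_mul]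
  refine (mul_le_mul h1 h2 (abs_nonneg _)
    (mul_nonneg hB (pow_nonneg (cavityError_nonneg _ _ _ _) _))).trans_eq ?_
  ring

lemma abs_sub_target_le {p q : ℝ} (hp : p ∈ Set.Icc (0 : ℝ) (S ^ 2))
    (hq : q ∈ Set.Icc (0 : ℝ) (S ^ 2)) {x : ℝ} (hx : |x| ≤ (S : ℝ) ^ 2) (k l : Fin n) :
    |x - target p q k l| ≤ 2 * S ^ 2 := by
  have hx' := abs_le.1 hx
  rw [abs_le]
  unfold target
  split_ifs
  · constructor <;> linarith [hp.1, hp.2]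
  · constructor <;> linarith [hq.1, hq.2]

/-- Averages of nonnegative functions along the path are controlled by the end of the path. -/
lemma cavityAvg_le_exp_mul {β h cr p q : ℝ} (hp : p ∈ Set.Icc (0 : ℝ) (S ^ 2))
    (hq : q ∈ Set.Icc (0 : ℝ) (S ^ 2)) (i : Fin N) {f : (Fin n → Config N S) → ℝ}
    (hf : ∀ σ, 0 ≤ f σ) {θ : ℝ} (hθ : θ ∈ Set.Icc 0 (Real.pi / 2)) :
    cavityAvg β h cr p q i θ f
      ≤ Real.exp (2 * (β ^ 2 * (4 * n * (n + 1) * (S ^ 2 * (2 * S ^ 2))))) * fullAvg β h cr f := by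
  rw [← cavityAvg_end β h cr p q i]
  refine le_exp_mul_of_hasDerivAt_sin_mul_cos (hasDerivAt_cavityAvg hq.1 i f) (by positivity)
    (fun θ => gaussAvg_nonneg _ _ hf) (fun θ => ?_) hθ
  rw [abs_mul, abs_of_nonneg (sq_nonneg β), mul_assoc]
  refine mul_le_mul_of_nonneg_left ?_ (sq_nonneg β)
  unfold cavityAvg
  refine (abs_gaussAvg_le _ _ _).trans ?_
  rw [← gaussAvg_comp _ _ (Fin.castSucc_injective n) f,
    ← gaussAvg_comp _ _ (Fin.castSucc_injective (n + 1)), ← gaussAvg_const_mul]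
  refine gaussAvg_mono _ _ fun τ => ?_
  rw [cavityDeriv, abs_mul, mul_comm]
  refine mul_le_mul (abs_sum_replicaCoeff_le fun k l => ?_) (le_of_eq (abs_of_nonneg (hf _)))
    (abs_nonneg _) (by positivity)
  rw [abs_mul]
  exact mul_le_mul (abs_sv_mul_sv_le _ _) (abs_sub_target_le hp hq (abs_cavityOverlap_le i _ _) _ _)
    (abs_nonneg _) (by positivity)

/-- The sum of the moments of order `m` of the deviations of the overlap and of the self-overlap
from their targets. -/
def overlapMoment (N S : ℕ) (β h cr p q : ℝ) (m : ℕ) : ℝ :=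
  fullAvg (N := N) (S := S) (n := 2) β h cr (fun σ => |overlap σ 0 1 - q| ^ m)
    + fullAvg (N := N) (S := S) (n := 2) β h cr (fun σ => |overlap σ 0 0 - p| ^ m)

lemma overlapMoment_nonneg (β h cr p q : ℝ) (m : ℕ) : 0 ≤ overlapMoment N S β h cr p q m :=
  add_nonneg (gaussAvg_nonneg _ _ fun _ => by positivity)
    (gaussAvg_nonneg _ _ fun _ => by positivity)

lemma overlap_eq (i : Fin N) (σ : Fin n → Config N S) (k l : Fin n) :
    overlap σ k l = cavityOverlap i (σ k) (σ l) + 1 / N * (sv (σ k i) * sv (σ l i)) := by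
  rw [overlap, cavityOverlap, ← Finset.add_sum_erase _ _ (Finset.mem_univ i)]
  ring

lemma abs_overlap_sub_cavityOverlap_le (i : Fin N) (σ : Fin n → Config N S) (k l : Fin n) :
    |overlap σ k l - cavityOverlap i (σ k) (σ l)| ≤ S ^ 2 / N := by
  rw [overlap_eq i, add_sub_cancel_left, abs_mul, abs_of_nonneg (by positivity), one_div,
    div_eq_inv_mul]
  exact mul_le_mul_of_nonneg_left (abs_sv_mul_sv_le _ _) (by positivity)

lemma cavityAvg_pow_le {β h cr p q : ℝ} (hβ : β ^ 2 ≤ 1) (hp : p ∈ Set.Icc (0 : ℝ) (S ^ 2))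
    (hq : q ∈ Set.Icc (0 : ℝ) (S ^ 2)) (i : Fin N) {θ : ℝ} (hθ : θ ∈ Set.Icc 0 (Real.pi / 2))
    (m : ℕ) (k l : Fin n) :
    cavityAvg β h cr p q i θ
        (fun σ : Fin n → Config N S => |cavityOverlap i (σ k) (σ l) - target p q k l| ^ m)
      ≤ Real.exp (96 * S ^ 4) * (2 ^ m * (1 + S ^ 2) ^ m) *
        (overlapMoment N S β h cr p q m + (1 / N) ^ m) := by
  have hN : (0 : ℝ) < N := by exact_mod_cast i.pos
  have hexp : Real.exp (2 * (β ^ 2 * (4 * (2 : ℕ) * ((2 : ℕ) + 1) * (S ^ 2 * (2 * (S : ℝ) ^ 2)))))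
      ≤ Real.exp (96 * S ^ 4) := by
    refine Real.exp_le_exp.2 ?_
    have : β ^ 2 * (S : ℝ) ^ 4 ≤ 1 * S ^ 4 := mul_le_mul_of_nonneg_right hβ (by positivity)
    push_cast
    nlinarith
  have key : ∀ x y : Fin 2, fullAvg (N := N) (S := S) (n := 2) β h cr
      (fun σ => |overlap σ x y - target p q x y| ^ m) ≤ overlapMoment N S β h cr p q m →
      cavityAvg β h cr p q i θ
        (fun σ : Fin 2 → Config N S => |cavityOverlap i (σ x) (σ y) - target p q x y| ^ m)
      ≤ Real.exp (96 * S ^ 4) * (2 ^ m * (1 + S ^ 2) ^ m) *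
        (overlapMoment N S β h cr p q m + (1 / N) ^ m) := by
    intro x y hxy
    refine (cavityAvg_le_exp_mul hp hq i (fun σ => by positivity) hθ).trans ?_
    rw [mul_assoc (Real.exp (96 * (S : ℝ) ^ 4))]
    refine mul_le_mul hexp ?_ (gaussAvg_nonneg _ _ fun _ => by positivity) (Real.exp_pos _).le
    have hpt : ∀ σ : Fin 2 → Config N S, |cavityOverlap i (σ x) (σ y) - target p q x y| ^ m
        ≤ 2 ^ m * (1 + (S : ℝ) ^ 2) ^ m * |overlap σ x y - target p q x y| ^ m
          + 2 ^ m * (1 + (S : ℝ) ^ 2) ^ m * (1 / N) ^ m := by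
      intro σ
      have h1 : |cavityOverlap i (σ x) (σ y) - target p q x y|
          ≤ |overlap σ x y - target p q x y| + S ^ 2 / N := by
        have h2 := abs_overlap_sub_cavityOverlap_le i σ x y
        have h3 := abs_sub_le (cavityOverlap i (σ x) (σ y)) (overlap σ x y) (target p q x y)
        rw [abs_sub_comm] at h2
        linarith
      have hS1 : (1 : ℝ) ≤ 1 + (S : ℝ) ^ 2 := le_add_of_nonneg_right (by positivity)
      have h4 : |overlap σ x y - target p q x y| + S ^ 2 / N
          ≤ (1 + (S : ℝ) ^ 2) * |overlap σ x y - target p q x y| + (1 + S ^ 2) * (1 / N) := by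
        have e1 : (S : ℝ) ^ 2 / N ≤ (1 + S ^ 2) * (1 / N) := by
          rw [mul_one_div]
          gcongr
          linarith
        have e2 := le_mul_of_one_le_left (abs_nonneg (overlap σ x y - target p q x y)) hS1
        linarith
      refine (pow_le_pow_left₀ (abs_nonneg _) (h1.trans h4) m).trans
        ((add_pow_le (by positivity) (by positivity) m).trans ?_)
      rw [mul_pow, mul_pow]
      have h5 : (2 : ℝ) ^ (m - 1) ≤ 2 ^ m := pow_le_pow_right₀ one_le_two (Nat.sub_le m 1)
      calc _ ≤ 2 ^ m * ((1 + (S : ℝ) ^ 2) ^ m * |overlap σ x y - target p q x y| ^ m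
            + (1 + (S : ℝ) ^ 2) ^ m * (1 / N) ^ m) := by gcongr
        _ = _ := by ring
    refine (gaussAvg_mono _ _ hpt).trans ?_
    rw [gaussAvg_add, gaussAvg_const_mul, gaussAvg_const, ← mul_add]
    refine mul_le_mul_of_nonneg_left ?_ (by positivity)
    exact add_le_add hxy le_rfl
  by_cases hkl : k = l
  · subst hkl
    have h0 := key 0 0 (by
      simp only [target, if_true]
      exact le_add_of_nonneg_left (gaussAvg_nonneg _ _ fun _ => by positivity))
    refine le_of_eq_of_le ?_ h0
    unfold cavityAvg
    have e1 := gaussAvg_comp (cavityCoupling β q i θ) (cavityField β h cr p q i θ)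
      (φ := fun _ : Fin 1 => k) (fun a b _ => Subsingleton.elim a b)
      (fun σ : Fin 1 → Config N S => |cavityOverlap i (σ 0) (σ 0) - p| ^ m)
    have e2 := gaussAvg_comp (cavityCoupling β q i θ) (cavityField β h cr p q i θ)
      (φ := fun _ : Fin 1 => (0 : Fin 2)) (fun a b _ => Subsingleton.elim a b)
      (fun σ : Fin 1 → Config N S => |cavityOverlap i (σ 0) (σ 0) - p| ^ m)
    simp only [Function.comp] at e1 e2
    simp only [target, if_true]
    rw [e1, e2]
  · have h0 := key 0 1 (by
      simp only [target, Fin.zero_eq_one_iff, OfNat.ofNat_ne_one, if_false]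
      exact le_add_of_nonneg_right (gaussAvg_nonneg _ _ fun _ => by positivity))
    refine le_of_eq_of_le ?_ h0
    unfold cavityAvg
    have hinj : Function.Injective ![k, l] := by
      intro a b hab
      fin_cases a <;> fin_cases b <;> simp_all
    have e1 := gaussAvg_comp (cavityCoupling β q i θ) (cavityField β h cr p q i θ) hinj
      (fun σ : Fin 2 → Config N S => |cavityOverlap i (σ 0) (σ 1) - q| ^ m)
    simp only [Function.comp, Matrix.cons_val_zero, Matrix.cons_val_one] at e1
    simp only [target, hkl, Fin.zero_eq_one_iff, OfNat.ofNat_ne_one, if_false]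
    exact e1

/-- The constant in `cavityAvg_cavityError_le`. -/
def momentConst (S n m : ℕ) : ℝ :=
  (n * n : ℝ) ^ m * (n * (n * (Real.exp (96 * S ^ 4) * (2 ^ (m + 1) * (1 + S ^ 2) ^ (m + 1)))))

lemma momentConst_nonneg (S n m : ℕ) : 0 ≤ momentConst S n m := by
  unfold momentConst; positivity

lemma cavityError_pow_le (p q : ℝ) (i : Fin N) (m : ℕ) (σ : Fin n → Config N S) :
    cavityError p q i σ ^ (m + 1) ≤ (n * n : ℝ) ^ m *
      ∑ k, ∑ l, |cavityOverlap i (σ k) (σ l) - target p q k l| ^ (m + 1) := by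
  rcases Nat.eq_zero_or_pos n with rfl | hn
  · simp [cavityError]
  have h1 := pow_sum_div_card_le_sum_pow (s := (Finset.univ : Finset (Fin n × Fin n)))
    (f := fun x => |cavityOverlap i (σ x.1) (σ x.2) - target p q x.1 x.2|)
    (fun x _ => abs_nonneg _) m
  rw [Fintype.sum_prod_type, Fintype.sum_prod_type, Finset.card_univ, Fintype.card_prod,
    Fintype.card_fin, Nat.cast_mul, div_le_iff₀ (by positivity), mul_comm] at h1
  exact h1

/-- The moments of the deviations along the cavity path. -/
lemma cavityAvg_cavityError_le {β h cr p q : ℝ} (hβ : β ^ 2 ≤ 1)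
    (hp : p ∈ Set.Icc (0 : ℝ) (S ^ 2)) (hq : q ∈ Set.Icc (0 : ℝ) (S ^ 2)) (i : Fin N) {θ : ℝ}
    (hθ : θ ∈ Set.Icc 0 (Real.pi / 2)) (m : ℕ) :
    cavityAvg β h cr p q i θ (fun σ : Fin n → Config N S => cavityError p q i σ ^ (m + 1))
      ≤ momentConst S n m * (overlapMoment N S β h cr p q (m + 1) + (1 / N) ^ (m + 1)) := by
  have h1 : cavityAvg β h cr p q i θ
      (fun σ : Fin n → Config N S => cavityError p q i σ ^ (m + 1))
      ≤ (n * n : ℝ) ^ m * ∑ k : Fin n, ∑ l : Fin n, cavityAvg β h cr p q i θ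
        (fun σ : Fin n → Config N S =>
          |cavityOverlap i (σ k) (σ l) - target p q k l| ^ (m + 1)) := by
    refine (gaussAvg_mono _ _ (cavityError_pow_le p q i m)).trans_eq ?_
    rw [gaussAvg_const_mul, gaussAvg_sum]
    simp only [gaussAvg_sum]
    rfl
  refine h1.trans ?_
  refine (mul_le_mul_of_nonneg_left (Finset.sum_le_sum fun k _ => Finset.sum_le_sum fun l _ =>
    cavityAvg_pow_le hβ hp hq i hθ (m + 1) k l) (by positivity)).trans_eq ?_
  simp only [Finset.sum_const, Finset.card_univ, Fintype.card_fin, nsmul_eq_mul, momentConst]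
  ring

end CavityError

/-! ### Expansions at the decoupled end -/

section Expansion

variable {N S : ℕ} {n : ℕ} {β h cr p q : ℝ}

lemma abs_cavityAvg_le_of_error (hβ : β ^ 2 ≤ 1) (hp : p ∈ Set.Icc (0 : ℝ) (S ^ 2))
    (hq : q ∈ Set.Icc (0 : ℝ) (S ^ 2)) (i : Fin N) {f : (Fin n → Config N S) → ℝ} {B : ℝ} {m : ℕ}
    (hB : 0 ≤ B) (hf : ∀ σ, |f σ| ≤ B * cavityError p q i σ ^ (m + 1)) {θ : ℝ}
    (hθ : θ ∈ Set.Icc 0 (Real.pi / 2)) :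
    |cavityAvg β h cr p q i θ f|
      ≤ B * (momentConst S n m * (overlapMoment N S β h cr p q (m + 1) + (1 / N) ^ (m + 1))) := by
  refine (abs_gaussAvg_le _ _ _).trans ((gaussAvg_mono _ _ hf).trans ?_)
  rw [gaussAvg_const_mul]
  exact mul_le_mul_of_nonneg_left (cavityAvg_cavityError_le hβ hp hq i hθ m) hB

/-- Zeroth-order expansion at the decoupled end. -/
lemma abs_cavityAvg_sub_le (hβ : β ^ 2 ≤ 1) (hp : p ∈ Set.Icc (0 : ℝ) (S ^ 2))
    (hq : q ∈ Set.Icc (0 : ℝ) (S ^ 2)) (i : Fin N) {f : (Fin n → Config N S) → ℝ} {B : ℝ} {m : ℕ}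
    (hB : 0 ≤ B) (hf : ∀ σ, |f σ| ≤ B * cavityError p q i σ ^ m) {θ : ℝ}
    (hθ : θ ∈ Set.Icc 0 (Real.pi / 2)) :
    |cavityAvg β h cr p q i θ f - cavityAvg β h cr p q i 0 f|
      ≤ 2 * (β ^ 2 * (B * ((n + 1) * (n + 2) * S ^ 2) * (momentConst S (n + 2) m *
        (overlapMoment N S β h cr p q (m + 1) + (1 / N) ^ (m + 1))))) := by
  refine abs_sub_le_of_hasDerivAt_sin_mul_cos (hasDerivAt_cavityAvg hq.1 i f) (fun θ hθ => ?_) hθ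
  rw [abs_mul, abs_of_nonneg (sq_nonneg β)]
  exact mul_le_mul_of_nonneg_left (abs_cavityAvg_le_of_error hβ hp hq i (by positivity)
    (abs_cavityDeriv_le_error p q i hB hf) hθ) (sq_nonneg β)

/-- First-order expansion at the decoupled end. -/
lemma abs_cavityAvg_sub_sub_le (hβ : β ^ 2 ≤ 1) (hp : p ∈ Set.Icc (0 : ℝ) (S ^ 2))
    (hq : q ∈ Set.Icc (0 : ℝ) (S ^ 2)) (i : Fin N) {f : (Fin n → Config N S) → ℝ} {B : ℝ} {m : ℕ}
    (hB : 0 ≤ B) (hf : ∀ σ, |f σ| ≤ B * cavityError p q i σ ^ m) :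
    |fullAvg β h cr f - cavityAvg β h cr p q i 0 f
        - β ^ 2 / 2 * cavityAvg β h cr p q i 0 (cavityDeriv p q i f)|
      ≤ 2 * (β ^ 2 * (2 * (β ^ 2 * (B * ((n + 1) * (n + 2) * S ^ 2) *
        (((n + 2 : ℕ) + 1) * ((n + 2 : ℕ) + 2) * S ^ 2) * (momentConst S (n + 2 + 2) (m + 1) *
        (overlapMoment N S β h cr p q (m + 1 + 1) + (1 / N) ^ (m + 1 + 1))))))) := by
  rw [← cavityAvg_end β h cr p q i]
  have := abs_sub_sub_half_le_of_hasDerivAt_sin_mul_cos (hasDerivAt_cavityAvg (h := h) (cr := cr)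
    (p := p) (β := β) hq.1 i f) (fun θ hθ => by
      rw [← mul_sub, abs_mul, abs_of_nonneg (sq_nonneg β)]
      exact mul_le_mul_of_nonneg_left (abs_cavityAvg_sub_le hβ hp hq i (by positivity)
        (abs_cavityDeriv_le_error p q i hB hf) hθ) (sq_nonneg β))
  rw [← mul_assoc, show 1 / 2 * β ^ 2 = β ^ 2 / 2 by ring] at this
  exact this

lemma cavityOverlap_update (i : Fin N) (σ τ : Config N S) (x y : Spin S) :
    cavityOverlap i (Function.update σ i x) (Function.update τ i y) = cavityOverlap i σ τ := by
  unfold cavityOverlap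
  congr 1
  exact Finset.sum_congr rfl fun j hj => by
    rw [Function.update_of_ne (Finset.ne_of_mem_erase hj),
      Function.update_of_ne (Finset.ne_of_mem_erase hj)]

/-! ### Concentration of the overlaps -/

/-- The constant in front of `β ^ 2` in `fullAvg_pow_le`. -/
def concConst (S s : ℕ) : ℝ := 48 * S ^ 4 * momentConst S 4 (s + 1)

/-- The constant in front of the lower moment in `fullAvg_pow_le`. -/
def siteConst (S s : ℕ) : ℝ := 2 * S ^ 4 * (s + 1) * 2 ^ s * (1 + S ^ 2) ^ s

lemma concConst_nonneg (S s : ℕ) : 0 ≤ concConst S s :=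
  mul_nonneg (by positivity) (momentConst_nonneg _ _ _)

lemma siteConst_nonneg (S s : ℕ) : 0 ≤ siteConst S s := by
  unfold siteConst; positivity

/-- One factor of the deviation is written as a sum over the sites and each site is decoupled: the
leading term vanishes by the replica-symmetric equation. -/
lemma fullAvg_pow_le (hN : 1 ≤ N) (hβ : β ^ 2 ≤ 1) (hp : p ∈ Set.Icc (0 : ℝ) (S ^ 2))
    (hq : q ∈ Set.Icc (0 : ℝ) (S ^ 2)) {s : ℕ} (hs : Even s) (x y : Fin 2)
    (hxy : nu0 S β h cr p q (n := 2) (fun ε => ε x * ε y) = target p q x y)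
    (hM : fullAvg (N := N) (S := S) (n := 2) β h cr
      (fun σ => |overlap σ x y - target p q x y| ^ s) ≤ overlapMoment N S β h cr p q s) :
    fullAvg (N := N) (S := S) (n := 2) β h cr
        (fun σ => |overlap σ x y - target p q x y| ^ (s + 2))
      ≤ β ^ 2 * concConst S s * (overlapMoment N S β h cr p q (s + 2) + (1 / N) ^ (s + 2))
        + siteConst S s / N * (overlapMoment N S β h cr p q s + (1 / N) ^ s) := by
  have hN0 : (0 : ℝ) < N := by exact_mod_cast hN
  set r := target p q x y with hr
  have hsum : ∀ σ : Fin 2 → Config N S, |overlap σ x y - r| ^ (s + 2)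
      = 1 / N * ∑ i, (sv (σ x i) * sv (σ y i) - r) * (overlap σ x y - r) ^ (s + 1) := by
    intro σ
    rw [← Finset.sum_mul, Finset.sum_sub_distrib, ← mul_assoc, mul_sub]
    simp only [Finset.sum_const, Finset.card_univ, Fintype.card_fin, nsmul_eq_mul]
    rw [show 1 / (N : ℝ) * (N * r) = r by field_simp]
    rw [(hs.add even_two).pow_abs]
    unfold overlap
    ring
  have hsite : ∀ i : Fin N, fullAvg (N := N) (S := S) (n := 2) β h cr (fun σ =>
      (sv (σ x i) * sv (σ y i) - r) * (overlap σ x y - r) ^ (s + 1))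
      ≤ β ^ 2 * concConst S s * (overlapMoment N S β h cr p q (s + 2) + (1 / N) ^ (s + 2))
        + siteConst S s / N * (overlapMoment N S β h cr p q s + (1 / N) ^ s) := by
    intro i
    have hε : ∀ σ : Fin 2 → Config N S, |sv (σ x i) * sv (σ y i) - r| ≤ 2 * S ^ 2 := fun σ =>
      abs_sub_target_le hp hq (abs_sv_mul_sv_le _ _) x y
    have hpt : ∀ σ : Fin 2 → Config N S,
        (sv (σ x i) * sv (σ y i) - r) * (overlap σ x y - r) ^ (s + 1)
        ≤ (sv (σ x i) * sv (σ y i) - r) * (cavityOverlap i (σ x) (σ y) - r) ^ (s + 1)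
          + siteConst S s / N * (|overlap σ x y - r| ^ s + (1 / N) ^ s) := by
      intro σ
      have h1 := abs_overlap_sub_cavityOverlap_le i σ x y
      have h2 := abs_pow_sub_pow_le (overlap σ x y - r) (cavityOverlap i (σ x) (σ y) - r) (s + 1)
      rw [sub_sub_sub_cancel_right, Nat.add_sub_cancel] at h2
      have hS1 : (1 : ℝ) ≤ 1 + (S : ℝ) ^ 2 := le_add_of_nonneg_right (by positivity)
      have h3 : max |overlap σ x y - r| |cavityOverlap i (σ x) (σ y) - r|
          ≤ (1 + (S : ℝ) ^ 2) * |overlap σ x y - r| + (1 + S ^ 2) * (1 / N) := by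
        have e1 : (S : ℝ) ^ 2 / N ≤ (1 + S ^ 2) * (1 / N) := by
          rw [mul_one_div]
          gcongr
          linarith
        have e2 := le_mul_of_one_le_left (abs_nonneg (overlap σ x y - r)) hS1
        have e3 := abs_sub_le (cavityOverlap i (σ x) (σ y)) (overlap σ x y) r
        have h1' := h1
        rw [abs_sub_comm] at h1'
        have e4 : (0 : ℝ) ≤ (1 + S ^ 2) * (1 / N) := by positivity
        refine max_le ?_ ?_ <;> linarith
      have h4 : max |overlap σ x y - r| |cavityOverlap i (σ x) (σ y) - r| ^ s
          ≤ 2 ^ s * (1 + (S : ℝ) ^ 2) ^ s * (|overlap σ x y - r| ^ s + (1 / N) ^ s) := by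
        refine (pow_le_pow_left₀ ((abs_nonneg _).trans (le_max_left _ _)) h3 s).trans
          ((add_pow_le (by positivity) (by positivity) s).trans ?_)
        rw [mul_pow, mul_pow, ← mul_add, ← mul_assoc]
        have h5 : (2 : ℝ) ^ (s - 1) ≤ 2 ^ s := pow_le_pow_right₀ one_le_two (Nat.sub_le s 1)
        gcongr
      have h5 : |(sv (σ x i) * sv (σ y i) - r) * ((overlap σ x y - r) ^ (s + 1)
          - (cavityOverlap i (σ x) (σ y) - r) ^ (s + 1))|
          ≤ siteConst S s / N * (|overlap σ x y - r| ^ s + (1 / N) ^ s) := by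
        rw [abs_mul]
        calc _ ≤ 2 * (S : ℝ) ^ 2 * (S ^ 2 / N * ((s + 1 : ℕ) : ℝ) *
              (2 ^ s * (1 + (S : ℝ) ^ 2) ^ s * (|overlap σ x y - r| ^ s + (1 / N) ^ s))) := by
              refine mul_le_mul (hε σ) (h2.trans ?_) (abs_nonneg _) (by positivity)
              gcongr
          _ = _ := by
              unfold siteConst
              push_cast
              ring
      have h6 := (le_abs_self _).trans h5
      rw [mul_sub] at h6
      linarith
    refine (gaussAvg_mono _ _ hpt).trans ?_
    rw [gaussAvg_add, gaussAvg_const_mul, gaussAvg_add, gaussAvg_const]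
    refine add_le_add ?_ (mul_le_mul_of_nonneg_left (add_le_add hM le_rfl)
      (div_nonneg (siteConst_nonneg S s) hN0.le))
    -- the leading term
    have hzero : cavityAvg β h cr p q i 0 (fun σ : Fin 2 → Config N S =>
        (sv (σ x i) * sv (σ y i) - r) * (cavityOverlap i (σ x) (σ y) - r) ^ (s + 1)) = 0 := by
      have h1 := cavityAvg_zero_mul β h cr p q i (fun ε : Fin 2 → ℝ => ε x * ε y - r)
        (b := fun σ : Fin 2 → Config N S => (cavityOverlap i (σ x) (σ y) - r) ^ (s + 1))
        (fun σ => by simp only [cavityOverlap_update])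
      rw [h1, nu0_sub, hxy, nu0_const, sub_self, zero_mul]
    have hfirst := abs_cavityAvg_sub_le (h := h) (cr := cr) hβ hp hq i (B := 2 * (S : ℝ) ^ 2)
      (m := s + 1) (f := fun σ : Fin 2 → Config N S =>
        (sv (σ x i) * sv (σ y i) - r) * (cavityOverlap i (σ x) (σ y) - r) ^ (s + 1))
      (by positivity) (fun σ => by
        rw [abs_mul, abs_pow]
        exact mul_le_mul (hε σ) (pow_le_pow_left₀ (abs_nonneg _) (le_cavityError p q i σ x y) _)
          (by positivity) (by positivity))
      (Set.right_mem_Icc.2 (by positivity : (0 : ℝ) ≤ Real.pi / 2))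
    rw [cavityAvg_end, hzero, sub_zero] at hfirst
    refine (le_abs_self _).trans (hfirst.trans_eq ?_)
    unfold concConst
    push_cast
    ring
  simp_rw [hsum]
  unfold fullAvg at hsite ⊢
  rw [gaussAvg_const_mul, gaussAvg_sum]
  refine (mul_le_mul_of_nonneg_left (Finset.sum_le_sum fun i _ => hsite i)
    (by positivity)).trans_eq ?_
  simp only [Finset.sum_const, Finset.card_univ, Fintype.card_fin, nsmul_eq_mul]
  rw [← mul_assoc, one_div_mul_cancel hN0.ne', one_mul]

lemma IsReplicaSymmetric.nu0_mul (hrs : IsReplicaSymmetric S β h cr p q) (x y : Fin n) :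
    nu0 S β h cr p q (fun ε : Fin n → ℝ => ε x * ε y) = target p q x y := by
  unfold target
  split_ifs with hxy
  · subst hxy
    have h1 := nu0_comp (S := S) (β := β) (h := h) (cr := cr) (p := p) (q := q)
      (φ := fun _ : Fin 1 => x) (fun a b _ => Subsingleton.elim a b) (fun ε => ε 0 ^ 2)
    rw [← hrs.1] at h1
    simpa only [Function.comp, pow_two] using h1
  · have hinj : Function.Injective ![x, y] := by
      intro a b hab
      fin_cases a <;> fin_cases b <;> simp_all
    have h1 := nu0_comp (S := S) (β := β) (h := h) (cr := cr) (p := p) (q := q) hinj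
      (fun ε => ε 0 * ε 1)
    rw [← hrs.2] at h1
    simpa only [Function.comp, Matrix.cons_val_zero, Matrix.cons_val_one] using h1

lemma overlapMoment_add_two_le (hN : 1 ≤ N) (hβ : β ^ 2 ≤ 1)
    (hrs : IsReplicaSymmetric S β h cr p q) {s : ℕ} (hs : Even s)
    (hc : 4 * (β ^ 2 * concConst S s) ≤ 1) :
    overlapMoment N S β h cr p q (s + 2) ≤ (1 / N) ^ (s + 2)
      + 4 * siteConst S s / N * (overlapMoment N S β h cr p q s + (1 / N) ^ s) := by
  obtain ⟨hp0, hp1, hq0, hq1⟩ := hrs.bounds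
  have h1 := fullAvg_pow_le (h := h) (cr := cr) hN hβ ⟨hp0, hp1⟩ ⟨hq0, hq1⟩ hs 0 1
    (hrs.nu0_mul 0 1) (le_add_of_nonneg_right (gaussAvg_nonneg _ _ fun _ => by positivity))
  have h2 := fullAvg_pow_le (h := h) (cr := cr) hN hβ ⟨hp0, hp1⟩ ⟨hq0, hq1⟩ hs 0 0
    (hrs.nu0_mul 0 0) (le_add_of_nonneg_left (gaussAvg_nonneg _ _ fun _ => by positivity))
  have h3 : overlapMoment N S β h cr p q (s + 2)
      ≤ 2 * (β ^ 2 * concConst S s * (overlapMoment N S β h cr p q (s + 2) + (1 / N) ^ (s + 2))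
        + siteConst S s / N * (overlapMoment N S β h cr p q s + (1 / N) ^ s)) := by
    rw [two_mul]
    exact add_le_add h1 h2
  have hM := overlapMoment_nonneg (N := N) (S := S) β h cr p q (s + 2)
  have h4 : β ^ 2 * concConst S s * (overlapMoment N S β h cr p q (s + 2) + (1 / N) ^ (s + 2))
      ≤ 1 / 4 * (overlapMoment N S β h cr p q (s + 2) + (1 / N) ^ (s + 2)) :=
    mul_le_mul_of_nonneg_right (by linarith) (by positivity)
  have h5 : 4 * siteConst S s / N * (overlapMoment N S β h cr p q s + (1 / N) ^ s)
      = 4 * (siteConst S s / N * (overlapMoment N S β h cr p q s + (1 / N) ^ s)) := by ring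
  rw [h5]
  linarith

lemma overlapMoment_zero (β h cr p q : ℝ) : overlapMoment N S β h cr p q 0 = 2 := by
  simp only [overlapMoment, pow_zero, fullAvg, gaussAvg_const]
  norm_num

/-- The overlaps concentrate: their moments of order `m ≤ 4` are of order `N ^ (-m / 2)`. The bound
is written in terms of `ε = 1 / √N`. -/
theorem exists_overlapMoment_le (S : ℕ) : ∃ K : ℝ, 0 ≤ K ∧ ∀ (N : ℕ) (β h cr p q : ℝ), 1 ≤ N →
    β ^ 2 ≤ 1 → 4 * (β ^ 2 * concConst S 0) ≤ 1 → 4 * (β ^ 2 * concConst S 2) ≤ 1 →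
    IsReplicaSymmetric S β h cr p q → ∀ m ∈ Finset.Icc 1 4,
      overlapMoment N S β h cr p q m ≤ K * (1 / √(N : ℝ)) ^ m := by
  have hk0 := siteConst_nonneg S 0
  have hk2 := siteConst_nonneg S 2
  refine ⟨2 + (1 + 12 * siteConst S 0)
    + (1 + 4 * siteConst S 2 * (2 + 12 * siteConst S 0)), by positivity, ?_⟩
  intro N β h cr p q hN hβ hc0 hc2 hrs m hm
  have hN0 : (0 : ℝ) < N := by exact_mod_cast hN
  set K2 := 1 + 12 * siteConst S 0 with hK2
  set K4 := 1 + 4 * siteConst S 2 * (2 + 12 * siteConst S 0) with hK4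
  have hK2' : 0 ≤ K2 := by positivity
  have hK4' : 0 ≤ K4 := by positivity
  set ε := 1 / √(N : ℝ) with hε
  have hε0 : 0 < ε := by positivity
  have hε2 : 1 / (N : ℝ) = ε ^ 2 := by
    rw [hε, div_pow, Real.sq_sqrt hN0.le, one_pow]
  have hε1 : ε ≤ 1 := by
    rw [hε, div_le_one (by positivity)]
    exact Real.one_le_sqrt.2 (by exact_mod_cast hN)
  have hdiv : ∀ c : ℝ, c / N = c * ε ^ 2 := fun c => by rw [← hε2, mul_one_div]
  have hε21 : ε ^ 2 ≤ 1 := pow_le_one₀ hε0.le hε1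
  have hM2 : overlapMoment N S β h cr p q 2 ≤ K2 * ε ^ 2 := by
    have h1 := overlapMoment_add_two_le hN hβ hrs (s := 0) (by simp) hc0
    rw [overlapMoment_zero, hε2, hdiv] at h1
    simp only [pow_zero, zero_add] at h1
    have h2 : (ε ^ 2) ^ 2 ≤ ε ^ 2 := by
      rw [pow_two (ε ^ 2)]
      exact mul_le_of_le_one_left (by positivity) hε21
    rw [hK2]
    nlinarith
  have hM4 : overlapMoment N S β h cr p q 4 ≤ K4 * ε ^ 4 := by
    have h1 := overlapMoment_add_two_le hN hβ hrs (s := 2) (by simp) hc2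
    rw [hε2, hdiv] at h1
    have h2 : (ε ^ 2) ^ 2 ≤ ε ^ 2 := by
      rw [pow_two (ε ^ 2)]
      exact mul_le_of_le_one_left (by positivity) hε21
    have h3 : (ε ^ 2) ^ 4 ≤ ε ^ 4 := by
      rw [← pow_mul]
      exact pow_le_pow_of_le_one hε0.le hε1 (by norm_num)
    calc _ ≤ ε ^ 4 + 4 * siteConst S 2 * ε ^ 2 * (K2 * ε ^ 2 + ε ^ 2) := by
          refine h1.trans (add_le_add h3 ?_)
          gcongr
      _ = _ := by rw [hK4, hK2]; ring
  -- odd moments are interpolated between even ones, pointwise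
  have hodd : ∀ (m : ℕ) (L : ℝ), (∀ x : ℝ, |x| ^ m ≤ L * |x| ^ (m - 1) + 1 / L * |x| ^ (m + 1)) →
      overlapMoment N S β h cr p q m ≤ L * overlapMoment N S β h cr p q (m - 1)
        + 1 / L * overlapMoment N S β h cr p q (m + 1) := by
    intro m L hx
    have h1 := gaussAvg_mono (n := 2) (fullCoupling (N := N) (S := S) β) (fullField h cr)
      fun σ => hx (overlap σ 0 1 - q)
    have h2 := gaussAvg_mono (n := 2) (fullCoupling (N := N) (S := S) β) (fullField h cr)
      fun σ => hx (overlap σ 0 0 - p)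
    rw [gaussAvg_add, gaussAvg_const_mul, gaussAvg_const_mul] at h1 h2
    unfold overlapMoment fullAvg
    linarith
  have hpt : ∀ (k : ℕ) (x : ℝ), |x| ^ (k + 1) ≤ ε * |x| ^ k + 1 / ε * |x| ^ (k + 1 + 1) := by
    intro k x
    have h1 : |x| ≤ ε + 1 / ε * |x| ^ 2 := by
      have h2 : 0 ≤ 1 / ε * (ε - |x|) ^ 2 := by positivity
      have h3 : 1 / ε * (ε - |x|) ^ 2 = ε - 2 * |x| + 1 / ε * |x| ^ 2 := by
        field_simp
        ring
      have := abs_nonneg x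
      linarith
    calc |x| ^ (k + 1) = |x| ^ k * |x| := pow_succ _ _
      _ ≤ |x| ^ k * (ε + 1 / ε * |x| ^ 2) := by gcongr
      _ = _ := by ring
  have hM1 : overlapMoment N S β h cr p q 1 ≤ (2 + K2) * ε := by
    refine (hodd 1 ε (hpt 0)).trans ?_
    simp only [Nat.sub_self, overlapMoment_zero]
    calc _ ≤ ε * 2 + 1 / ε * (K2 * ε ^ 2) := by gcongr
      _ = _ := by field_simp
  have hM3 : overlapMoment N S β h cr p q 3 ≤ (K2 + K4) * ε ^ 3 := by
    refine (hodd 3 ε (hpt 2)).trans ?_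
    calc _ ≤ ε * (K2 * ε ^ 2) + 1 / ε * (K4 * ε ^ 4) := by gcongr
      _ = _ := by field_simp
  have hm' := Finset.mem_Icc.1 hm
  obtain rfl | rfl | rfl | rfl : m = 1 ∨ m = 2 ∨ m = 3 ∨ m = 4 := by omega
  · refine hM1.trans ?_
    rw [pow_one]
    exact mul_le_mul_of_nonneg_right (by linarith) (by positivity)
  · exact hM2.trans (mul_le_mul_of_nonneg_right (by linarith) (by positivity))
  · exact hM3.trans (mul_le_mul_of_nonneg_right (by linarith) (by positivity))
  · exact hM4.trans (mul_le_mul_of_nonneg_right (by linarith) (by positivity))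

end Expansion

/-! ### Covariances of the overlaps by the cavity method -/

section Covariance

variable {S : ℕ} {n : ℕ} {β h cr p q : ℝ}

/-- The covariance-type average of two overlaps, centered at their targets. -/
def overlapCov (N S : ℕ) (β h cr p q : ℝ) {n : ℕ} (x y k l : Fin n) : ℝ :=
  fullAvg (N := N) (S := S) β h cr (fun σ : Fin n → Config N S =>
    (overlap σ x y - target p q x y) * (overlap σ k l - target p q k l))

lemma exists_spin_bound (a : (Fin n → ℝ) → ℝ) :
    ∃ A, 0 ≤ A ∧ ∀ ε : Fin n → Spin S, |a fun k => sv (ε k)| ≤ A :=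
  exists_abs_bound fun ε : Fin n → Spin S => a fun k => sv (ε k)

/-- The average of the cavity derivative of a product at the decoupled end: every term is a
product of a single-spin average and an average of overlaps. -/
lemma cavityAvg_zero_cavityDeriv {N : ℕ} (β h cr p q : ℝ) (i : Fin N) (a : (Fin n → ℝ) → ℝ)
    (x y : Fin n) :
    cavityAvg β h cr p q i 0 (cavityDeriv p q i fun σ : Fin n → Config N S =>
        a (fun k => sv (σ k i)) * (cavityOverlap i (σ x) (σ y) - target p q x y))
      = ∑ k : Fin (n + 1), ∑ l : Fin (n + 2), replicaCoeff n k * replicaCoeff (n + 1) l *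
        (nu0 S β h cr p q (fun ε : Fin (n + 2) → ℝ =>
            a (fun j => ε j.castSucc.castSucc) * (ε k.castSucc * ε l)) *
          cavityAvg β h cr p q i 0 (fun σ : Fin (n + 2) → Config N S =>
            (cavityOverlap i (σ x.castSucc.castSucc) (σ y.castSucc.castSucc) - target p q x y) *
            (cavityOverlap i (σ k.castSucc) (σ l) - target p q k.castSucc l))) := by
  have h1 : ∀ (k : Fin (n + 1)) (l : Fin (n + 2)),
      nu0 S β h cr p q (fun ε : Fin (n + 2) → ℝ =>
          a (fun j => ε j.castSucc.castSucc) * (ε k.castSucc * ε l)) *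
        cavityAvg β h cr p q i 0 (fun σ : Fin (n + 2) → Config N S =>
          (cavityOverlap i (σ x.castSucc.castSucc) (σ y.castSucc.castSucc) - target p q x y) *
          (cavityOverlap i (σ k.castSucc) (σ l) - target p q k.castSucc l))
      = cavityAvg β h cr p q i 0 (fun σ : Fin (n + 2) → Config N S =>
          a (fun j => sv (σ j.castSucc.castSucc i)) * (sv (σ k.castSucc i) * sv (σ l i)) *
          ((cavityOverlap i (σ x.castSucc.castSucc) (σ y.castSucc.castSucc) - target p q x y) *
          (cavityOverlap i (σ k.castSucc) (σ l) - target p q k.castSucc l))) := by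
    intro k l
    rw [← cavityAvg_zero_mul β h cr p q i (fun ε : Fin (n + 2) → ℝ =>
          a (fun j => ε j.castSucc.castSucc) * (ε k.castSucc * ε l))
        (fun σ => by simp only [cavityOverlap_update])]
  simp_rw [h1]
  unfold cavityAvg
  simp_rw [← gaussAvg_const_mul, ← gaussAvg_sum]
  congr 1
  funext τ
  simp only [cavityDeriv, Finset.mul_sum]
  exact Finset.sum_congr rfl fun k _ => Finset.sum_congr rfl fun l _ => by ring

/-- Removing a site from two overlaps changes their covariance by less than the order kept. -/
lemma abs_overlap_mul_sub_le {N : ℕ} (i : Fin N) (σ : Fin n → Config N S) (x y k l : Fin n) :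
    |(overlap σ x y - target p q x y) * (overlap σ k l - target p q k l)
        - (cavityOverlap i (σ x) (σ y) - target p q x y) *
          (cavityOverlap i (σ k) (σ l) - target p q k l)|
      ≤ S ^ 2 / N * (2 * cavityError p q i σ ^ 1 + S ^ 2 / N) := by
  have h1 := abs_overlap_sub_cavityOverlap_le i σ x y
  have h2 := abs_overlap_sub_cavityOverlap_le i σ k l
  have h3 := le_cavityError p q i σ x y
  have h4 := le_cavityError p q i σ k l
  have e : (overlap σ x y - target p q x y) * (overlap σ k l - target p q k l)
        - (cavityOverlap i (σ x) (σ y) - target p q x y) *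
          (cavityOverlap i (σ k) (σ l) - target p q k l)
      = (overlap σ x y - cavityOverlap i (σ x) (σ y)) *
          (overlap σ k l - cavityOverlap i (σ k) (σ l))
        + (overlap σ x y - cavityOverlap i (σ x) (σ y)) *
          (cavityOverlap i (σ k) (σ l) - target p q k l)
        + (overlap σ k l - cavityOverlap i (σ k) (σ l)) *
          (cavityOverlap i (σ x) (σ y) - target p q x y) := by ring
  rw [e, pow_one]
  refine (abs_add_three _ _ _).trans ?_
  rw [abs_mul, abs_mul, abs_mul]
  have hd : (0 : ℝ) ≤ S ^ 2 / N := by positivity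
  have t1 := mul_le_mul h1 h2 (abs_nonneg _) hd
  have t2 := mul_le_mul h1 h4 (abs_nonneg _) hd
  have t3 := mul_le_mul h2 h3 (abs_nonneg _) hd
  linarith

/-- The expansion of an average with one decoupled site, up to order `N ^ (-3 / 2)`. -/
theorem exists_cavity_expansion (hβ : β ^ 2 ≤ 1) (hp : p ∈ Set.Icc (0 : ℝ) (S ^ 2))
    (hq : q ∈ Set.Icc (0 : ℝ) (S ^ 2)) {K : ℝ} (hK0 : 0 ≤ K)
    (hK : ∀ N : ℕ, 1 ≤ N → ∀ m ∈ Finset.Icc 1 4,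
      overlapMoment N S β h cr p q m ≤ K * (1 / √(N : ℝ)) ^ m)
    (a : (Fin n → ℝ) → ℝ) (ha : nu0 S β h cr p q a = 0) (x y : Fin n) :
    ∃ C : ℝ, ∀ (N : ℕ) (i : Fin N),
      |fullAvg β h cr (fun σ : Fin n → Config N S =>
            a (fun k => sv (σ k i)) * (overlap σ x y - target p q x y))
          - (1 / N * nu0 S β h cr p q (fun ε : Fin n → ℝ => a ε * (ε x * ε y))
            + β ^ 2 / 2 * ∑ k : Fin (n + 1), ∑ l : Fin (n + 2),
              replicaCoeff n k * replicaCoeff (n + 1) l *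
              (nu0 S β h cr p q (fun ε : Fin (n + 2) → ℝ =>
                  a (fun j => ε j.castSucc.castSucc) * (ε k.castSucc * ε l)) *
                overlapCov N S β h cr p q x.castSucc.castSucc y.castSucc.castSucc
                  k.castSucc l))|
        ≤ C * (1 / √(N : ℝ)) ^ 3 := by
  obtain ⟨A, hA0, hA⟩ := exists_spin_bound (S := S) a
  -- the constants of the four approximations
  obtain ⟨C1, hC1⟩ : ∃ C1 : ℝ, C1 = 2 * (β ^ 2 * (A * S ^ 2 * ((n + 1) * (n + 2) * S ^ 2) *
      (momentConst S (n + 2) 0 * (K + 1)))) := ⟨_, rfl⟩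
  obtain ⟨C2, hC2⟩ : ∃ C2 : ℝ, C2 = 2 * (β ^ 2 * (2 * (β ^ 2 * (A * ((n + 1) * (n + 2) * S ^ 2) *
        (((n + 2 : ℕ) + 1) * ((n + 2 : ℕ) + 2) * S ^ 2) *
        (momentConst S (n + 2 + 2) (1 + 1) * (K + 1)))))) := ⟨_, rfl⟩
  obtain ⟨C3, hC3⟩ : ∃ C3 : ℝ, C3 = 2 * (β ^ 2 * (1 *
      (((n + 2 : ℕ) + 1) * ((n + 2 : ℕ) + 2) * S ^ 2) *
      (momentConst S (n + 2 + 2) 2 * (K + 1)))) := ⟨_, rfl⟩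
  obtain ⟨C4, hC4⟩ : ∃ C4 : ℝ, C4 = S ^ 2 * (2 * (momentConst S (n + 2) 0 * (K + 1)) + S ^ 2) :=
    ⟨_, rfl⟩
  have hC3' : 0 ≤ C3 := by
    have := momentConst_nonneg S (n + 2 + 2) 2
    rw [hC3]; positivity
  have hC4' : 0 ≤ C4 := by
    have := momentConst_nonneg S (n + 2) 0
    rw [hC4]; positivity
  refine ⟨C1 + C2 + β ^ 2 / 2 * (4 * n * (n + 1) * ((A * S ^ 2) * (C3 + C4))), fun N i => ?_⟩
  have hN : 1 ≤ N := i.pos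
  have hN0 : (0 : ℝ) < N := by exact_mod_cast hN
  set ε := 1 / √(N : ℝ) with hε
  have hε0 : 0 < ε := by positivity
  have hε2 : 1 / (N : ℝ) = ε ^ 2 := by
    rw [hε, div_pow, Real.sq_sqrt hN0.le, one_pow]
  have hε1 : ε ≤ 1 := by
    rw [hε, div_le_one (by positivity)]
    exact Real.one_le_sqrt.2 (by exact_mod_cast hN)
  have hdiv : ∀ c : ℝ, c / N = c * ε ^ 2 := fun c => by rw [← hε2, mul_one_div]
  have hmom : ∀ m ∈ Finset.Icc 1 4,
      overlapMoment N S β h cr p q m + (1 / N) ^ m ≤ (K + 1) * ε ^ m := by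
    intro m hm
    have h1 := hK N hN m hm
    have h2 : (1 / (N : ℝ)) ^ m ≤ ε ^ m := by
      rw [hε2]
      exact pow_le_pow_left₀ (by positivity) (pow_le_of_le_one hε0.le hε1 two_ne_zero) m
    linarith
  have hend : Real.pi / 2 ∈ Set.Icc 0 (Real.pi / 2) := Set.right_mem_Icc.2 (by positivity)
  -- the contribution of the site `i` to the overlap
  have s1 : |fullAvg β h cr (fun σ : Fin n → Config N S =>
      a (fun k => sv (σ k i)) * (sv (σ x i) * sv (σ y i)))
      - nu0 S β h cr p q (fun ε : Fin n → ℝ => a ε * (ε x * ε y))| ≤ C1 * ε := by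
    have h1 := abs_cavityAvg_sub_le (h := h) (cr := cr) hβ hp hq i (m := 0) (B := A * S ^ 2)
      (f := fun σ : Fin n → Config N S => a (fun k => sv (σ k i)) * (sv (σ x i) * sv (σ y i)))
      (by positivity) (fun σ => by
        rw [abs_mul, pow_zero, mul_one]
        exact mul_le_mul (hA _) (abs_sv_mul_sv_le _ _) (abs_nonneg _) hA0) hend
    have h2 := cavityAvg_zero_mul (S := S) β h cr p q i (fun ε : Fin n → ℝ => a ε * (ε x * ε y))
      (b := fun _ => 1) (fun _ => rfl)
    simp only [mul_one] at h2
    rw [cavityAvg_end, h2, show cavityAvg β h cr p q i 0 (fun _ : Fin n → Config N S => (1 : ℝ)) = 1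
      from gaussAvg_const _ _ 1, mul_one] at h1
    refine h1.trans ?_
    have h3 := hmom 1 (by simp)
    simp only [pow_one, zero_add] at h3 ⊢
    have h4 := momentConst_nonneg S (n + 2) 0
    calc _ ≤ 2 * (β ^ 2 * (A * S ^ 2 * ((n + 1) * (n + 2) * S ^ 2) *
          (momentConst S (n + 2) 0 * ((K + 1) * ε)))) := by gcongr
      _ = _ := by rw [hC1]; ring
  -- the contribution of the other sites
  have s2 : |fullAvg β h cr (fun σ : Fin n → Config N S =>
      a (fun k => sv (σ k i)) * (cavityOverlap i (σ x) (σ y) - target p q x y))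
      - β ^ 2 / 2 * cavityAvg β h cr p q i 0 (cavityDeriv p q i fun σ : Fin n → Config N S =>
        a (fun k => sv (σ k i)) * (cavityOverlap i (σ x) (σ y) - target p q x y))|
      ≤ C2 * ε ^ 3 := by
    have h1 := abs_cavityAvg_sub_sub_le (h := h) (cr := cr) hβ hp hq i (m := 1) (B := A)
      (f := fun σ : Fin n → Config N S =>
        a (fun k => sv (σ k i)) * (cavityOverlap i (σ x) (σ y) - target p q x y))
      hA0 (fun σ => by
        rw [abs_mul, pow_one]
        exact mul_le_mul (hA _) (le_cavityError _ _ _ _ _ _) (abs_nonneg _) hA0)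
    rw [cavityAvg_zero_mul (S := S) β h cr p q i a
      (b := fun σ : Fin n → Config N S => cavityOverlap i (σ x) (σ y) - target p q x y)
      (fun σ => by simp only [cavityOverlap_update]), ha, zero_mul, sub_zero] at h1
    refine h1.trans ?_
    have h3 := hmom 3 (by simp)
    have h4 := momentConst_nonneg S (n + 2 + 2) (1 + 1)
    calc _ ≤ 2 * (β ^ 2 * (2 * (β ^ 2 * (A * ((n + 1) * (n + 2) * S ^ 2) *
        (((n + 2 : ℕ) + 1) * ((n + 2 : ℕ) + 2) * S ^ 2) *
        (momentConst S (n + 2 + 2) (1 + 1) * ((K + 1) * ε ^ 3)))))) := by gcongr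
      _ = _ := by rw [hC2]; ring
  -- the covariances at the decoupled end
  have s3 : ∀ (k : Fin (n + 1)) (l : Fin (n + 2)),
      |cavityAvg β h cr p q i 0 (fun σ : Fin (n + 2) → Config N S =>
          (cavityOverlap i (σ x.castSucc.castSucc) (σ y.castSucc.castSucc) - target p q x y) *
          (cavityOverlap i (σ k.castSucc) (σ l) - target p q k.castSucc l))
        - overlapCov N S β h cr p q x.castSucc.castSucc y.castSucc.castSucc k.castSucc l|
      ≤ (C3 + C4) * ε ^ 3 := by
    intro k l
    have htar : target p q x y = target p q x.castSucc.castSucc y.castSucc.castSucc := by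
      rw [target_castSucc, target_castSucc]
    rw [htar]
    have h1 := abs_cavityAvg_sub_le (h := h) (cr := cr) hβ hp hq i (m := 2) (B := 1)
      (f := fun σ : Fin (n + 2) → Config N S =>
          (cavityOverlap i (σ x.castSucc.castSucc) (σ y.castSucc.castSucc)
            - target p q x.castSucc.castSucc y.castSucc.castSucc) *
          (cavityOverlap i (σ k.castSucc) (σ l) - target p q k.castSucc l))
      zero_le_one (fun σ => by
        rw [abs_mul, one_mul, pow_two]
        exact mul_le_mul (le_cavityError _ _ _ _ _ _) (le_cavityError _ _ _ _ _ _) (abs_nonneg _)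
          (cavityError_nonneg _ _ _ _)) hend
    rw [cavityAvg_end, abs_sub_comm] at h1
    have h2 : |fullAvg β h cr (fun σ : Fin (n + 2) → Config N S =>
          (cavityOverlap i (σ x.castSucc.castSucc) (σ y.castSucc.castSucc)
            - target p q x.castSucc.castSucc y.castSucc.castSucc) *
          (cavityOverlap i (σ k.castSucc) (σ l) - target p q k.castSucc l))
        - overlapCov N S β h cr p q x.castSucc.castSucc y.castSucc.castSucc k.castSucc l|
        ≤ C4 * ε ^ 3 := by
      rw [abs_sub_comm, overlapCov]
      unfold fullAvg
      rw [← gaussAvg_sub]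
      refine (abs_gaussAvg_le _ _ _).trans ((gaussAvg_mono _ _ fun σ =>
        abs_overlap_mul_sub_le i σ _ _ _ _).trans ?_)
      rw [gaussAvg_const_mul, gaussAvg_add, gaussAvg_const_mul, gaussAvg_const]
      have h3 := cavityAvg_cavityError_le (n := n + 2) (h := h) (cr := cr) hβ hp hq i hend 0
      rw [cavityAvg_end] at h3
      have h4 := hmom 1 (by simp)
      have h5 := momentConst_nonneg S (n + 2) 0
      simp only [zero_add] at h3
      have h6 : fullAvg β h cr (fun σ : Fin (n + 2) → Config N S => cavityError p q i σ ^ 1)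
          ≤ momentConst S (n + 2) 0 * ((K + 1) * ε ^ 1) :=
        h3.trans (mul_le_mul_of_nonneg_left h4 h5)
      unfold fullAvg at h6
      rw [hdiv]
      have h7 : (S : ℝ) ^ 2 * ε ^ 2 ≤ S ^ 2 * ε :=
        mul_le_mul_of_nonneg_left (pow_le_of_le_one hε0.le hε1 two_ne_zero) (by positivity)
      calc _ ≤ S ^ 2 * ε ^ 2 * (2 * (momentConst S (n + 2) 0 * ((K + 1) * ε ^ 1))
            + S ^ 2 * ε) := by gcongr
        _ = _ := by rw [hC4]; ring
    have h3 := hmom 3 (by simp)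
    have h4 := momentConst_nonneg S (n + 2 + 2) 2
    have h5 : 2 * (β ^ 2 * (1 * (((n + 2 : ℕ) + 1) * ((n + 2 : ℕ) + 2) * S ^ 2)
        * (momentConst S (n + 2 + 2) 2 *
          (overlapMoment N S β h cr p q (2 + 1) + (1 / N) ^ (2 + 1))))) ≤ C3 * ε ^ 3 := by
      calc _ ≤ 2 * (β ^ 2 * (1 * (((n + 2 : ℕ) + 1) * ((n + 2 : ℕ) + 2) * S ^ 2)
            * (momentConst S (n + 2 + 2) 2 * ((K + 1) * ε ^ 3)))) := by gcongr
        _ = _ := by rw [hC3]; ring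
    refine (abs_sub_le _ _ _).trans ((add_le_add (h1.trans h5) h2).trans_eq ?_)
    ring
  -- collecting the terms
  have hsplit : fullAvg β h cr (fun σ : Fin n → Config N S =>
      a (fun k => sv (σ k i)) * (overlap σ x y - target p q x y))
      = fullAvg β h cr (fun σ : Fin n → Config N S =>
          a (fun k => sv (σ k i)) * (cavityOverlap i (σ x) (σ y) - target p q x y))
        + 1 / N * fullAvg β h cr (fun σ : Fin n → Config N S =>
          a (fun k => sv (σ k i)) * (sv (σ x i) * sv (σ y i))) := by
    unfold fullAvg
    rw [← gaussAvg_const_mul, ← gaussAvg_add]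
    congr 1
    funext σ
    rw [overlap_eq i]
    ring
  rw [cavityAvg_zero_cavityDeriv] at s2
  have s4 : |(∑ k : Fin (n + 1), ∑ l : Fin (n + 2), replicaCoeff n k * replicaCoeff (n + 1) l *
        (nu0 S β h cr p q (fun ε : Fin (n + 2) → ℝ =>
            a (fun j => ε j.castSucc.castSucc) * (ε k.castSucc * ε l)) *
          cavityAvg β h cr p q i 0 (fun σ : Fin (n + 2) → Config N S =>
            (cavityOverlap i (σ x.castSucc.castSucc) (σ y.castSucc.castSucc) - target p q x y) *
            (cavityOverlap i (σ k.castSucc) (σ l) - target p q k.castSucc l))))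
      - ∑ k : Fin (n + 1), ∑ l : Fin (n + 2), replicaCoeff n k * replicaCoeff (n + 1) l *
        (nu0 S β h cr p q (fun ε : Fin (n + 2) → ℝ =>
            a (fun j => ε j.castSucc.castSucc) * (ε k.castSucc * ε l)) *
          overlapCov N S β h cr p q x.castSucc.castSucc y.castSucc.castSucc k.castSucc l)|
      ≤ 4 * n * (n + 1) * ((A * S ^ 2) * ((C3 + C4) * ε ^ 3)) := by
    simp_rw [← Finset.sum_sub_distrib, ← mul_sub]
    refine abs_sum_replicaCoeff_le fun k l => ?_
    rw [abs_mul]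
    refine mul_le_mul (abs_nu0_le fun ε => ?_) (s3 k l) (abs_nonneg _) (by positivity)
    rw [abs_mul]
    exact mul_le_mul (hA fun j => ε j.castSucc.castSucc) (abs_sv_mul_sv_le _ _) (abs_nonneg _) hA0
  rw [hsplit, hε2]
  set X1 := fullAvg β h cr (fun σ : Fin n → Config N S =>
    a (fun k => sv (σ k i)) * (sv (σ x i) * sv (σ y i)))
  set X2 := fullAvg β h cr (fun σ : Fin n → Config N S =>
    a (fun k => sv (σ k i)) * (cavityOverlap i (σ x) (σ y) - target p q x y))
  set Y1 := nu0 S β h cr p q (fun ε : Fin n → ℝ => a ε * (ε x * ε y))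
  generalize (∑ k : Fin (n + 1), ∑ l : Fin (n + 2), replicaCoeff n k * replicaCoeff (n + 1) l *
        (nu0 S β h cr p q (fun ε : Fin (n + 2) → ℝ =>
            a (fun j => ε j.castSucc.castSucc) * (ε k.castSucc * ε l)) *
          cavityAvg β h cr p q i 0 (fun σ : Fin (n + 2) → Config N S =>
            (cavityOverlap i (σ x.castSucc.castSucc) (σ y.castSucc.castSucc) - target p q x y) *
            (cavityOverlap i (σ k.castSucc) (σ l) - target p q k.castSucc l)))) = Y2 at s2 s4
  generalize (∑ k : Fin (n + 1), ∑ l : Fin (n + 2), replicaCoeff n k * replicaCoeff (n + 1) l *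
        (nu0 S β h cr p q (fun ε : Fin (n + 2) → ℝ =>
            a (fun j => ε j.castSucc.castSucc) * (ε k.castSucc * ε l)) *
          overlapCov N S β h cr p q x.castSucc.castSucc y.castSucc.castSucc k.castSucc l)) = Y3
    at s4 ⊢
  have e : X2 + ε ^ 2 * X1 - (ε ^ 2 * Y1 + β ^ 2 / 2 * Y3)
      = ε ^ 2 * (X1 - Y1) + (X2 - β ^ 2 / 2 * Y2) + β ^ 2 / 2 * (Y2 - Y3) := by ring
  rw [e]
  refine (abs_add_three _ _ _).trans ?_
  rw [abs_mul, abs_mul, abs_of_nonneg (by positivity : 0 ≤ ε ^ 2),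
    abs_of_nonneg (by positivity : 0 ≤ β ^ 2 / 2)]
  have t1 := mul_le_mul_of_nonneg_left s1 (by positivity : 0 ≤ ε ^ 2)
  have t2 := mul_le_mul_of_nonneg_left s4 (by positivity : 0 ≤ β ^ 2 / 2)
  calc _ ≤ ε ^ 2 * (C1 * ε) + C2 * ε ^ 3
        + β ^ 2 / 2 * (4 * n * (n + 1) * ((A * S ^ 2) * ((C3 + C4) * ε ^ 3))) := by linarith
    _ = _ := by ring

/-- The expansion averaged over the sites. -/
theorem exists_cavity_expansion_sum (hβ : β ^ 2 ≤ 1) (hp : p ∈ Set.Icc (0 : ℝ) (S ^ 2))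
    (hq : q ∈ Set.Icc (0 : ℝ) (S ^ 2)) {K : ℝ} (hK0 : 0 ≤ K)
    (hK : ∀ N : ℕ, 1 ≤ N → ∀ m ∈ Finset.Icc 1 4,
      overlapMoment N S β h cr p q m ≤ K * (1 / √(N : ℝ)) ^ m)
    (a : (Fin n → ℝ) → ℝ) (ha : nu0 S β h cr p q a = 0) (x y : Fin n) :
    ∃ C : ℝ, ∀ N : ℕ, 1 ≤ N →
      |fullAvg β h cr (fun σ : Fin n → Config N S =>
            (1 / (N : ℝ) * ∑ i, a (fun k => sv (σ k i))) * (overlap σ x y - target p q x y))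
          - (1 / N * nu0 S β h cr p q (fun ε : Fin n → ℝ => a ε * (ε x * ε y))
            + β ^ 2 / 2 * ∑ k : Fin (n + 1), ∑ l : Fin (n + 2),
              replicaCoeff n k * replicaCoeff (n + 1) l *
              (nu0 S β h cr p q (fun ε : Fin (n + 2) → ℝ =>
                  a (fun j => ε j.castSucc.castSucc) * (ε k.castSucc * ε l)) *
                overlapCov N S β h cr p q x.castSucc.castSucc y.castSucc.castSucc
                  k.castSucc l))|
        ≤ C * (1 / √(N : ℝ)) ^ 3 := by
  obtain ⟨C, hC⟩ := exists_cavity_expansion hβ hp hq hK0 hK a ha x y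
  refine ⟨C, fun N hN => ?_⟩
  have hN0 : (0 : ℝ) < N := by exact_mod_cast hN
  have h1 : fullAvg β h cr (fun σ : Fin n → Config N S =>
      (1 / (N : ℝ) * ∑ i, a (fun k => sv (σ k i))) * (overlap σ x y - target p q x y))
      = 1 / N * ∑ i : Fin N, fullAvg β h cr (fun σ : Fin n → Config N S =>
        a (fun k => sv (σ k i)) * (overlap σ x y - target p q x y)) := by
    unfold fullAvg
    rw [← gaussAvg_sum, ← gaussAvg_const_mul]
    congr 1
    funext σ
    rw [mul_assoc, Finset.sum_mul]
  rw [h1]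
  have h2 : ∀ (Z : Fin N → ℝ) (Y : ℝ), 1 / (N : ℝ) * ∑ i, Z i - Y = 1 / N * ∑ i, (Z i - Y) := by
    intro Z Y
    rw [Finset.sum_sub_distrib, mul_sub]
    simp only [Finset.sum_const, Finset.card_univ, Fintype.card_fin, nsmul_eq_mul]
    rw [← mul_assoc, one_div_mul_cancel hN0.ne', one_mul]
  rw [h2, abs_mul, abs_of_nonneg (by positivity)]
  refine (mul_le_mul_of_nonneg_left ((Finset.abs_sum_le_sum_abs _ _).trans
    (Finset.sum_le_sum fun i _ => hC N i)) (by positivity : (0 : ℝ) ≤ 1 / N)).trans_eq ?_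
  simp only [Finset.sum_const, Finset.card_univ, Fintype.card_fin, nsmul_eq_mul]
  rw [← mul_assoc, one_div_mul_cancel hN0.ne', one_mul]

end Covariance

/-! ### Moments of the decoupled spin -/

section Moments

variable {S : ℕ} {n : ℕ} {β h cr p q : ℝ}

/-- The moments of the decoupled spin, given the Gaussian field. -/
def spinMoment (S : ℕ) (β h cr p q η : ℝ) (j : ℕ) : ℝ :=
  ∑ x : Spin S, sv x ^ j * gibbsWeight (lastHamiltonian S β h cr p q η) x

/-- The Gaussian average of a monomial in the first four moments of the decoupled spin. -/
def momentInt (S : ℕ) (β h cr p q : ℝ) (m : ℕ × ℕ × ℕ × ℕ) : ℝ :=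
  ∫ η, spinMoment S β h cr p q η 1 ^ m.1 * spinMoment S β h cr p q η 2 ^ m.2.1 *
    spinMoment S β h cr p q η 3 ^ m.2.2.1 * spinMoment S β h cr p q η 4 ^ m.2.2.2
    ∂gaussianReal 0 1

/-- How often the exponents `1`, `2`, `3`, `4` occur in a monomial. -/
def exponentCount (e : Fin n → ℕ) : ℕ × ℕ × ℕ × ℕ :=
  ((Finset.univ.filter fun k => e k = 1).card, (Finset.univ.filter fun k => e k = 2).card,
    (Finset.univ.filter fun k => e k = 3).card, (Finset.univ.filter fun k => e k = 4).card)

lemma spinMoment_zero (η : ℝ) : spinMoment S β h cr p q η 0 = 1 := by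
  simp only [spinMoment, pow_zero, one_mul]
  exact sum_gibbsWeight _

lemma nu0_monomial {e : Fin n → ℕ} (he : ∀ k, e k ≤ 4) :
    nu0 S β h cr p q (fun ε : Fin n → ℝ => ∏ k, ε k ^ e k)
      = momentInt S β h cr p q (exponentCount e) := by
  rw [nu0_eq, momentInt]
  congr 1
  funext η
  rw [replicaAvg_prod (lastHamiltonian S β h cr p q η) fun k x => sv x ^ e k]
  change ∏ k, spinMoment S β h cr p q η (e k) = _
  rw [← Finset.prod_fiberwise_of_maps_to' (t := Finset.range 5) (g := e)
    (fun k _ => Finset.mem_range.2 (Nat.lt_succ_of_le (he k)))]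
  simp_rw [Finset.prod_const]
  simp only [Finset.prod_range_succ, Finset.prod_range_zero, spinMoment_zero, one_pow, one_mul,
    exponentCount]

lemma prod_pow_add_mul (e : Fin n → ℕ) (k l : Fin n) (ε : Fin n → ℝ) :
    (∏ j, ε j ^ e j) * (ε k * ε l)
      = ∏ j, ε j ^ (e j + (if j = k then 1 else 0) + if j = l then 1 else 0) := by
  simp only [pow_add, Finset.prod_mul_distrib, pow_ite, pow_one, pow_zero, Finset.prod_ite_eq',
    Finset.mem_univ, if_true, mul_assoc]

lemma nu0_monomial_mul {e : Fin n → ℕ} (he : ∀ k, e k ≤ 2) (k l : Fin n) :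
    nu0 S β h cr p q (fun ε : Fin n → ℝ => (∏ j, ε j ^ e j) * (ε k * ε l))
      = momentInt S β h cr p q
        (exponentCount fun j => e j + (if j = k then 1 else 0) + if j = l then 1 else 0) := by
  simp_rw [prod_pow_add_mul]
  refine nu0_monomial fun j => ?_
  have := he j
  split_ifs <;> omega

lemma nu0_sub_monomial_mul {e e' : Fin n → ℕ} (he : ∀ k, e k ≤ 2) (he' : ∀ k, e' k ≤ 2)
    (k l : Fin n) :
    nu0 S β h cr p q (fun ε : Fin n → ℝ => (∏ j, ε j ^ e j - ∏ j, ε j ^ e' j) * (ε k * ε l))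
      = momentInt S β h cr p q
          (exponentCount fun j => e j + (if j = k then 1 else 0) + if j = l then 1 else 0)
        - momentInt S β h cr p q
          (exponentCount fun j => e' j + (if j = k then 1 else 0) + if j = l then 1 else 0) := by
  simp_rw [sub_mul]
  rw [nu0_sub, nu0_monomial_mul he, nu0_monomial_mul he']

lemma cD_eq : cD S β h cr p q
    = momentInt S β h cr p q (0, 0, 0, 1) - momentInt S β h cr p q (0, 2, 0, 0) := by
  have h1 := nu0_sub_monomial_mul (S := S) (β := β) (h := h) (cr := cr) (p := p) (q := q)
    (e := ![2, 0]) (e' := ![0, 2]) (by decide) (by decide) 0 0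
  simp only [Fin.prod_univ_two, Matrix.cons_val_zero, Matrix.cons_val_one, pow_zero, one_mul,
    mul_one] at h1
  simp only [cD, pow_two] at h1 ⊢
  exact h1

lemma cE_eq : cE S β h cr p q
    = momentInt S β h cr p q (1, 0, 1, 0) - momentInt S β h cr p q (2, 1, 0, 0) := by
  have h1 := nu0_sub_monomial_mul (S := S) (β := β) (h := h) (cr := cr) (p := p) (q := q)
    (e := ![2, 0, 0]) (e' := ![0, 2, 0]) (by decide) (by decide) 0 2
  simp only [Fin.prod_univ_three, Matrix.cons_val, pow_zero, one_mul, mul_one] at h1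
  exact h1

lemma cF_eq : cF S β h cr p q
    = momentInt S β h cr p q (0, 2, 0, 0) - momentInt S β h cr p q (2, 1, 0, 0) := by
  have h1 := nu0_sub_monomial_mul (S := S) (β := β) (h := h) (cr := cr) (p := p) (q := q)
    (e := ![1, 0, 1]) (e' := ![0, 1, 1]) (by decide) (by decide) 0 2
  simp only [Fin.prod_univ_three, Matrix.cons_val, pow_zero, pow_one, one_mul, mul_one] at h1
  exact h1

lemma cG_eq : cG S β h cr p q
    = momentInt S β h cr p q (2, 1, 0, 0) - momentInt S β h cr p q (4, 0, 0, 0) := by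
  have h1 := nu0_sub_monomial_mul (S := S) (β := β) (h := h) (cr := cr) (p := p) (q := q)
    (e := ![1, 0, 1, 0]) (e' := ![0, 1, 1, 0]) (by decide) (by decide) 0 3
  simp only [Fin.prod_univ_four, Matrix.cons_val, pow_zero, pow_one, one_mul, mul_one] at h1
  exact h1

/-- The averages `ν₀((ε₁² - ε₂²) εₖ εₗ)`, indexed by `k` and `l` (counted from `0`); see
`nu0_sq_sub_sq_mul`. -/
def sqTable (D E : ℝ) : Fin 6 → Fin 6 → ℝ :=
  ![![D, 0, E, E, E, E], ![0, -D, -E, -E, -E, -E], ![E, -E, 0, 0, 0, 0], ![E, -E, 0, 0, 0, 0],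
    ![E, -E, 0, 0, 0, 0], ![E, -E, 0, 0, 0, 0]]

/-- The averages `ν₀((ε₁ - ε₂) ε₃ εₖ εₗ)`, indexed by `k` and `l` (counted from `0`); see
`nu0_sub_mul_mul`. -/
def mulTable (E F G : ℝ) : Fin 6 → Fin 6 → ℝ :=
  ![![E, 0, F, G, G, G], ![0, -E, -F, -G, -G, -G], ![F, -F, 0, 0, 0, 0], ![G, -G, 0, 0, 0, 0],
    ![G, -G, 0, 0, 0, 0], ![G, -G, 0, 0, 0, 0]]

lemma nu0_sq_sub_sq_mul (k l : Fin 6) :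
    nu0 S β h cr p q (fun ε : Fin 6 → ℝ => (ε 0 ^ 2 - ε 1 ^ 2) * (ε k * ε l))
      = sqTable (cD S β h cr p q) (cE S β h cr p q) k l := by
  have h1 := nu0_sub_monomial_mul (S := S) (β := β) (h := h) (cr := cr) (p := p) (q := q)
    (e := ![2, 0, 0, 0, 0, 0]) (e' := ![0, 2, 0, 0, 0, 0]) (by decide) (by decide) k l
  simp only [Fin.prod_univ_six, Matrix.cons_val, pow_zero, one_mul, mul_one] at h1
  rw [h1, cD_eq, cE_eq]
  fin_cases k <;> fin_cases l <;>
    first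
    | exact sub_self _
    | rfl
    | exact (neg_sub _ _).symm

lemma nu0_sub_mul_mul (k l : Fin 6) :
    nu0 S β h cr p q (fun ε : Fin 6 → ℝ => ((ε 0 - ε 1) * ε 2) * (ε k * ε l))
      = mulTable (cE S β h cr p q) (cF S β h cr p q) (cG S β h cr p q) k l := by
  have h1 := nu0_sub_monomial_mul (S := S) (β := β) (h := h) (cr := cr) (p := p) (q := q)
    (e := ![1, 0, 1, 0, 0, 0]) (e' := ![0, 1, 1, 0, 0, 0]) (by decide) (by decide) k l
  simp only [Fin.prod_univ_six, Matrix.cons_val, pow_zero, pow_one, one_mul, mul_one] at h1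
  simp only [sub_mul (_ : ℝ) _ (_ : ℝ)] at h1 ⊢
  rw [h1, cE_eq, cF_eq, cG_eq]
  fin_cases k <;> fin_cases l <;>
    first
    | exact sub_self _
    | rfl
    | exact (neg_sub _ _).symm

end Moments

/-! ### The linear system for the covariances -/

section System

variable {N S : ℕ} {n m : ℕ} {β h cr p q : ℝ}

lemma overlapCov_comp {φ : Fin n → Fin m} (hφ : Function.Injective φ) (x y k l : Fin n) :
    overlapCov N S β h cr p q (φ x) (φ y) (φ k) (φ l) = overlapCov N S β h cr p q x y k l := by
  have ht : ∀ a b, target p q (φ a) (φ b) = target p q a b := fun a b => by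
    simp only [target, hφ.eq_iff]
  unfold overlapCov
  simp only [ht]
  exact gaussAvg_comp _ _ hφ (fun σ : Fin n → Config N S =>
    (overlap σ x y - target p q x y) * (overlap σ k l - target p q k l))

lemma overlapCov_swap (x y k l : Fin n) :
    overlapCov N S β h cr p q x y l k = overlapCov N S β h cr p q x y k l := by
  have h1 : ∀ σ : Fin n → Config N S, overlap σ l k = overlap σ k l := fun σ => by
    unfold overlap
    simp only [mul_comm]
  have h2 : target p q l k = target p q k l := by simp only [target, eq_comm]
  simp only [overlapCov, h1, h2]

lemma overlapCov_swap' (x y k l : Fin n) :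
    overlapCov N S β h cr p q y x k l = overlapCov N S β h cr p q x y k l := by
  have h1 : ∀ σ : Fin n → Config N S, overlap σ y x = overlap σ x y := fun σ => by
    unfold overlap
    simp only [mul_comm]
  have h2 : target p q y x = target p q x y := by simp only [target, eq_comm]
  simp only [overlapCov, h1, h2]

lemma overlapCov_comm (x y k l : Fin n) :
    overlapCov N S β h cr p q k l x y = overlapCov N S β h cr p q x y k l := by
  simp only [overlapCov, mul_comm]

/-- Variance of the self-overlap. As for the six quantities below, deviations are measured from the
targets `p` and `q` rather than from the means. -/
def covP (N S : ℕ) (β h cr p q : ℝ) : ℝ := overlapCov N S β h cr p q (0 : Fin 1) 0 0 0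

/-- Covariance of the self-overlaps of two replicas. -/
def covP' (N S : ℕ) (β h cr p q : ℝ) : ℝ := overlapCov N S β h cr p q (0 : Fin 2) 0 1 1

/-- Covariance of a self-overlap and an overlap which involves the same replica. -/
def covY (N S : ℕ) (β h cr p q : ℝ) : ℝ := overlapCov N S β h cr p q (0 : Fin 2) 0 0 1

/-- Covariance of a self-overlap and an overlap of two other replicas. -/
def covZ (N S : ℕ) (β h cr p q : ℝ) : ℝ := overlapCov N S β h cr p q (0 : Fin 3) 0 1 2

/-- Variance of an overlap. -/
def covU (N S : ℕ) (β h cr p q : ℝ) : ℝ := overlapCov N S β h cr p q (0 : Fin 2) 1 0 1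

/-- Covariance of two overlaps with one common replica. -/
def covV (N S : ℕ) (β h cr p q : ℝ) : ℝ := overlapCov N S β h cr p q (0 : Fin 3) 1 0 2

/-- Covariance of two overlaps of four different replicas. -/
def covW (N S : ℕ) (β h cr p q : ℝ) : ℝ := overlapCov N S β h cr p q (0 : Fin 4) 1 2 3

lemma injective_vec_two {a b : Fin n} (h : a ≠ b) : Function.Injective ![a, b] := by
  intro i j hij
  fin_cases i <;> fin_cases j <;> simp_all

lemma injective_vec_three {a b c : Fin n} (h1 : a ≠ b) (h2 : a ≠ c) (h3 : b ≠ c) :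
    Function.Injective ![a, b, c] := by
  intro i j hij
  fin_cases i <;> fin_cases j <;> simp_all

lemma overlapCov_diag_diag (x k : Fin n) : overlapCov N S β h cr p q x x k k
    = if k = x then covP N S β h cr p q else covP' N S β h cr p q := by
  split_ifs with hk
  · subst hk
    exact overlapCov_comp (φ := fun _ : Fin 1 => k) (fun a b _ => Subsingleton.elim a b) 0 0 0 0
  · exact overlapCov_comp (injective_vec_two (Ne.symm hk)) 0 0 1 1

lemma overlapCov_diag_off (x : Fin n) {k l : Fin n} (hkl : k ≠ l) :
    overlapCov N S β h cr p q x x k l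
      = if k = x ∨ l = x then covY N S β h cr p q else covZ N S β h cr p q := by
  split_ifs with hx
  · rcases hx with rfl | rfl
    · exact overlapCov_comp (injective_vec_two hkl) 0 0 0 1
    · rw [overlapCov_swap]
      exact overlapCov_comp (injective_vec_two hkl.symm) 0 0 0 1
  · push Not at hx
    exact overlapCov_comp (injective_vec_three hx.1.symm hx.2.symm hkl) 0 0 1 2

lemma overlapCov_off_share {x y z : Fin n} (hxy : x ≠ y) (hxz : x ≠ z) :
    overlapCov N S β h cr p q x y x z
      = if z = y then covU N S β h cr p q else covV N S β h cr p q := by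
  split_ifs with hz
  · subst hz
    exact overlapCov_comp (injective_vec_two hxy) 0 1 0 1
  · exact overlapCov_comp (injective_vec_three hxy hxz (Ne.symm hz)) 0 1 0 2

lemma overlapCov_off_off {x y k l : Fin n} (hxy : x ≠ y) (hkl : k ≠ l) :
    overlapCov N S β h cr p q x y k l
      = if (k = x ∧ l = y) ∨ (k = y ∧ l = x) then covU N S β h cr p q
        else if k = x ∨ l = x ∨ k = y ∨ l = y then covV N S β h cr p q
        else covW N S β h cr p q := by
  by_cases h1 : k = x
  · subst h1
    rw [overlapCov_off_share hxy hkl]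
    by_cases h2 : l = y
    · simp [h2]
    · simp [h2, hxy]
  by_cases h2 : l = x
  · subst h2
    rw [overlapCov_swap, overlapCov_off_share hxy hkl.symm]
    by_cases h3 : k = y
    · simp [h3]
    · simp [h3, h1]
  by_cases h3 : k = y
  · subst h3
    rw [overlapCov_swap', overlapCov_off_share hxy.symm hkl]
    simp [h1, h2]
  by_cases h4 : l = y
  · subst h4
    rw [overlapCov_swap', overlapCov_swap, overlapCov_off_share hxy.symm hkl.symm]
    simp [h1, h2, hkl]
  simp only [h1, h2, h3, h4, false_and, or_self, if_false]
  have hinj : Function.Injective ![x, y, k, l] := by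
    intro i j hij
    fin_cases i <;> fin_cases j <;> simp_all
  exact overlapCov_comp hinj 0 1 2 3

/-- The value of `overlapCov` in terms of the coincidences between the replicas. -/
lemma overlapCov_eq (x y k l : Fin n) :
    overlapCov N S β h cr p q x y k l =
      if x = y then
        if k = l then if k = x then covP N S β h cr p q else covP' N S β h cr p q
        else if k = x ∨ l = x then covY N S β h cr p q else covZ N S β h cr p q
      else if k = l then
        if x = k ∨ y = k then covY N S β h cr p q else covZ N S β h cr p q
      else if (k = x ∧ l = y) ∨ (k = y ∧ l = x) then covU N S β h cr p q
        else if k = x ∨ l = x ∨ k = y ∨ l = y then covV N S β h cr p q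
        else covW N S β h cr p q := by
  by_cases hxy : x = y
  · subst hxy
    rw [if_pos rfl]
    by_cases hkl : k = l
    · subst hkl
      rw [if_pos rfl, overlapCov_diag_diag]
    · rw [if_neg hkl, overlapCov_diag_off x hkl]
  · rw [if_neg hxy]
    by_cases hkl : k = l
    · subst hkl
      rw [if_pos rfl, overlapCov_comm, overlapCov_diag_off k hxy]
    · rw [if_neg hkl, overlapCov_off_off hxy hkl]

/-- A quantity of order `N ^ (-3 / 2)`. -/
def IsSmall (a : ℕ → ℝ) : Prop := ∃ C : ℝ, ∀ N : ℕ, 1 ≤ N → |a N| ≤ C * (1 / √(N : ℝ)) ^ 3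

lemma IsSmall.add {a b : ℕ → ℝ} (ha : IsSmall a) (hb : IsSmall b) :
    IsSmall fun N => a N + b N := by
  obtain ⟨C, hC⟩ := ha
  obtain ⟨C', hC'⟩ := hb
  refine ⟨C + C', fun N hN => (abs_add_le _ _).trans ?_⟩
  rw [add_mul]
  exact add_le_add (hC N hN) (hC' N hN)

lemma IsSmall.const_mul {a : ℕ → ℝ} (ha : IsSmall a) (c : ℝ) : IsSmall fun N => c * a N := by
  obtain ⟨C, hC⟩ := ha
  refine ⟨|c| * C, fun N hN => ?_⟩
  rw [abs_mul, mul_assoc]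
  exact mul_le_mul_of_nonneg_left (hC N hN) (abs_nonneg _)

lemma IsSmall.congr {a b : ℕ → ℝ} (ha : IsSmall a) (hab : ∀ N, 1 ≤ N → a N = b N) :
    IsSmall b := by
  obtain ⟨C, hC⟩ := ha
  exact ⟨C, fun N hN => hab N hN ▸ hC N hN⟩

lemma replicaCoeff_four : replicaCoeff 4 = ![1, 1, 1, 1, -4] := by
  funext k; fin_cases k <;> simp [replicaCoeff]

lemma replicaCoeff_five : replicaCoeff 5 = ![1, 1, 1, 1, 1, -5] := by
  funext k; fin_cases k <;> simp [replicaCoeff]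

/-- The double sum of the cavity expansion. Here and in the next three lemmas only differences of
the seven covariances survive, because the weights `replicaCoeff` add up to zero. -/
lemma sum_sqTable_diag (D E : ℝ) :
    ∑ k : Fin 5, ∑ l : Fin 6, replicaCoeff 4 k * replicaCoeff 5 l * (sqTable D E k.castSucc l *
      overlapCov N S β h cr p q (0 : Fin 6) 0 k.castSucc l)
    = D * (covP N S β h cr p q - covP' N S β h cr p q)
      - 4 * E * (covY N S β h cr p q - covZ N S β h cr p q) := by
  simp only [overlapCov_eq, replicaCoeff_four, replicaCoeff_five, Fin.sum_univ_five,
    Fin.sum_univ_six, sqTable]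
  simp [Fin.ext_iff]
  ring

lemma sum_sqTable_off (D E : ℝ) :
    ∑ k : Fin 5, ∑ l : Fin 6, replicaCoeff 4 k * replicaCoeff 5 l * (sqTable D E k.castSucc l *
      overlapCov N S β h cr p q (0 : Fin 6) 2 k.castSucc l)
    = D * (covY N S β h cr p q - covZ N S β h cr p q)
      + 2 * E * (covU N S β h cr p q - 4 * covV N S β h cr p q + 3 * covW N S β h cr p q) := by
  simp only [overlapCov_eq, replicaCoeff_four, replicaCoeff_five, Fin.sum_univ_five,
    Fin.sum_univ_six, sqTable]
  simp [Fin.ext_iff]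
  ring

lemma sum_mulTable_two (E F G : ℝ) :
    ∑ k : Fin 5, ∑ l : Fin 6, replicaCoeff 4 k * replicaCoeff 5 l * (mulTable E F G k.castSucc l *
      overlapCov N S β h cr p q (0 : Fin 6) 2 k.castSucc l)
    = E * (covY N S β h cr p q - covZ N S β h cr p q)
      + 2 * (F * (covU N S β h cr p q - covV N S β h cr p q)
        - 3 * G * (covV N S β h cr p q - covW N S β h cr p q)) := by
  simp only [overlapCov_eq, replicaCoeff_four, replicaCoeff_five, Fin.sum_univ_five,
    Fin.sum_univ_six, mulTable]
  simp [Fin.ext_iff]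
  ring

lemma sum_mulTable_three (E F G : ℝ) :
    ∑ k : Fin 5, ∑ l : Fin 6, replicaCoeff 4 k * replicaCoeff 5 l * (mulTable E F G k.castSucc l *
      overlapCov N S β h cr p q (0 : Fin 6) 3 k.castSucc l)
    = E * (covY N S β h cr p q - covZ N S β h cr p q)
      + 2 * (F * (covV N S β h cr p q - covW N S β h cr p q)
        + G * (covU N S β h cr p q - covV N S β h cr p q)
        - 4 * G * (covV N S β h cr p q - covW N S β h cr p q)) := by
  simp only [overlapCov_eq, replicaCoeff_four, replicaCoeff_five, Fin.sum_univ_five,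
    Fin.sum_univ_six, mulTable]
  simp [Fin.ext_iff]
  ring

end System

section Components

variable {Ω : Type*} [Fintype Ω] {n : ℕ}

/-! ### The components of the overlap -/

lemma replicaAvg_zero (H : Ω → ℝ) (f : (Fin 0 → Ω) → ℝ) : replicaAvg H f = f ![] := by
  simp [replicaAvg, Subsingleton.elim (default : Fin 0 → Ω) ![]]

lemma replicaAvg_succ (H : Ω → ℝ) (f : (Fin (n + 1) → Ω) → ℝ) :
    replicaAvg H f = ∑ x, replicaAvg H (fun σ : Fin n → Ω => f (Fin.cons x σ)) *
      gibbsWeight H x := by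
  unfold replicaAvg
  rw [← Equiv.sum_comp (Fin.consEquiv fun _ => Ω), Fintype.sum_prod_type]
  refine Finset.sum_congr rfl fun x _ => ?_
  rw [Finset.sum_mul]
  refine Finset.sum_congr rfl fun σ _ => ?_
  have h : Fin.consEquiv (fun _ => Ω) (x, σ) = Fin.cons x σ := rfl
  rw [h, Fin.prod_univ_succ]
  simp only [Fin.cons_zero, Fin.cons_succ]
  ring

/-- The average of a function of a single replica. -/
def singleAvg (H : Ω → ℝ) (u : Ω → ℝ) : ℝ := ∑ x, u x * gibbsWeight H x

lemma singleAvg_const_mul (H : Ω → ℝ) (c : ℝ) (u : Ω → ℝ) :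
    singleAvg H (fun x => c * u x) = c * singleAvg H u := by
  simp only [singleAvg, Finset.mul_sum, mul_assoc]

lemma singleAvg_mul_const (H : Ω → ℝ) (c : ℝ) (u : Ω → ℝ) :
    singleAvg H (fun x => u x * c) = singleAvg H u * c := by
  simp only [mul_comm _ c, singleAvg_const_mul]

lemma singleAvg_add (H : Ω → ℝ) (u v : Ω → ℝ) :
    singleAvg H (fun x => u x + v x) = singleAvg H u + singleAvg H v := by
  simp only [singleAvg, add_mul, Finset.sum_add_distrib]

lemma singleAvg_sub (H : Ω → ℝ) (u v : Ω → ℝ) :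
    singleAvg H (fun x => u x - v x) = singleAvg H u - singleAvg H v := by
  simp only [singleAvg, sub_mul, Finset.sum_sub_distrib]

lemma singleAvg_sum {ι : Type*} (s : Finset ι) (H : Ω → ℝ) (u : ι → Ω → ℝ) :
    singleAvg H (fun x => ∑ j ∈ s, u j x) = ∑ j ∈ s, singleAvg H (u j) := by
  simp only [singleAvg, Finset.sum_mul]
  rw [Finset.sum_comm]

lemma singleAvg_const [Nonempty Ω] (H : Ω → ℝ) (c : ℝ) : singleAvg H (fun _ => c) = c := by
  rw [singleAvg, ← Finset.mul_sum, sum_gibbsWeight, mul_one]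

lemma replicaAvg_one (H : Ω → ℝ) (f : (Fin 1 → Ω) → ℝ) :
    replicaAvg H f = singleAvg H fun x => f ![x] := by
  rw [replicaAvg_succ]
  simp only [replicaAvg_zero]
  rfl

lemma replicaAvg_two (H : Ω → ℝ) (f : (Fin 2 → Ω) → ℝ) :
    replicaAvg H f = singleAvg H fun x => singleAvg H fun y => f ![x, y] := by
  rw [replicaAvg_succ]
  simp only [replicaAvg_one]
  rfl

lemma replicaAvg_three (H : Ω → ℝ) (f : (Fin 3 → Ω) → ℝ) :
    replicaAvg H f = singleAvg H fun x => singleAvg H fun y => singleAvg H fun z =>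
      f ![x, y, z] := by
  rw [replicaAvg_succ]
  simp only [replicaAvg_two]
  rfl

lemma replicaAvg_four (H : Ω → ℝ) (f : (Fin 4 → Ω) → ℝ) :
    replicaAvg H f = singleAvg H fun x => singleAvg H fun y => singleAvg H fun z =>
      singleAvg H fun w => f ![x, y, z, w] := by
  rw [replicaAvg_succ]
  simp only [replicaAvg_three]
  rfl

/-- A covariance does not change when constants are subtracted. -/
lemma singleAvg_centered [Nonempty Ω] (H : Ω → ℝ) (u v : Ω → ℝ) (r s : ℝ) :
    singleAvg H (fun x => (u x - singleAvg H u) * (v x - singleAvg H v))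
      = singleAvg H (fun x => (u x - r) * (v x - s))
        - (singleAvg H u - r) * (singleAvg H v - s) := by
  have h1 : ∀ a b : ℝ, singleAvg H (fun x => (u x - a) * (v x - b))
      = singleAvg H (fun x => u x * v x) - b * singleAvg H u - a * singleAvg H v + a * b := by
    intro a b
    have : (fun x => (u x - a) * (v x - b))
        = fun x => ((u x * v x - b * u x) - a * v x) + a * b := by funext x; ring
    rw [this, singleAvg_add, singleAvg_sub, singleAvg_sub, singleAvg_const_mul,
      singleAvg_const_mul, singleAvg_const]
  rw [h1, h1]
  ring

end Components

section ComponentsGS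

variable {N S : ℕ} {β h cr p q : ℝ}

/-- The overlap of two configurations. -/
def pairOverlap (σ τ : Config N S) : ℝ := 1 / (N : ℝ) * ∑ i, sv (σ i) * sv (τ i)

lemma nu_eq_integral {n : ℕ} (f : Disorder N → (Fin n → Config N S) → ℝ) :
    nu N S β h cr f = ∫ g, replicaAvg (hamiltonian N S β h cr g) (f g) ∂disorderLaw N := rfl

instance : IsProbabilityMeasure (disorderLaw N) := by
  unfold disorderLaw
  infer_instance

lemma quenchedMean_eq (g : Disorder N) (i : Fin N) : quenchedMean N S β h cr g i
    = singleAvg (hamiltonian N S β h cr g) fun σ => sv (σ i) := by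
  have h1 := replicaAvg_one (hamiltonian N S β h cr g) fun σ => sv (σ 0 i)
  simp only [Matrix.cons_val_fin_one] at h1
  rw [← h1]
  rfl

lemma quenchedSq_eq (g : Disorder N) (i : Fin N) : quenchedSq N S β h cr g i
    = singleAvg (hamiltonian N S β h cr g) fun σ => sv (σ i) ^ 2 := by
  have h1 := replicaAvg_one (hamiltonian N S β h cr g) fun σ => sv (σ 0 i) ^ 2
  simp only [Matrix.cons_val_fin_one] at h1
  rw [← h1]
  rfl

lemma integrable_hamiltonian {n : ℕ} (f : (Fin n → Config N S) → ℝ) :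
    Integrable (fun g => replicaAvg (hamiltonian N S β h cr g) f) (disorderLaw N) := by
  obtain ⟨B, -, hB⟩ := exists_abs_bound f
  refine Integrable.of_bound
    (continuous_replicaAvg (fun σ => ?_) f).aestronglyMeasurable B
    (Filter.Eventually.of_forall fun g => abs_replicaAvg_le_of_bound _ hB)
  unfold hamiltonian
  fun_prop

/-- The overlap of a configuration with an independent replica, averaged over the latter. -/
lemma singleAvg_pairOverlap (g : Disorder N) (σ : Config N S) :
    singleAvg (hamiltonian N S β h cr g) (pairOverlap σ)
      = 1 / (N : ℝ) * ∑ i, sv (σ i) * quenchedMean N S β h cr g i := by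
  have h1 : pairOverlap σ = fun τ => 1 / (N : ℝ) * ∑ i, sv (σ i) * sv (τ i) := rfl
  simp only [h1, singleAvg_const_mul, singleAvg_sum, quenchedMean_eq]

/-- `T₁` is the conditional expectation, given the first replica, of the overlap with a second one,
minus the Gibbs mean of that overlap. -/
lemma compT_eq (g : Disorder N) (σ : Config N S) : compT N S β h cr (0 : Fin 1) g ![σ]
    = singleAvg (hamiltonian N S β h cr g) (pairOverlap σ)
      - singleAvg (hamiltonian N S β h cr g)
        (fun τ => singleAvg (hamiltonian N S β h cr g) (pairOverlap τ)) := by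
  simp only [singleAvg_pairOverlap, singleAvg_const_mul, singleAvg_sum, singleAvg_mul_const,
    ← quenchedMean_eq]
  simp only [compT, sub_mul, Finset.sum_sub_distrib, mul_sub, Matrix.cons_val_fin_one]

lemma compS_eq (g : Disorder N) (σ : Config N S) : compS N S β h cr (0 : Fin 1) g ![σ]
    = pairOverlap σ σ - singleAvg (hamiltonian N S β h cr g) (fun τ => pairOverlap τ τ) := by
  simp only [pairOverlap, ← pow_two, singleAvg_const_mul, singleAvg_sum, ← quenchedSq_eq]
  simp only [compS, Finset.sum_sub_distrib, mul_sub, Matrix.cons_val_fin_one]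

lemma overlapCov_eq_integral {n : ℕ} (x y k l : Fin n) : overlapCov N S β h cr p q x y k l
    = ∫ g, replicaAvg (hamiltonian N S β h cr g) (fun σ : Fin n → Config N S =>
        (pairOverlap (σ x) (σ y) - target p q x y) * (pairOverlap (σ k) (σ l) - target p q k l))
        ∂disorderLaw N := by
  rw [overlapCov, ← nu_eq_fullAvg]
  rfl

/-- The second moment of `T₁` is a difference of overlap covariances: each quenched mean is replaced
by an average over one more replica. The two lemmas below treat the other moments in this way. -/
lemma nu_compT_sq (N S : ℕ) (β h cr p q : ℝ) :
    nu N S β h cr (n := 1) (fun g σ => compT N S β h cr 0 g σ ^ 2)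
      = covV N S β h cr p q - covW N S β h cr p q := by
  rw [nu_eq_integral, covV, covW, overlapCov_eq_integral, overlapCov_eq_integral,
    ← integral_sub (integrable_hamiltonian _) (integrable_hamiltonian _)]
  congr 1
  funext g
  rw [replicaAvg_one, replicaAvg_three, replicaAvg_four]
  simp only [compT_eq, pow_two]
  rw [singleAvg_centered _ _ _ q q]
  simp [target, singleAvg_mul_const, singleAvg_const_mul, singleAvg_sub, singleAvg_const]

lemma nu_compS_sq (N S : ℕ) (β h cr p q : ℝ) :
    nu N S β h cr (n := 1) (fun g σ => compS N S β h cr 0 g σ ^ 2)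
      = covP N S β h cr p q - covP' N S β h cr p q := by
  rw [nu_eq_integral, covP, covP', overlapCov_eq_integral, overlapCov_eq_integral,
    ← integral_sub (integrable_hamiltonian _) (integrable_hamiltonian _)]
  congr 1
  funext g
  rw [replicaAvg_one, replicaAvg_one, replicaAvg_two]
  simp only [compS_eq, pow_two]
  rw [singleAvg_centered _ (fun σ => pairOverlap σ σ) (fun σ => pairOverlap σ σ) p p]
  simp [target, singleAvg_mul_const, singleAvg_const_mul, singleAvg_sub, singleAvg_const]

lemma nu_compS_mul_compT (N S : ℕ) (β h cr p q : ℝ) :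
    nu N S β h cr (n := 1) (fun g σ => compS N S β h cr 0 g σ * compT N S β h cr 0 g σ)
      = covY N S β h cr p q - covZ N S β h cr p q := by
  rw [nu_eq_integral, covY, covZ, overlapCov_eq_integral, overlapCov_eq_integral,
    ← integral_sub (integrable_hamiltonian _) (integrable_hamiltonian _)]
  congr 1
  funext g
  rw [replicaAvg_one, replicaAvg_two, replicaAvg_three]
  simp only [compS_eq, compT_eq]
  rw [singleAvg_centered _ (fun σ => pairOverlap σ σ) _ p q]
  simp [target, singleAvg_mul_const, singleAvg_const_mul, singleAvg_sub, singleAvg_const]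

end ComponentsGS

/-! ### Solution of the linear system -/

section Solution

variable {S : ℕ} {β h cr p q : ℝ}

/-- The cavity expansion for the difference of two overlaps against a third one, with the
single-spin averages collected in a table. -/
lemma isSmall_expansion (hβ : β ^ 2 ≤ 1) (hrs : IsReplicaSymmetric S β h cr p q) {K : ℝ}
    (hK0 : 0 ≤ K) (hK : ∀ N : ℕ, 1 ≤ N → ∀ m ∈ Finset.Icc 1 4,
      overlapMoment N S β h cr p q m ≤ K * (1 / √(N : ℝ)) ^ m)
    {a : (Fin 4 → ℝ) → ℝ} {k₁ l₁ k₂ l₂ : Fin 4} (ha : ∀ ε, a ε = ε k₁ * ε l₁ - ε k₂ * ε l₂)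
    (ht : k₁ = l₁ ↔ k₂ = l₂) (x y : Fin 4) {t : Fin 6 → Fin 6 → ℝ}
    (htab : ∀ k l : Fin 6, nu0 S β h cr p q (fun ε : Fin 6 → ℝ =>
      a (fun j => ε j.castSucc.castSucc) * (ε k * ε l)) = t k l) :
    IsSmall fun N => overlapCov N S β h cr p q k₁ l₁ x y - overlapCov N S β h cr p q k₂ l₂ x y
      - (1 / N * t x.castSucc.castSucc y.castSucc.castSucc
        + β ^ 2 / 2 * ∑ k : Fin 5, ∑ l : Fin 6, replicaCoeff 4 k * replicaCoeff 5 l *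
          (t k.castSucc l * overlapCov N S β h cr p q x.castSucc.castSucc y.castSucc.castSucc
            k.castSucc l)) := by
  obtain ⟨hp0, hp1, hq0, hq1⟩ := hrs.bounds
  have htar : target p q k₁ l₁ = target p q k₂ l₂ := by simp only [target, ht]
  have ha0 : nu0 S β h cr p q a = 0 := by
    have : a = fun ε => ε k₁ * ε l₁ - ε k₂ * ε l₂ := funext ha
    rw [this, nu0_sub, hrs.nu0_mul, hrs.nu0_mul, htar, sub_self]
  obtain ⟨C, hC⟩ := exists_cavity_expansion_sum hβ ⟨hp0, hp1⟩ ⟨hq0, hq1⟩ hK0 hK a ha0 x y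
  refine ⟨C, fun N hN => ?_⟩
  have h1 : nu0 S β h cr p q (fun ε : Fin 4 → ℝ => a ε * (ε x * ε y))
      = t x.castSucc.castSucc y.castSucc.castSucc := by
    rw [← htab]
    exact (nu0_comp (φ := fun j : Fin 4 => j.castSucc.castSucc)
      ((Fin.castSucc_injective 5).comp (Fin.castSucc_injective 4))
      (fun ε : Fin 4 → ℝ => a ε * (ε x * ε y))).symm
  have h2 : fullAvg β h cr (fun σ : Fin 4 → Config N S =>
      (1 / (N : ℝ) * ∑ i, a (fun k => sv (σ k i))) * (overlap σ x y - target p q x y))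
      = overlapCov N S β h cr p q k₁ l₁ x y - overlapCov N S β h cr p q k₂ l₂ x y := by
    unfold overlapCov fullAvg
    rw [← gaussAvg_sub]
    congr 1
    funext σ
    have h4 : 1 / (N : ℝ) * ∑ i, a (fun k => sv (σ k i))
        = overlap σ k₁ l₁ - overlap σ k₂ l₂ := by
      simp only [ha, Finset.sum_sub_distrib]
      rw [mul_sub]
      rfl
    rw [h4, htar]
    ring
  have h3 := hC N hN
  rw [h1, h2] at h3
  simp only [htab] at h3
  exact h3

/-- The solution of the linear system, with the remainders `e₁, …, e₄` of the four equations. Here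
`b = β ^ 2`, `ν = 1 / N`, and `T`, the difference of the variance of an overlap and of the
covariance of two overlaps with a common replica, is an auxiliary unknown. -/
lemma solve_system {b ν D E F G M₁ M₂ M₃ M A B C T e₁ e₂ e₃ e₄ : ℝ}
    (hM1 : M₁ = 1 - b * (F - 3 * G)) (hM2 : M₂ = 1 - b / 2 * D) (hM3 : M₃ = 1 - b * (F - G))
    (hM : M = M₁ * M₂ + b ^ 2 * E ^ 2) (h2 : M₂ ≠ 0) (h3 : M₃ ≠ 0) (h0 : M ≠ 0)
    (he1 : T - (ν * F + b / 2 * (E * C + 2 * (F * T - 3 * G * A))) = e₁)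
    (he2 : A - (ν * G + b / 2 * (E * C + 2 * (F * A + G * T - 4 * G * A))) = e₂)
    (he3 : C - (ν * E + b / 2 * (D * C + 2 * E * (T - 3 * A))) = e₃)
    (he4 : B - (ν * D + b / 2 * (D * B - 4 * E * C)) = e₄) :
    (A = (G * M₂ + b / 2 * E ^ 2) / M * (ν / M₃)
      + (M₂ / M * e₂ + b / 2 * E / M * e₃
        + (M₂ * b * G + b ^ 2 * E ^ 2 / 2) / (M * M₃) * (e₁ + -1 * e₂))) ∧
    (C = E * ν / M + (M₁ / M * e₃ + -(2 * b * E) / M * e₂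
        + (M₁ * b * E - 2 * b ^ 2 * E * G) / (M * M₃) * (e₁ + -1 * e₂))) ∧
    (B = (D * M₁ - 2 * b * E ^ 2) * ν / M
      + (1 / M₂ * e₄ + -(2 * b * E) / M₂ * (C - E * ν / M))) := by
  have hX : T - A = ((F - G) * ν + (e₁ - e₂)) / M₃ := by
    rw [eq_div_iff h3]
    rw [hM3]
    linear_combination he1 - he2
  have hA : M₁ * A = ν * G + b / 2 * E * C + b * G * (T - A) + e₂ := by
    rw [hM1]
    linear_combination he2
  have hC : M₂ * C = ν * E + b * E * (T - A) - 2 * b * E * A + e₃ := by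
    rw [hM2]
    linear_combination he3
  have hB : M₂ * B = ν * D - 2 * b * E * C + e₄ := by
    rw [hM2]
    linear_combination he4
  -- `1 + b (F - G) / M₃ = 1 / M₃` and `M₁ - 2 b G = M₃`
  have hF : b * (F - G) = 1 - M₃ := by rw [hM3]; ring
  have hG : 2 * (b * G) = M₁ - M₃ := by rw [hM1, hM3]; ring
  have hD : b * D = 2 * (1 - M₂) := by rw [hM2]; ring
  have hA' : A = (M₂ * (ν * G + b * G * (T - A) + e₂)
      + b / 2 * E * (ν * E + b * E * (T - A) + e₃)) / M := by
    rw [eq_div_iff h0, hM]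
    linear_combination M₂ * hA + b / 2 * E * hC
  have hC' : C = (M₁ * (ν * E + b * E * (T - A) + e₃)
      - 2 * b * E * (ν * G + b * G * (T - A) + e₂)) / M := by
    rw [eq_div_iff h0, hM]
    linear_combination M₁ * hC - 2 * b * E * hA
  refine ⟨?_, ?_, ?_⟩
  · conv_lhs => rw [hA', hX]
    field_simp
    linear_combination (ν * (2 * M₂ * G + b * E ^ 2)) * hF
  · conv_lhs => rw [hC', hX]
    field_simp
    linear_combination (ν * E * (M₁ - 2 * b * G)) * hF - (E * ν) * hG
  · have hB' : B = (ν * D - 2 * b * E * C + e₄) / M₂ := by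
      rw [eq_div_iff h2]
      linear_combination hB
    rw [hB']
    field_simp
    rw [hM]
    linear_combination (ν * b * E ^ 2) * hD

end Solution

/-! ### Asymptotics of the covariances -/

section Asymptotics

variable {S : ℕ} {β h cr p q : ℝ}

section Expansions

variable (hβ : β ^ 2 ≤ 1) (hrs : IsReplicaSymmetric S β h cr p q) {K : ℝ} (hK0 : 0 ≤ K)
  (hK : ∀ N : ℕ, 1 ≤ N → ∀ m ∈ Finset.Icc 1 4,
    overlapMoment N S β h cr p q m ≤ K * (1 / √(N : ℝ)) ^ m)

include hβ hrs hK0 hK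

/-- The cavity equation for the second moment of `S₁`: test function `ε₁² - ε₂²`, against the
deviation of the self-overlap of the first replica. -/
lemma isSmall_sq_diag : IsSmall fun N => covP N S β h cr p q - covP' N S β h cr p q
    - (1 / N * cD S β h cr p q + β ^ 2 / 2 *
      (cD S β h cr p q * (covP N S β h cr p q - covP' N S β h cr p q)
        - 4 * cE S β h cr p q * (covY N S β h cr p q - covZ N S β h cr p q))) := by
  refine (isSmall_expansion hβ hrs hK0 hK (a := fun ε => ε 0 ^ 2 - ε 1 ^ 2) (k₁ := 0) (l₁ := 0)
    (k₂ := 1) (l₂ := 1) (fun ε => by ring) (by simp) 0 0 nu0_sq_sub_sq_mul).congr fun N _ => ?_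
  rw [← sum_sqTable_diag (N := N)]
  simp only [overlapCov_eq (n := 4)]
  simp
  exact Or.inl rfl

/-- The cavity equation for the mixed moment of `S₁` and `T₁`: test function `ε₁² - ε₂²`, against
the deviation of the overlap of the first and the third replica. -/
lemma isSmall_sq_off : IsSmall fun N => covY N S β h cr p q - covZ N S β h cr p q
    - (1 / N * cE S β h cr p q + β ^ 2 / 2 *
      (cD S β h cr p q * (covY N S β h cr p q - covZ N S β h cr p q)
        + 2 * cE S β h cr p q * (covU N S β h cr p q - 4 * covV N S β h cr p q
          + 3 * covW N S β h cr p q))) := by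
  refine (isSmall_expansion hβ hrs hK0 hK (a := fun ε => ε 0 ^ 2 - ε 1 ^ 2) (k₁ := 0) (l₁ := 0)
    (k₂ := 1) (l₂ := 1) (fun ε => by ring) (by simp) 0 2 nu0_sq_sub_sq_mul).congr fun N _ => ?_
  rw [← sum_sqTable_off (N := N)]
  simp only [overlapCov_eq (n := 4)]
  simp
  exact Or.inl rfl

/-- The auxiliary cavity equation: test function `(ε₁ - ε₂) ε₃`, against the deviation of the
overlap of the first and the third replica. -/
lemma isSmall_mul_two : IsSmall fun N => covU N S β h cr p q - covV N S β h cr p q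
    - (1 / N * cF S β h cr p q + β ^ 2 / 2 *
      (cE S β h cr p q * (covY N S β h cr p q - covZ N S β h cr p q)
        + 2 * (cF S β h cr p q * (covU N S β h cr p q - covV N S β h cr p q)
          - 3 * cG S β h cr p q * (covV N S β h cr p q - covW N S β h cr p q)))) := by
  refine (isSmall_expansion hβ hrs hK0 hK (a := fun ε => (ε 0 - ε 1) * ε 2) (k₁ := 0) (l₁ := 2)
    (k₂ := 1) (l₂ := 2) (fun ε => by ring) (by simp) 0 2 nu0_sub_mul_mul).congr fun N _ => ?_
  rw [← sum_mulTable_two (N := N)]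
  simp only [overlapCov_eq (n := 4)]
  simp
  exact Or.inl rfl

/-- The cavity equation for the second moment of `T₁`: test function `(ε₁ - ε₂) ε₃`, against the
deviation of the overlap of the first and the fourth replica. -/
lemma isSmall_mul_three : IsSmall fun N => covV N S β h cr p q - covW N S β h cr p q
    - (1 / N * cG S β h cr p q + β ^ 2 / 2 *
      (cE S β h cr p q * (covY N S β h cr p q - covZ N S β h cr p q)
        + 2 * (cF S β h cr p q * (covV N S β h cr p q - covW N S β h cr p q)
          + cG S β h cr p q * (covU N S β h cr p q - covV N S β h cr p q)
          - 4 * cG S β h cr p q * (covV N S β h cr p q - covW N S β h cr p q)))) := by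
  refine (isSmall_expansion hβ hrs hK0 hK (a := fun ε => (ε 0 - ε 1) * ε 2) (k₁ := 0) (l₁ := 2)
    (k₂ := 1) (l₂ := 2) (fun ε => by ring) (by simp) 0 3 nu0_sub_mul_mul).congr fun N _ => ?_
  rw [← sum_mulTable_three (N := N)]
  simp only [overlapCov_eq (n := 4)]
  simp
  exact Or.inl rfl

lemma isSmall_components (h2 : M2 S β h cr p q ≠ 0) (h3 : M3 S β h cr p q ≠ 0)
    (h0 : M0 S β h cr p q ≠ 0) :
    (IsSmall fun N => covV N S β h cr p q - covW N S β h cr p q - A1sq N S β h cr p q) ∧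
    (IsSmall fun N => covP N S β h cr p q - covP' N S β h cr p q - B1sq N S β h cr p q) ∧
    (IsSmall fun N => covY N S β h cr p q - covZ N S β h cr p q - C1sq N S β h cr p q) := by
  have s1 := isSmall_mul_two hβ hrs hK0 hK
  have s2 := isSmall_mul_three hβ hrs hK0 hK
  have s3 := isSmall_sq_off hβ hrs hK0 hK
  have s4 := isSmall_sq_diag hβ hrs hK0 hK
  have hM : M0 S β h cr p q = M1 S β h cr p q * M2 S β h cr p q
      + (β ^ 2) ^ 2 * cE S β h cr p q ^ 2 := by rw [M0]; ring
  have hsol := fun N : ℕ => solve_system (ν := 1 / (N : ℝ))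
    (C := covY N S β h cr p q - covZ N S β h cr p q)
    (T := covU N S β h cr p q - covV N S β h cr p q)
    (A := covV N S β h cr p q - covW N S β h cr p q)
    (B := covP N S β h cr p q - covP' N S β h cr p q)
    (rfl : M1 S β h cr p q = _) (rfl : M2 S β h cr p q = _) (rfl : M3 S β h cr p q = _) hM h2 h3 h0
    rfl rfl rfl rfl
  have sC : IsSmall fun N => covY N S β h cr p q - covZ N S β h cr p q - C1sq N S β h cr p q := by
    refine (((s3.const_mul (M1 S β h cr p q / M0 S β h cr p q)).add
      (s2.const_mul (-(2 * β ^ 2 * cE S β h cr p q) / M0 S β h cr p q))).add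
      ((s1.add (s2.const_mul (-1))).const_mul
        ((M1 S β h cr p q * β ^ 2 * cE S β h cr p q
          - 2 * (β ^ 2) ^ 2 * cE S β h cr p q * cG S β h cr p q)
          / (M0 S β h cr p q * M3 S β h cr p q)))).congr fun N hN => ?_
    have hN' : (N : ℝ) ≠ 0 := by positivity
    have hC := (hsol N).2.1
    have hC1 : C1sq N S β h cr p q = cE S β h cr p q * (1 / N) / M0 S β h cr p q := by
      unfold C1sq; field_simp
    rw [eq_sub_iff_add_eq, hC1, add_comm]
    convert hC.symm using 3
    ring
  refine ⟨?_, ?_, sC⟩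
  · refine (((s2.const_mul (M2 S β h cr p q / M0 S β h cr p q)).add
      (s3.const_mul (β ^ 2 / 2 * cE S β h cr p q / M0 S β h cr p q))).add
      ((s1.add (s2.const_mul (-1))).const_mul
        ((M2 S β h cr p q * β ^ 2 * cG S β h cr p q
          + (β ^ 2) ^ 2 * cE S β h cr p q ^ 2 / 2)
          / (M0 S β h cr p q * M3 S β h cr p q)))).congr fun N hN => ?_
    have hN' : (N : ℝ) ≠ 0 := by positivity
    have hA := (hsol N).1
    have hA1 : A1sq N S β h cr p q = (cG S β h cr p q * M2 S β h cr p q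
        + β ^ 2 / 2 * cE S β h cr p q ^ 2) / M0 S β h cr p q * (1 / N / M3 S β h cr p q) := by
      unfold A1sq; field_simp
    rw [eq_sub_iff_add_eq, hA1, add_comm]
    convert hA.symm using 3
    ring
  -- the equation for `S₁` contains the mixed moment, whose value is already known
  · refine ((s4.const_mul (1 / M2 S β h cr p q)).add
      (sC.const_mul (-(2 * β ^ 2 * cE S β h cr p q) / M2 S β h cr p q))).congr fun N hN => ?_
    have hN' : (N : ℝ) ≠ 0 := by positivity
    have hB := (hsol N).2.2
    have hB1 : B1sq N S β h cr p q = (cD S β h cr p q * M1 S β h cr p q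
        - 2 * β ^ 2 * cE S β h cr p q ^ 2) * (1 / N) / M0 S β h cr p q := by
      unfold B1sq; field_simp
    have hC1 : C1sq N S β h cr p q = cE S β h cr p q * (1 / N) / M0 S β h cr p q := by
      unfold C1sq; field_simp
    rw [eq_sub_iff_add_eq, hB1, hC1, add_comm]
    exact hB.symm

end Expansions

lemma rpow_neg_half_eq {N : ℕ} (H : ℕ) :
    (N : ℝ) ^ (-(H : ℝ) / 2) = (1 / √(N : ℝ)) ^ H := by
  rw [one_div, Real.sqrt_eq_rpow, ← Real.rpow_neg (Nat.cast_nonneg N), ← Real.rpow_natCast,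
    ← Real.rpow_mul (Nat.cast_nonneg N)]
  congr 1
  ring

lemma IsSmall.isON {a : ℕ → ℝ} (ha : IsSmall a) : IsON 3 a := by
  obtain ⟨C, hC⟩ := ha
  refine ⟨C, fun N hN => ?_⟩
  rw [rpow_neg_half_eq]
  exact hC N hN

lemma isON_overlap {K : ℝ} (hK : ∀ N : ℕ, 1 ≤ N → overlapMoment N S β h cr p q 2
    ≤ K * (1 / √(N : ℝ)) ^ 2) :
    IsON 2 (fun N => nu N S β h cr (n := 2) fun _ σ => (overlap σ 0 1 - q) ^ 2) ∧
    IsON 2 (fun N => nu N S β h cr (n := 1) fun _ σ => (overlap σ 0 0 - p) ^ 2) := by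
  have h1 : ∀ N : ℕ, 0 ≤ fullAvg (N := N) (S := S) (n := 2) β h cr
      fun σ => (overlap σ 0 1 - q) ^ 2 := fun N => gaussAvg_nonneg _ _ fun _ => sq_nonneg _
  have h2 : ∀ N : ℕ, 0 ≤ fullAvg (N := N) (S := S) (n := 2) β h cr
      fun σ => (overlap σ 0 0 - p) ^ 2 := fun N => gaussAvg_nonneg _ _ fun _ => sq_nonneg _
  have h3 : ∀ N : ℕ, fullAvg (N := N) (S := S) (n := 2) β h cr (fun σ => (overlap σ 0 0 - p) ^ 2)
      = fullAvg (N := N) (S := S) (n := 1) β h cr fun σ => (overlap σ 0 0 - p) ^ 2 := fun N =>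
    gaussAvg_comp _ _ (φ := fun _ : Fin 1 => (0 : Fin 2)) (fun a b _ => Subsingleton.elim a b)
      (fun σ : Fin 1 → Config N S => (overlap σ 0 0 - p) ^ 2)
  simp only [overlapMoment, sq_abs] at hK
  refine ⟨⟨K, fun N hN => ?_⟩, ⟨K, fun N hN => ?_⟩⟩
  · beta_reduce
    rw [rpow_neg_half_eq, nu_eq_fullAvg, abs_of_nonneg (h1 N)]
    linarith [hK N hN, h2 N]
  · beta_reduce
    rw [rpow_neg_half_eq, nu_eq_fullAvg, ← h3, abs_of_nonneg (h2 N)]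
    linarith [hK N hN, h1 N]

/-- The normalizers are positive at high temperature, since `D`, `F` and `G` are at most
`2 * S ^ 4` in absolute value. -/
lemma normalizers_pos (hβ : 96 * (β ^ 2 * S ^ 4) ≤ 1) :
    0 < M1 S β h cr p q ∧ 0 < M2 S β h cr p q ∧ 0 < M3 S β h cr p q ∧ 0 < M0 S β h cr p q := by
  have hprod : ∀ x y z : Spin S, ∀ w : Spin S, |sv x * sv y * (sv z * sv w)| ≤ (S : ℝ) ^ 4 := by
    intro x y z w
    rw [abs_mul]
    calc _ ≤ (S : ℝ) ^ 2 * S ^ 2 :=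
          mul_le_mul (abs_sv_mul_sv_le x y) (abs_sv_mul_sv_le z w) (abs_nonneg _) (by positivity)
      _ = _ := by ring
  have hsub : ∀ x y x' y' z w : Spin S,
      |(sv x * sv y - sv x' * sv y') * (sv z * sv w)| ≤ 2 * (S : ℝ) ^ 4 := by
    intro x y x' y' z w
    rw [sub_mul]
    exact (abs_sub _ _).trans (by linarith [hprod x y z w, hprod x' y' z w])
  have hD : |cD S β h cr p q| ≤ 2 * (S : ℝ) ^ 4 := abs_nu0_le fun ε => by
    simp only [pow_two (sv _)]
    exact hsub _ _ _ _ _ _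
  have hF : |cF S β h cr p q| ≤ 2 * (S : ℝ) ^ 4 := abs_nu0_le fun ε => hsub _ _ _ _ _ _
  have hG : |cG S β h cr p q| ≤ 2 * (S : ℝ) ^ 4 := abs_nu0_le fun ε => hsub _ _ _ _ _ _
  have hmul : ∀ {c : ℝ}, |c| ≤ 2 * (S : ℝ) ^ 4 → |β ^ 2 * c| ≤ 1 / 48 := by
    intro c hc
    rw [abs_mul, abs_of_nonneg (sq_nonneg β)]
    linarith [mul_le_mul_of_nonneg_left hc (sq_nonneg β)]
  have hD' := abs_le.1 (hmul hD)
  have hF' := abs_le.1 (hmul hF)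
  have hG' := abs_le.1 (hmul hG)
  have h1 : 0 < M1 S β h cr p q := by unfold M1; linarith
  have h2 : 0 < M2 S β h cr p q := by unfold M2; linarith
  refine ⟨h1, h2, by unfold M3; linarith, ?_⟩
  unfold M0
  positivity

lemma A1sq_eq (hβ : 0 < β) {N : ℕ} (hN : 1 ≤ N) (h3 : M3 S β h cr p q ≠ 0)
    (h0 : M0 S β h cr p q ≠ 0) : A1sq N S β h cr p q = 1 / (2 * β ^ 2 * (N : ℝ))
      * (1 / M3 S β h cr p q - M2 S β h cr p q / M0 S β h cr p q) := by
  have hN' : (N : ℝ) ≠ 0 := by positivity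
  unfold A1sq
  field_simp
  unfold M0 M1 M3
  ring

lemma B1sq_eq (hβ : 0 < β) {N : ℕ} (hN : 1 ≤ N) (h0 : M0 S β h cr p q ≠ 0) :
    B1sq N S β h cr p q = 2 / ((N : ℝ) * β ^ 2)
      * (M1 S β h cr p q / M0 S β h cr p q - 1) := by
  have hN' : (N : ℝ) ≠ 0 := by positivity
  unfold B1sq
  field_simp
  unfold M0 M2
  ring

end Asymptotics

end GhatakSherrington

end

theorem mainTheorem6 (S : ℕ) (hS : 1 ≤ S) :
    ∃ β' : ℝ, 0 < β' ∧ ∀ β : ℝ, 0 ≤ β → β < β' → ∀ h : ℝ, 0 ≤ h → ∀ cr : ℝ,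
      ∃ p q : ℝ,
        -- `(p, q)` is the unique solution of the replica-symmetric equations,
        GhatakSherrington.IsReplicaSymmetric S β h cr p q ∧
        (∀ p' q' : ℝ, GhatakSherrington.IsReplicaSymmetric S β h cr p' q' → p' = p ∧ q' = q) ∧
        -- the overlap and the self-overlap concentrate at `q` and `p`,
        GhatakSherrington.IsON 2 (fun N => GhatakSherrington.nu N S β h cr (n := 2)
          fun _ σ => (GhatakSherrington.overlap σ 0 1 - q) ^ 2) ∧
        GhatakSherrington.IsON 2 (fun N => GhatakSherrington.nu N S β h cr (n := 1)
          fun _ σ => (GhatakSherrington.overlap σ 0 0 - p) ^ 2) ∧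
        -- the normalizers are positive,
        0 < GhatakSherrington.M1 S β h cr p q ∧ 0 < GhatakSherrington.M2 S β h cr p q ∧
        0 < GhatakSherrington.M3 S β h cr p q ∧ 0 < GhatakSherrington.M0 S β h cr p q ∧
        -- the variances and the covariance,
        GhatakSherrington.IsON 3 (fun N => GhatakSherrington.nu N S β h cr (n := 1)
            (fun g σ => GhatakSherrington.compT N S β h cr 0 g σ ^ 2)
          - GhatakSherrington.A1sq N S β h cr p q) ∧
        GhatakSherrington.IsON 3 (fun N => GhatakSherrington.nu N S β h cr (n := 1)
            (fun g σ => GhatakSherrington.compS N S β h cr 0 g σ ^ 2)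
          - GhatakSherrington.B1sq N S β h cr p q) ∧
        GhatakSherrington.IsON 3 (fun N => GhatakSherrington.nu N S β h cr (n := 1)
            (fun g σ => GhatakSherrington.compS N S β h cr 0 g σ
              * GhatakSherrington.compT N S β h cr 0 g σ)
          - GhatakSherrington.C1sq N S β h cr p q) ∧
        -- and the second form of the two variances.
        (0 < β → ∀ N : ℕ, 1 ≤ N →
          GhatakSherrington.A1sq N S β h cr p q
            = 1 / (2 * β ^ 2 * (N : ℝ))
              * (1 / GhatakSherrington.M3 S β h cr p q
                - GhatakSherrington.M2 S β h cr p q / GhatakSherrington.M0 S β h cr p q) ∧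
          GhatakSherrington.B1sq N S β h cr p q
            = 2 / ((N : ℝ) * β ^ 2)
              * (GhatakSherrington.M1 S β h cr p q / GhatakSherrington.M0 S β h cr p q - 1)) := by
  -- the conditions `β² L ≤ 1` for the contraction and the concentration follow from `β L ≤ 1`
  set L : ℝ := 1 + 96 * (S : ℝ) ^ 4 + 4 * GhatakSherrington.concConst S 0
    + 4 * GhatakSherrington.concConst S 2 with hL
  have hc0 := GhatakSherrington.concConst_nonneg S 0
  have hc2 := GhatakSherrington.concConst_nonneg S 2
  have hS4 : 0 ≤ 96 * (S : ℝ) ^ 4 := by positivity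
  have hLpos : 0 < L := by linarith
  obtain ⟨K, hK0, hK⟩ := GhatakSherrington.exists_overlapMoment_le S
  refine ⟨1 / L, by positivity, fun β hβ0 hβ h _ cr => ?_⟩
  have hβL : β * L ≤ 1 := ((lt_div_iff₀ hLpos).1 hβ).le
  have hβ1 : β ≤ 1 := by nlinarith
  have hsq : β ^ 2 ≤ β := by nlinarith
  have hle : ∀ {c : ℝ}, 0 ≤ c → c ≤ L → β ^ 2 * c ≤ 1 := fun hc hcL =>
    (mul_le_mul hsq hcL hc hβ0).trans hβL
  have h1 : β ^ 2 ≤ 1 := hsq.trans hβ1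
  have h96 : 96 * (β ^ 2 * (S : ℝ) ^ 4) ≤ 1 := by
    linarith [hle hS4 (by linarith)]
  have h4 : 4 * (β ^ 2 * GhatakSherrington.concConst S 0) ≤ 1 := by
    linarith [hle (c := 4 * GhatakSherrington.concConst S 0) (by linarith) (by linarith)]
  have h4' : 4 * (β ^ 2 * GhatakSherrington.concConst S 2) ≤ 1 := by
    linarith [hle (c := 4 * GhatakSherrington.concConst S 2) (by linarith) (by linarith)]
  obtain ⟨p, q, hrs, huniq⟩ :=
    GhatakSherrington.exists_isReplicaSymmetric (h := h) (cr := cr) h96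
  have hKN : ∀ N : ℕ, 1 ≤ N → ∀ m ∈ Finset.Icc 1 4,
      GhatakSherrington.overlapMoment N S β h cr p q m ≤ K * (1 / √(N : ℝ)) ^ m :=
    fun N hN => hK N β h cr p q hN h1 h4 h4' hrs
  obtain ⟨m1, m2, m3, m0⟩ :=
    GhatakSherrington.normalizers_pos (h := h) (cr := cr) (p := p) (q := q) h96
  obtain ⟨hU, hP⟩ := GhatakSherrington.isON_overlap fun N hN => hKN N hN 2 (by decide)
  obtain ⟨sA, sB, sC⟩ :=
    GhatakSherrington.isSmall_components h1 hrs hK0 hKN m2.ne' m3.ne' m0.ne'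
  refine ⟨p, q, hrs, huniq, hU, hP, m1, m2, m3, m0, ?_, ?_, ?_, fun hpos N hN =>
    ⟨GhatakSherrington.A1sq_eq hpos hN m3.ne' m0.ne', GhatakSherrington.B1sq_eq hpos hN m0.ne'⟩⟩
  · exact (sA.congr fun N _ => by rw [GhatakSherrington.nu_compT_sq]).isON
  · exact (sB.congr fun N _ => by rw [GhatakSherrington.nu_compS_sq]).isON
  · exact (sC.congr fun N _ => by rw [GhatakSherrington.nu_compS_mul_compT]).isON
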